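/- **Model.** Let $\lambda_t>0$, $p\in[0,1]$, $\alpha>2$, $C_d,C_r,d_0,m_h,m_r,P,\sigma_0^2>0$, let $N\ge 1$ be an integer, $\gamma_t=P/\sigma_0^2$, and let $\bar\gamma\ge 0$ be the SINR threshold. Put $$e_1=C_d+NC_rd_0^{-\alpha},\qquad a=\frac{\Gamma(m_h+\frac12)}{\Gamma(m_h)}\,\frac{\Gamma(m_r+\frac12)}{\Gamma(m_r)}\,\frac1{\sqrt{m_hm_r}},\qquad M_1=Na,\qquad M_2=N+N(N-1)a^2,$$ $$\kappa_r=\frac{M_1^2}{M_2-M_1^2},\qquad \omega_r=\frac{M_2-M_1^2}{M_1},\qquad \mu^g_q=\Gamma(1+\tfrac q2),\qquad \mu^\varsigma_q=\omega_r^q\,\frac{\Gamma(q+\kappa_r)}{\Gamma(\kappa_r)},\qquad \beta=\sqrt{C_rd_0^{-\alpha}/C_d},$$ $$\chi_1=\mu^g_2+2\beta\mu^g_1\mu^\varsigma_1+\beta^2\mu^\varsigma_2,\qquad \chi_2=\mu^g_4+4\beta\mu^g_3\mu^\varsigma_1+6\beta^2\mu^g_2\mu^\varsigma_2+4\beta^3\mu^g_1\mu^\varsigma_3+\beta^4\mu^\varsigma_4,$$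 $$\bar\chi=\frac{\chi_2-\chi_1^2}{\chi_1},\qquad \kappa_s=\frac{\chi_1^2}{\chi_2-\chi_1^2},\qquad \hat\kappa_s=\text{the positive integer nearest to }\kappa_s\ \text{(ties rounded up)}.$$ The transmitters form a homogeneous Poisson point process of density $\lambda_t$ in $\mathbb R^2$, and the user is at the origin. Each transmitter $k$, at distance $d_k$ from the user, has a reconfigurable intelligent surface (RIS) with $N$ elements with probability $p$, and none otherwise. The RIS indicators and the fading variables below are independent of the positions, are independent between different transmitters, and for each transmitter the indicator is independent of the fading. Write $\eta_g(d)=C_dd^{-\alpha}$ and $\eta_h(d)=C_r(d_0d)^{-\alpha}$. Under the Gaussian (central limit), moment-matching gamma and far-field (distance from RIS to user equal to distance from transmitter to user) approximations: * an interfering transmitter with an RIS contributes the power $|\sqrt{\eta_g(d_k)}\,g_k+\sqrt{\eta_h(d_k)}\,I_{r,k}|^2$, and one without an RIS contributes $\eta_g(d_k)|g_k|^2$, where $g_k\sim\mathcal{CN}(0,1)$ and $I_{r,k}\sim\mathcal{CN}(0,N)$ are independent; * the serving transmitter, at distance $d$, gives the signal power $S_0^+=\eta_g(d)\,G$ if it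 has an RIS, where $G$ has the gamma law with shape $\hat\kappa_s$ and scale $\bar\chi$ (so that $S_0^+$ has scale $\omega_s=\eta_g(d)\bar\chi$), and $S_0^*=\eta_g(d)|g|^2$ with $g\sim\mathcal{CN}(0,1)$ if it has none. The user is served by the nearest transmitter; the SINR $\gamma_0$ is the signal power divided by $I+\gamma_t^{-1}$, where $I$ is the sum of the powers of all other transmitters. The coverage probability is $P_{c,n}(\bar\gamma)=\mathbb P(\gamma_0>\bar\gamma)$. **Proposition.** With $f(r)=2\pi\lambda_t r\,e^{-\pi\lambda_t r^2}$, $$P_{c,n}(\bar\gamma)=p\int_0^\infty q^+(r)f(r)\,dr+(1-p)\int_0^\infty q^*(r)f(r)\,dr,$$ where, writing $H(x)={}_2F_1\left(1,-\tfrac2\alpha;1-\tfrac2\alpha;x\right)$ (principal branch, analytically continued to $x<1$), $$q^+(r)=\sum_{i=0}^{\hat\kappa_s-1}\frac{(-1)^i}{i!}\left[\frac{\partial^i}{\partial s^i}\exp(W(s,r))\right]_{s=1},$$ $$W(s,r)=-\frac{\bar\gamma\gamma_t^{-1}}{C_d\bar\chi}r^\alpha s+\pi\lambda_tr^2-\pi\lambda_tp\,r^2H\left(-\frac{e_1\bar\gamma}{C_d\bar\chi}s\right)-\pi\lambda_t(1-p)r^2H\left(-\frac{\bar\gamma}{\bar\chi}s\right),$$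 $$q^*(r)=\exp\left(-\frac{\bar\gamma\gamma_t^{-1}}{C_d}r^\alpha+\pi\lambda_tr^2-\pi\lambda_tp\,r^2H\left(-\frac{e_1\bar\gamma}{C_d}\right)-\pi\lambda_t(1-p)r^2H(-\bar\gamma)\right).$$ Moreover, for every $r>0$ the function $s\mapsto\exp(W(s,r))$ is smooth at $s=1$, and both integrands are integrable on $(0,\infty)$. -/

import Mathlib

open MeasureTheory ProbabilityTheory Set
open scoped ENNReal NNReal

noncomputable section

namespace RISNet

/-! ### The Gauss hypergeometric function -/

/-- `F` is the principal branch of `₂F₁(a, b; c; ·)`: it is holomorphic on the plane cut along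
`[1, ∞)` and it is the sum of the Gauss series on the open unit disc. Such an `F` is unique on
the cut plane. -/
def IsPrincipalHyp2F1 (a b c : ℂ) (F : ℂ → ℂ) : Prop :=
  DifferentiableOn ℂ F {z : ℂ | 1 - z ∈ Complex.slitPlane} ∧
    ∀ z : ℂ, ‖z‖ < 1 → F z = ordinaryHypergeometric a b c z

/-- `₂F₁(a, b; c; x)` for real parameters and real `x < 1` (principal branch). -/
def hyp2F1 (a b c x : ℝ) : ℝ :=
  (Classical.epsilon (IsPrincipalHyp2F1 (a : ℂ) (b : ℂ) (c : ℂ)) (x : ℂ)).re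

/-! ### Parameters of the network -/

/-- The deterministic parameters of the network. -/
structure Params where
  /-- density of the transmitters -/
  lam : ℝ
  /-- probability that a transmitter has an assisting RIS -/
  p : ℝ
  /-- path loss exponent -/
  α : ℝ
  /-- path loss per unit distance of the direct link -/
  Cd : ℝ
  /-- path loss per unit distance of the reflected link -/
  Cr : ℝ
  /-- distance between a transmitter and its RIS -/
  d₀ : ℝ
  /-- number of elements of each RIS -/
  N : ℕ
  /-- Nakagami shape parameter of the transmitter-RIS links -/
  mh : ℝ
  /-- Nakagami shape parameter of the RIS-user links -/
  mr : ℝ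
  /-- transmit power -/
  P : ℝ
  /-- noise variance -/
  σsq : ℝ

/-- The admissible parameter range. -/
structure Params.Admissible (θ : Params) : Prop where
  lam_pos : 0 < θ.lam
  p_nonneg : 0 ≤ θ.p
  p_le_one : θ.p ≤ 1
  two_lt_α : 2 < θ.α
  Cd_pos : 0 < θ.Cd
  Cr_pos : 0 < θ.Cr
  d₀_pos : 0 < θ.d₀
  one_le_N : 1 ≤ θ.N
  mh_pos : 0 < θ.mh
  mr_pos : 0 < θ.mr
  P_pos : 0 < θ.P
  σsq_pos : 0 < θ.σsq

namespace Params

variable (θ : Params)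

/-- Transmit signal-to-noise ratio `γ_t = P / σ₀²`. -/
def γt : ℝ := θ.P / θ.σsq

/-- Path loss of a direct link of length `d`. -/
def ηg (d : ℝ) : ℝ := θ.Cd * d ^ (-θ.α)

/-- Path loss of the reflected path through the RIS of a transmitter at distance `d` from the
user; the RIS-user distance is identified with `d`. -/
def ηh (d : ℝ) : ℝ := θ.Cr * (θ.d₀ * d) ^ (-θ.α)

/-- The constant `e₁ = C_d + N C_r d₀^{-α}`. -/
def e₁ : ℝ := θ.Cd + θ.N * θ.Cr * θ.d₀ ^ (-θ.α)

/-- The mean of the product of two independent Nakagami amplitudes with shape parameters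
`m_h`, `m_r` and unit spread. -/
def meanProd : ℝ :=
  Real.Gamma (θ.mh + 1 / 2) / Real.Gamma θ.mh * (Real.Gamma (θ.mr + 1 / 2) / Real.Gamma θ.mr) *
    √(1 / (θ.mh * θ.mr))

/-- First moment of `S_r = ∑ₙ |h_{0,n}| |r_{0,n}|`. -/
def ESr : ℝ := θ.N * θ.meanProd

/-- Second moment of `S_r`. -/
def ESr2 : ℝ := θ.N + θ.N * (θ.N - 1) * θ.meanProd ^ 2

/-- Shape of the gamma law fitted to `S_r`. -/
def κr : ℝ := θ.ESr ^ 2 / (θ.ESr2 - θ.ESr ^ 2)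

/-- Scale of the gamma law fitted to `S_r`. -/
def ωr : ℝ := (θ.ESr2 - θ.ESr ^ 2) / θ.ESr

/-- `q`-th moment of the Rayleigh amplitude `|g₀|`. -/
def μg (q : ℕ) : ℝ := Real.Gamma (1 + (q : ℝ) / 2)

/-- `q`-th moment of the gamma law fitted to `S_r`. -/
def μς (q : ℕ) : ℝ := θ.ωr ^ q * (Real.Gamma (q + θ.κr) / Real.Gamma θ.κr)

/-- `β = √(η_h / η_g)`, which does not depend on the distance. -/
def β : ℝ := √(θ.Cr * θ.d₀ ^ (-θ.α) / θ.Cd)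

/-- `χ₁ = 𝔼[S₀⁺] / η_g`. -/
def χ₁ : ℝ := μg 2 + 2 * θ.β * μg 1 * θ.μς 1 + θ.β ^ 2 * θ.μς 2

/-- `χ₂ = 𝔼[(S₀⁺)²] / η_g²`. -/
def χ₂ : ℝ :=
  μg 4 + 4 * θ.β * μg 3 * θ.μς 1 + 6 * θ.β ^ 2 * μg 2 * θ.μς 2 +
    4 * θ.β ^ 3 * μg 1 * θ.μς 3 + θ.β ^ 4 * θ.μς 4

/-- `χ̄ = (χ₂ - χ₁²) / χ₁`, so that the scale of the gamma law fitted to `S₀⁺` is `η_g χ̄`. -/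
def χbar : ℝ := (θ.χ₂ - θ.χ₁ ^ 2) / θ.χ₁

/-- Shape of the gamma law fitted to `S₀⁺`, before rounding. -/
def κs : ℝ := θ.χ₁ ^ 2 / (θ.χ₂ - θ.χ₁ ^ 2)

/-- The positive integer nearest to `κ_s`. -/
def κhat : ℕ := max 1 (round θ.κs).toNat

end Params

/-! ### The probabilistic model -/

/-- The plane. -/
abbrev Plane : Type := EuclideanSpace ℝ (Fin 2)

/-- The circularly symmetric complex Gaussian law `𝒞𝒩(0, v)`. -/
def complexGaussian (v : ℝ≥0) : Measure ℂ :=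
  ((gaussianReal 0 (v / 2)).prod (gaussianReal 0 (v / 2))).map
    Complex.measurableEquivRealProd.symm

variable {Ω : Type*} [MeasurableSpace Ω]

/-- Number of points of the sequence `X` that lie in `B`. -/
def pointCount (X : ℕ → Ω → Plane) (B : Set Plane) (ω : Ω) : ℕ∞ :=
  {n : ℕ | X n ω ∈ B}.encard

/-- The points `X 0, X 1, …` (in any measurable enumeration) form a homogeneous Poisson point
process of density `lam` on the plane. -/
structure IsHPPP (lam : ℝ) (X : ℕ → Ω → Plane) (μ : Measure Ω) : Prop where
  measurable_point : ∀ n, Measurable (X n)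
  count_law : ∀ B : Set Plane, MeasurableSet B → volume B ≠ ∞ →
    HasLaw (pointCount X B)
      ((poissonMeasure (ENNReal.ofReal lam * volume B).toNNReal).map (Nat.cast : ℕ → ℕ∞)) μ
  count_indep : ∀ (m : ℕ) (B : Fin m → Set Plane), (∀ i, MeasurableSet (B i)) →
    (∀ i, volume (B i) ≠ ∞) → Pairwise (fun i j => Disjoint (B i) (B j)) →
    iIndepFun (fun i => pointCount X (B i)) μ

/-- The random network seen from a user at the origin. For the `k`-th transmitter, `X k` is its
position, `b k` tells whether it has an assisting RIS, `g k` is the fading of its direct link,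
`Ir k` is the (Gaussian) sum of the reflected paths when it interferes, and `G k` is the
distance-free power gain `S₀⁺ / η_g` when it serves the user with an aligned RIS. -/
structure IsNetwork (θ : Params) (μ : Measure Ω) (X : ℕ → Ω → Plane) (b : ℕ → Ω → Bool)
    (g Ir : ℕ → Ω → ℂ) (G : ℕ → Ω → ℝ) : Prop where
  hppp : IsHPPP θ.lam X μ
  b_meas : ∀ k, Measurable (b k)
  b_law : ∀ k, μ {ω | b k ω = true} = ENNReal.ofReal θ.p
  g_meas : ∀ k, Measurable (g k)
  g_law : ∀ k, HasLaw (g k) (complexGaussian 1) μ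
  Ir_meas : ∀ k, Measurable (Ir k)
  Ir_law : ∀ k, HasLaw (Ir k) (complexGaussian θ.N) μ
  G_meas : ∀ k, Measurable (G k)
  G_law : ∀ k, HasLaw (G k) (gammaMeasure θ.κhat (1 / θ.χbar)) μ
  /-- direct and reflected fading of one transmitter are independent -/
  g_indep_Ir : ∀ k, IndepFun (g k) (Ir k) μ
  /-- the presence of an RIS is independent of the fading -/
  b_indep : ∀ k, IndepFun (b k) (fun ω => (g k ω, Ir k ω, G k ω)) μ
  /-- different transmitters are independent -/
  marks_indep : iIndepFun (fun k ω => (b k ω, g k ω, Ir k ω, G k ω)) μ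
  /-- the positions are independent of everything else -/
  position_indep : IndepFun (fun ω k => X k ω) (fun ω k => (b k ω, g k ω, Ir k ω, G k ω)) μ

/-- The index of the transmitter nearest to the user (almost surely unique). -/
def nearest (X : ℕ → Ω → Plane) (ω : Ω) : ℕ :=
  Classical.epsilon fun k : ℕ => ∀ m : ℕ, ‖X k ω‖ ≤ ‖X m ω‖

/-- Signal power received when transmitter `k` serves the user: `S₀⁺` with RIS, `S₀*` without. -/
def signalPower (θ : Params) (X : ℕ → Ω → Plane) (b : ℕ → Ω → Bool) (g : ℕ → Ω → ℂ)
    (G : ℕ → Ω → ℝ) (k : ℕ) (ω : Ω) : ℝ :=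
  if b k ω = true then θ.ηg ‖X k ω‖ * G k ω else θ.ηg ‖X k ω‖ * ‖g k ω‖ ^ 2

/-- Power received from transmitter `k` when it interferes: `I_{1,k}` with RIS, `I_{2,k}`
without. -/
def interfererPower (θ : Params) (X : ℕ → Ω → Plane) (b : ℕ → Ω → Bool) (g Ir : ℕ → Ω → ℂ)
    (k : ℕ) (ω : Ω) : ℝ :=
  if b k ω = true then
    ‖((√(θ.ηg ‖X k ω‖) : ℝ) : ℂ) * g k ω + ((√(θ.ηh ‖X k ω‖) : ℝ) : ℂ) * Ir k ω‖ ^ 2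
  else ‖((√(θ.ηg ‖X k ω‖) : ℝ) : ℂ) * g k ω‖ ^ 2

/-- Total interference power when transmitter `i` serves the user. -/
def interference (θ : Params) (X : ℕ → Ω → Plane) (b : ℕ → Ω → Bool) (g Ir : ℕ → Ω → ℂ)
    (i : ℕ) (ω : Ω) : ℝ≥0∞ :=
  ∑' k : ℕ, if k = i then 0 else ENNReal.ofReal (interfererPower θ X b g Ir k ω)

/-- SINR of the user under nearest association. -/
def sinr (θ : Params) (X : ℕ → Ω → Plane) (b : ℕ → Ω → Bool) (g Ir : ℕ → Ω → ℂ)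
    (G : ℕ → Ω → ℝ) (ω : Ω) : ℝ≥0∞ :=
  ENNReal.ofReal (signalPower θ X b g G (nearest X ω) ω) /
    (interference θ X b g Ir (nearest X ω) ω + ENNReal.ofReal θ.γt⁻¹)

/-- Coverage probability under nearest association, for the SINR threshold `γ`. -/
def coverage (θ : Params) (μ : Measure Ω) (X : ℕ → Ω → Plane) (b : ℕ → Ω → Bool)
    (g Ir : ℕ → Ω → ℂ) (G : ℕ → Ω → ℝ) (γ : ℝ) : ℝ :=
  μ.real {ω | ENNReal.ofReal γ < sinr θ X b g Ir G ω}

/-! ### The closed-form expressions -/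

namespace Params

variable (θ : Params)

/-- Density of the distance to the nearest transmitter. -/
def distPDF (r : ℝ) : ℝ :=
  2 * Real.pi * θ.lam * r * Real.exp (-(Real.pi * θ.lam * r ^ 2))

/-- The function `₂F₁(1, -2/α; 1 - 2/α; x)`. -/
def hyp (x : ℝ) : ℝ := hyp2F1 1 (-(2 / θ.α)) (1 - 2 / θ.α) x

/-- The exponent `W(s, r)`. -/
def W (γ s r : ℝ) : ℝ :=
  -(γ * θ.γt⁻¹ / (θ.Cd * θ.χbar)) * r ^ θ.α * s + Real.pi * θ.lam * r ^ 2
    - Real.pi * θ.lam * θ.p * r ^ 2 * θ.hyp (-(θ.e₁ * γ / (θ.Cd * θ.χbar) * s))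
    - Real.pi * θ.lam * (1 - θ.p) * r ^ 2 * θ.hyp (-(γ / θ.χbar * s))

/-- The function `q⁺(r)`. -/
def qPlus (γ r : ℝ) : ℝ :=
  ∑ i ∈ Finset.range θ.κhat,
    (-1) ^ i / (Nat.factorial i : ℝ) * iteratedDeriv i (fun s => Real.exp (θ.W γ s r)) 1

/-- The function `q*(r)`. -/
def qStar (γ r : ℝ) : ℝ :=
  Real.exp (-(γ * θ.γt⁻¹ / θ.Cd) * r ^ θ.α + Real.pi * θ.lam * r ^ 2
    - Real.pi * θ.lam * θ.p * r ^ 2 * θ.hyp (-(θ.e₁ * γ / θ.Cd))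
    - Real.pi * θ.lam * (1 - θ.p) * r ^ 2 * θ.hyp (-γ))

end Params

end RISNet

end

noncomputable section

namespace RISNet

/-! Condition on the distance `r` to the nearest transmitter. If the interference is `y`, coverage
means that the serving gain exceeds a level affine in `y`. A gamma gain of integer shape `k` has the
tail `e^{-z} ∑_{i<k} zⁱ/i!` at the normalised level `z`, and an exponential gain has the tail
`e^{-z}`. Averaged over `y`, the factor `e^{-z}` produces the noise factor times the conditional
Laplace transform of the interference, and `zⁱ e^{-z}` is `(-1)ⁱ` times the `i`-th derivative of
`e^{-sz}` at `s = 1`. Since `e^{W(s,r)}` is the conditional mean of `e^{-sz}`, the formulas follow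
once the Laplace transform of the interference given `r` is known to be `condLaplace`.

That transform is found without Palm calculus. With the positions frozen, the marks are independent,
so the transform is the product of `φ_s(‖X_k‖)` over the non-serving transmitters, where `φ_s` is
`interfLaplace`. Apply the Laplace functional of the Poisson process to the function that is `∞` on
the disc of radius `r` and `-log φ_s` outside. With `R` the nearest distance this gives `E[1_{R>r}
∏_k φ_s(‖X_k‖)] = exp(-2πλ V_s(r))`, where `V_s` is `voidExponent` and `V_s'(r) = r φ_s(r)`.
Differentiating in `r` yields the density of `R` under the law tilted by the full product. Dividing
by `φ_s(R)` removes exactly the factor of the serving transmitter; this is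
`lintegral_dist_expNeg_interf`.

The integral in `V_s` becomes, under `t = x^{-α}`, the Euler integral of `₂F₁(1, -2/α; 1 - 2/α; ·)`.
That integral is holomorphic on the cut plane and sums the Gauss series on the disc, so the identity
theorem equates it with the principal branch.

Two points of rigour remain. The joint transform of `(R, I)` gives the transform of a regular
conditional law first for rational `s`, almost surely, and then for all `s` by continuity. Letting
`s → 0` shows that the interference is almost surely finite. -/

/-! ### Positivity of the moment-matching parameters. -/

theorem Gamma_add_half_sq_le {m : ℝ} (hm : 0 < m) :
    Real.Gamma (m + 1 / 2) ^ 2 ≤ m * Real.Gamma m ^ 2 := by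
  have h := Real.Gamma_mul_add_mul_le_rpow_Gamma_mul_rpow_Gamma (s := m) (t := m + 1)
    (a := 1 / 2) (b := 1 / 2) hm (by linarith) (by norm_num) (by norm_num) (by norm_num)
  have e : (1 / 2 : ℝ) * m + 1 / 2 * (m + 1) = m + 1 / 2 := by ring
  have hG := Real.Gamma_pos_of_pos hm
  rw [e, Real.Gamma_add_one hm.ne', ← Real.sqrt_eq_rpow, ← Real.sqrt_eq_rpow,
    ← Real.sqrt_mul hG.le] at h
  calc Real.Gamma (m + 1 / 2) ^ 2 ≤ √(Real.Gamma m * (m * Real.Gamma m)) ^ 2 := by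
        have := (Real.Gamma_pos_of_pos (show 0 < m + 1 / 2 by linarith)).le
        gcongr
    _ = m * Real.Gamma m ^ 2 := by rw [Real.sq_sqrt (by positivity)]; ring

/-- Log-convexity gives only `≤`. Strictness comes from using that bound at `m + 1` and descending
by the functional equation: the ratio of the constants is `m (m + 1) / (m + 1/2)²`, which is less
than `1`. -/
theorem Gamma_add_half_sq_lt {m : ℝ} (hm : 0 < m) :
    Real.Gamma (m + 1 / 2) ^ 2 < m * Real.Gamma m ^ 2 := by
  have h := Gamma_add_half_sq_le (show 0 < m + 1 by linarith)
  have e : m + 1 + 1 / 2 = (m + 1 / 2) + 1 := by ring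
  rw [e, Real.Gamma_add_one hm.ne', Real.Gamma_add_one (by linarith), mul_pow, mul_pow] at h
  have hG : 0 < Real.Gamma m ^ 2 := pow_pos (Real.Gamma_pos_of_pos hm) 2
  have h2 : (m + 1 / 2) ^ 2 * Real.Gamma (m + 1 / 2) ^ 2 <
      (m + 1 / 2) ^ 2 * (m * Real.Gamma m ^ 2) := by
    refine h.trans_lt ?_
    have : 0 < m * Real.Gamma m ^ 2 := by positivity
    nlinarith
  exact lt_of_mul_lt_mul_left h2 (by positivity)

namespace Params

variable {θ : Params}

theorem Admissible.meanProd_pos (h : θ.Admissible) : 0 < θ.meanProd := by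
  have h1 := Real.Gamma_pos_of_pos h.mh_pos
  have h2 := Real.Gamma_pos_of_pos h.mr_pos
  have h3 := Real.Gamma_pos_of_pos (show 0 < θ.mh + 1 / 2 by linarith [h.mh_pos])
  have h4 := Real.Gamma_pos_of_pos (show 0 < θ.mr + 1 / 2 by linarith [h.mr_pos])
  have h5 := h.mh_pos
  have h6 := h.mr_pos
  unfold meanProd
  positivity

/-- The two strict Gamma bounds multiply to `m_h m_r`, which cancels the normalisation. This makes
the variance `N (1 - a²)` of `S_r` positive, so the first gamma fit is not degenerate. -/
theorem Admissible.meanProd_sq_lt_one (h : θ.Admissible) : θ.meanProd ^ 2 < 1 := by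
  have h1 := Real.Gamma_pos_of_pos h.mh_pos
  have h2 := Real.Gamma_pos_of_pos h.mr_pos
  have h5 := h.mh_pos
  have h6 := h.mr_pos
  have h7 := Gamma_add_half_sq_lt h5
  have h8 := Gamma_add_half_sq_lt h6
  unfold meanProd
  rw [mul_pow, mul_pow, Real.sq_sqrt (by positivity), div_pow, div_pow, div_mul_div_comm,
    div_mul_div_comm, div_lt_one (by positivity)]
  have := mul_lt_mul'' h7 h8 (by positivity) (by positivity)
  linarith

theorem Admissible.ESr_pos (h : θ.Admissible) : 0 < θ.ESr := by
  have := h.meanProd_pos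
  have h1 : (1 : ℝ) ≤ θ.N := by exact_mod_cast h.one_le_N
  unfold ESr
  positivity

theorem Admissible.ESr2_sub_pos (h : θ.Admissible) : 0 < θ.ESr2 - θ.ESr ^ 2 := by
  have h1 : (1 : ℝ) ≤ θ.N := by exact_mod_cast h.one_le_N
  have := h.meanProd_sq_lt_one
  have e : θ.ESr2 - θ.ESr ^ 2 = θ.N * (1 - θ.meanProd ^ 2) := by
    unfold ESr2 ESr; ring
  rw [e]
  apply mul_pos <;> linarith

theorem Admissible.κr_pos (h : θ.Admissible) : 0 < θ.κr :=
  div_pos (pow_pos h.ESr_pos 2) h.ESr2_sub_pos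

theorem Admissible.ωr_pos (h : θ.Admissible) : 0 < θ.ωr := div_pos h.ESr2_sub_pos h.ESr_pos

theorem Admissible.β_pos (h : θ.Admissible) : 0 < θ.β := by
  have h1 := h.Cr_pos
  have h2 := h.Cd_pos
  have h3 := Real.rpow_pos_of_pos h.d₀_pos (-θ.α)
  unfold β
  positivity

theorem Admissible.μς_pos (h : θ.Admissible) (q : ℕ) : 0 < θ.μς q := by
  have := h.ωr_pos
  have h1 := Real.Gamma_pos_of_pos h.κr_pos
  have h2 := Real.Gamma_pos_of_pos (show 0 < q + θ.κr by linarith [h.κr_pos, q.cast_nonneg (α := ℝ)])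
  unfold μς
  positivity

theorem Admissible.μς_succ (h : θ.Admissible) (q : ℕ) :
    θ.μς (q + 1) = θ.ωr * (q + θ.κr) * θ.μς q := by
  have h1 := Real.Gamma_pos_of_pos h.κr_pos
  have h2 : (q : ℝ) + θ.κr ≠ 0 := by linarith [h.κr_pos, q.cast_nonneg (α := ℝ)]
  have e : ((q + 1 : ℕ) : ℝ) + θ.κr = (q + θ.κr) + 1 := by push_cast; ring
  unfold μς
  rw [e, Real.Gamma_add_one h2]
  field_simp
  ring

theorem μg_succ_succ (q : ℕ) : μg (q + 2) = (1 + q / 2) * μg q := by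
  have e : 1 + ((q + 2 : ℕ) : ℝ) / 2 = (1 + q / 2) + 1 := by push_cast; ring
  unfold μg
  rw [e, Real.Gamma_add_one (by positivity)]

theorem μg_pos (q : ℕ) : 0 < μg q := Real.Gamma_pos_of_pos (by positivity)

theorem Admissible.χ₁_pos (h : θ.Admissible) : 0 < θ.χ₁ := by
  have h1 := h.β_pos
  have h2 := h.μς_pos 1
  have h3 := h.μς_pos 2
  have h4 := μg_pos 1
  have h5 := μg_pos 2
  unfold χ₁
  positivity

/-- This is the variance of `(|g| + βS)²`, with `S` gamma distributed. The moment recurrences reduce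
it to a polynomial with visibly nonnegative terms, so no random variable has to be constructed. It
makes `χbar` a legitimate gamma scale. -/
theorem Admissible.χ₂_sub_pos (h : θ.Admissible) : 0 < θ.χ₂ - θ.χ₁ ^ 2 := by
  have hβ := h.β_pos
  have hκ := h.κr_pos
  have hω := h.ωr_pos
  have s0 : θ.μς 0 = 1 := by
    unfold μς
    simp [(Real.Gamma_pos_of_pos hκ).ne']
  have s1 : θ.μς 1 = θ.ωr * θ.κr := by rw [h.μς_succ 0, s0]; simp
  have s2 : θ.μς 2 = θ.ωr * (1 + θ.κr) * θ.μς 1 := by rw [h.μς_succ 1]; simp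
  have s3 : θ.μς 3 = θ.ωr * (2 + θ.κr) * θ.μς 2 := by rw [h.μς_succ 2]; simp
  have s4 : θ.μς 4 = θ.ωr * (3 + θ.κr) * θ.μς 3 := by rw [h.μς_succ 3]; simp
  have g0 : μg 0 = 1 := by unfold μg; simp
  have g2 : μg 2 = 1 := by rw [μg_succ_succ 0, g0]; simp
  have g4 : μg 4 = 2 := by rw [μg_succ_succ 2, g2]; norm_num
  have g3 : μg 3 = 3 / 2 * μg 1 := by rw [μg_succ_succ 1]; norm_num
  have g1 : μg 1 < 1 := by
    unfold μg
    have := Real.Gamma_three_div_two_lt_one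
    norm_num at this ⊢
    exact this
  have g1' := μg_pos 1
  -- Grouped by powers of `β`. The brackets are the variance of `|g| S`, the covariance of `S` and
  -- `S²`, and the variance of `S²`; the constant `1` gives strictness.
  have e : θ.χ₂ - θ.χ₁ ^ 2 = 1 + 2 * θ.β * μg 1 * θ.μς 1 +
      4 * θ.β ^ 2 * (θ.μς 2 - μg 1 ^ 2 * θ.μς 1 ^ 2) +
      4 * θ.β ^ 3 * μg 1 * (θ.μς 3 - θ.μς 1 * θ.μς 2) + θ.β ^ 4 * (θ.μς 4 - θ.μς 2 ^ 2) := by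
    unfold χ₂ χ₁
    rw [g2, g4, g3]
    ring
  have a1 := h.μς_pos 1
  have a2 := h.μς_pos 2
  have a3 := h.μς_pos 3
  have b2 : 0 ≤ θ.μς 2 - μg 1 ^ 2 * θ.μς 1 ^ 2 := by
    have : μg 1 ^ 2 ≤ 1 := pow_le_one₀ g1'.le g1.le
    have h2 : μg 1 ^ 2 * θ.μς 1 ^ 2 ≤ 1 * θ.μς 1 ^ 2 := by gcongr
    have h3 : θ.μς 2 = θ.μς 1 ^ 2 + θ.ωr * θ.μς 1 := by rw [s2]; nth_rw 2 [s1]; nth_rw 2 [s1]; rw [s1]; ring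
    nlinarith [mul_pos hω a1]
  have b3 : 0 ≤ θ.μς 3 - θ.μς 1 * θ.μς 2 := by
    have : θ.μς 3 - θ.μς 1 * θ.μς 2 = 2 * θ.ωr * θ.μς 2 := by rw [s3, s1]; ring
    rw [this]; positivity
  have b4 : 0 ≤ θ.μς 4 - θ.μς 2 ^ 2 := by
    have : θ.μς 4 - θ.μς 2 ^ 2 = θ.ωr ^ 2 * θ.μς 2 * (6 + 4 * θ.κr) := by
      rw [s4, s3, s2, s1]; ring
    rw [this]; positivity
  rw [e]
  positivity

theorem Admissible.χbar_pos (h : θ.Admissible) : 0 < θ.χbar := div_pos h.χ₂_sub_pos h.χ₁_pos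

theorem κhat_pos (θ : Params) : 0 < θ.κhat := lt_of_lt_of_le one_pos (le_max_left _ _)

theorem Admissible.γt_pos (h : θ.Admissible) : 0 < θ.γt := div_pos h.P_pos h.σsq_pos

theorem Admissible.ηg_pos (h : θ.Admissible) {d : ℝ} (hd : 0 < d) : 0 < θ.ηg d :=
  mul_pos h.Cd_pos (Real.rpow_pos_of_pos hd _)

theorem Admissible.e₁_pos (h : θ.Admissible) : 0 < θ.e₁ := by
  have h1 := h.Cd_pos
  have h2 := h.Cr_pos
  have h3 := Real.rpow_pos_of_pos h.d₀_pos (-θ.α)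
  unfold e₁
  positivity

end Params

/-! ### The principal branch of the hypergeometric function through its Euler integral. -/

/-- The domain of the principal branch of `₂F₁`. -/
def cutPlane : Set ℂ := {z : ℂ | 1 - z ∈ Complex.slitPlane}

theorem isOpen_cutPlane : IsOpen cutPlane :=
  Complex.isOpen_slitPlane.preimage (continuous_const.sub continuous_id)

theorem isPreconnected_cutPlane : IsPreconnected cutPlane := by
  have h : cutPlane = (fun z : ℂ => 1 - z) '' Complex.slitPlane := by
    ext z
    constructor
    · intro hz
      exact ⟨1 - z, hz, by ring⟩
    · rintro ⟨w, hw, rfl⟩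
      simpa [cutPlane] using hw
  rw [h]
  refine IsPreconnected.image ?_ _ (by fun_prop)
  exact (Complex.starConvex_one_slitPlane.isPathConnected
    Complex.one_mem_slitPlane).isConnected.isPreconnected

theorem mem_cutPlane_of_norm_lt_one {z : ℂ} (hz : ‖z‖ < 1) : z ∈ cutPlane := by
  left
  have := Complex.re_le_norm z
  simp
  linarith

theorem ofReal_mem_cutPlane {x : ℝ} (hx : x < 1) : (x : ℂ) ∈ cutPlane := by
  left
  simpa using hx

/-- Identity theorem: the cut plane is connected and both functions equal the Gauss series near `0`.
Hence the choice made by `Classical.epsilon` is irrelevant on the cut plane, once one principal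
branch is exhibited. -/
theorem IsPrincipalHyp2F1.eqOn {a b c : ℂ} {F F' : ℂ → ℂ} (hF : IsPrincipalHyp2F1 a b c F)
    (hF' : IsPrincipalHyp2F1 a b c F') : EqOn F F' cutPlane := by
  refine AnalyticOnNhd.eqOn_of_preconnected_of_eventuallyEq
    (DifferentiableOn.analyticOnNhd hF.1 isOpen_cutPlane)
    (DifferentiableOn.analyticOnNhd hF'.1 isOpen_cutPlane) isPreconnected_cutPlane
    (mem_cutPlane_of_norm_lt_one (z := 0) (by simp)) ?_
  filter_upwards [Metric.ball_mem_nhds (0 : ℂ) one_pos] with z hz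
  have hz' : ‖z‖ < 1 := by simpa using hz
  rw [hF.2 z hz', hF'.2 z hz']

/-- `1 - t z` lies on the segment from `1` to `1 - z`, and the slit plane is star-shaped about `1`.
So the denominator of the Euler integrand never vanishes. -/
theorem one_sub_ofReal_mul_mem_slitPlane {z : ℂ} (hz : z ∈ cutPlane) {t : ℝ} (ht : t ∈ Icc (0 : ℝ) 1) :
    1 - (t : ℂ) * z ∈ Complex.slitPlane := by
  have h := Complex.starConvex_one_slitPlane hz (a := 1 - t) (b := t) (by linarith [ht.2]) ht.1
    (by ring)
  have e : (1 - t) • (1 : ℂ) + t • (1 - z) = 1 - (t : ℂ) * z := by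
    simp only [Complex.real_smul]
    push_cast
    ring
  rwa [e] at h

/-- The Cauchy-type integral `∫₀¹ t^{-δ} / (1 - t z) dt`. -/
def stieltjesInt (δ : ℝ) (z : ℂ) : ℂ :=
  ∫ t in Ioo (0 : ℝ) 1, ((t ^ (-δ) : ℝ) : ℂ) * (1 - (t : ℂ) * z)⁻¹

/-- Integral representation of `₂F₁(1, -δ; 1 - δ; z)`. -/
def eulerHyp (δ : ℝ) (z : ℂ) : ℂ := 1 - δ * z * stieltjesInt δ z

theorem integrableOn_rpow_neg {δ : ℝ} (hδ : δ < 1) :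
    IntegrableOn (fun t : ℝ => t ^ (-δ)) (Ioo 0 1) :=
  (intervalIntegral.integrableOn_Ioo_rpow_iff one_pos).2 (by linarith)

theorem aestronglyMeasurable_stieltjes (δ : ℝ) (z : ℂ) :
    AEStronglyMeasurable (fun t : ℝ => ((t ^ (-δ) : ℝ) : ℂ) * (1 - (t : ℂ) * z)⁻¹)
      (volume.restrict (Ioo (0 : ℝ) 1)) := by
  apply Measurable.aestronglyMeasurable
  fun_prop

theorem exists_pos_le_norm_one_sub {K : Set ℂ} (hK : IsCompact K) (hKU : K ⊆ cutPlane) :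
    ∃ m : ℝ, 0 < m ∧ ∀ t ∈ Icc (0 : ℝ) 1, ∀ z ∈ K, m ≤ ‖1 - (t : ℂ) * z‖ := by
  rcases K.eq_empty_or_nonempty with rfl | hne
  · exact ⟨1, one_pos, by simp⟩
  obtain ⟨p, hp, hmin⟩ := ((isCompact_Icc (a := (0 : ℝ)) (b := 1)).prod hK).exists_isMinOn
    ((nonempty_Icc.2 zero_le_one).prod hne)
    (f := fun p : ℝ × ℂ => ‖1 - (p.1 : ℂ) * p.2‖) (by fun_prop)
  refine ⟨_, norm_pos_iff.2 (Complex.slitPlane_ne_zero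
    (one_sub_ofReal_mul_mem_slitPlane (hKU hp.2) hp.1)), fun t ht z hz => ?_⟩
  exact hmin (mk_mem_prod ht hz)

/-- Differentiation under the integral sign: on a closed ball inside the cut plane `|1 - t z|` has a
positive minimum `m`, so `t^{-δ} / m²` dominates the derivative, and it is integrable because `δ <
1`. -/
theorem differentiableOn_stieltjesInt {δ : ℝ} (hδ : δ < 1) :
    DifferentiableOn ℂ (stieltjesInt δ) cutPlane := by
  intro z₀ hz₀
  obtain ⟨ε, hε, hball⟩ := Metric.nhds_basis_closedBall.mem_iff.1 (isOpen_cutPlane.mem_nhds hz₀)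
  obtain ⟨m, hm, hbd⟩ := exists_pos_le_norm_one_sub (isCompact_closedBall z₀ ε) hball
  have hbound : ∀ t ∈ Ioo (0 : ℝ) 1, ∀ z ∈ Metric.ball z₀ ε, m ≤ ‖1 - (t : ℂ) * z‖ :=
    fun t ht z hz => hbd t ⟨ht.1.le, ht.2.le⟩ z (Metric.ball_subset_closedBall hz)
  have key := hasDerivAt_integral_of_dominated_loc_of_deriv_le (𝕜 := ℂ)
    (μ := volume.restrict (Ioo (0 : ℝ) 1))
    (F := fun z t => ((t ^ (-δ) : ℝ) : ℂ) * (1 - (t : ℂ) * z)⁻¹)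
    (F' := fun z t => ((t ^ (-δ) : ℝ) : ℂ) * (t / (1 - (t : ℂ) * z) ^ 2))
    (x₀ := z₀) (bound := fun t => t ^ (-δ) * (1 / m ^ 2)) (Metric.ball_mem_nhds z₀ hε)
    (Filter.Eventually.of_forall fun z => aestronglyMeasurable_stieltjes δ z) ?_
    (Measurable.aestronglyMeasurable (by fun_prop)) ?_
    ((integrableOn_rpow_neg hδ).mul_const _) ?_
  · exact key.2.differentiableAt.differentiableWithinAt
  · refine Integrable.mono' ((integrableOn_rpow_neg hδ).mul_const (1 / m))
      (aestronglyMeasurable_stieltjes δ z₀) ?_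
    filter_upwards [ae_restrict_mem measurableSet_Ioo] with t ht
    have h0 : 0 ≤ t ^ (-δ) := Real.rpow_nonneg ht.1.le _
    rw [norm_mul, norm_inv, Complex.norm_real, Real.norm_of_nonneg h0, ← one_div]
    have := hbound t ht z₀ (Metric.mem_ball_self hε)
    gcongr
  · filter_upwards [ae_restrict_mem measurableSet_Ioo] with t ht z hz
    have h0 : 0 ≤ t ^ (-δ) := Real.rpow_nonneg ht.1.le _
    rw [norm_mul, norm_div, norm_pow, Complex.norm_real, Complex.norm_real,
      Real.norm_of_nonneg h0, Real.norm_of_nonneg ht.1.le]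
    have := hbound t ht z hz
    have := ht.2.le
    gcongr
  · filter_upwards [ae_restrict_mem measurableSet_Ioo] with t ht z hz
    have hne : 1 - (t : ℂ) * z ≠ 0 := norm_pos_iff.1 (hm.trans_le (hbound t ht z hz))
    have h1 : HasDerivAt (fun z : ℂ => 1 - (t : ℂ) * z) (-(t : ℂ)) z := by
      simpa using ((hasDerivAt_id z).const_mul (t : ℂ)).const_sub 1
    have h2 := (h1.inv hne).const_mul ((t ^ (-δ) : ℝ) : ℂ)
    simpa using h2

theorem integral_rpow_neg_add_nat {δ : ℝ} (hδ : δ < 1) (n : ℕ) :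
    ∫ t in Ioo (0 : ℝ) 1, t ^ (-δ) * t ^ n = 1 / (n + 1 - δ) := by
  have h1 : ∫ t in Ioo (0 : ℝ) 1, t ^ (-δ) * t ^ n = ∫ t in Ioo (0 : ℝ) 1, t ^ (-δ + n) := by
    refine setIntegral_congr_fun measurableSet_Ioo fun t ht => ?_
    rw [Real.rpow_add ht.1, Real.rpow_natCast]
  have h2 : (0 : ℝ) ≤ n := n.cast_nonneg
  rw [h1, ← integral_Ioc_eq_integral_Ioo, ← intervalIntegral.integral_of_le zero_le_one,
    integral_rpow (Or.inl (by linarith)), Real.one_rpow, Real.zero_rpow (by linarith)]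
  congr 1 <;> ring

/-- Expand `1 / (1 - t z)` geometrically and integrate term by term; the integrals of the norms are
dominated by a geometric series in `‖z‖`. -/
theorem hasSum_stieltjesInt {δ : ℝ} (hδ : δ < 1) {z : ℂ} (hz : ‖z‖ < 1) :
    HasSum (fun n : ℕ => z ^ n * (1 / (n + 1 - δ) : ℝ)) (stieltjesInt δ z) := by
  have hint : ∀ n : ℕ, IntegrableOn (fun t : ℝ => t ^ (-δ) * t ^ n) (Ioo 0 1) := by
    intro n
    refine Integrable.mono' (integrableOn_rpow_neg hδ)
      (Measurable.aestronglyMeasurable (by fun_prop)) ?_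
    filter_upwards [ae_restrict_mem measurableSet_Ioo] with t ht
    have h0 : 0 ≤ t ^ (-δ) := Real.rpow_nonneg ht.1.le _
    have h1 : 0 ≤ t ^ n := pow_nonneg ht.1.le _
    rw [Real.norm_of_nonneg (by positivity)]
    exact mul_le_of_le_one_right h0 (pow_le_one₀ ht.1.le ht.2.le)
  have hF : ∀ n : ℕ, Integrable (fun t : ℝ => z ^ n * ((t ^ (-δ) * t ^ n : ℝ) : ℂ))
      (volume.restrict (Ioo (0 : ℝ) 1)) := fun n => (hint n).ofReal.const_mul _
  have hnorm : ∀ n : ℕ, ∫ t in Ioo (0 : ℝ) 1, ‖z ^ n * ((t ^ (-δ) * t ^ n : ℝ) : ℂ)‖ =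
      ‖z‖ ^ n * (1 / (n + 1 - δ)) := by
    intro n
    rw [← integral_rpow_neg_add_nat hδ n, ← integral_const_mul]
    refine setIntegral_congr_fun measurableSet_Ioo fun t ht => ?_
    have h0 : 0 ≤ t ^ (-δ) := Real.rpow_nonneg ht.1.le _
    have h1 : 0 ≤ t ^ n := pow_nonneg ht.1.le _
    rw [norm_mul, norm_pow, Complex.norm_real, Real.norm_of_nonneg (by positivity)]
  have hsum : Summable fun n : ℕ => ‖z‖ ^ n * (1 / (n + 1 - δ)) := by
    refine Summable.of_nonneg_of_le (fun n => ?_) (fun n => ?_)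
      ((summable_geometric_of_lt_one (norm_nonneg z) hz).mul_right (1 / (1 - δ)))
    · have h2 : (0 : ℝ) ≤ n := n.cast_nonneg
      have : 0 < (n : ℝ) + 1 - δ := by linarith
      positivity
    · have h2 : (0 : ℝ) ≤ n := n.cast_nonneg
      have : 0 < 1 - δ := by linarith
      gcongr
      linarith
  have key := hasSum_integral_of_summable_integral_norm hF (by simpa only [hnorm] using hsum)
  have e1 : ∀ n : ℕ, ∫ t in Ioo (0 : ℝ) 1, z ^ n * ((t ^ (-δ) * t ^ n : ℝ) : ℂ) =
      z ^ n * (1 / (n + 1 - δ) : ℝ) := by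
    intro n
    rw [integral_const_mul, integral_complex_ofReal, integral_rpow_neg_add_nat hδ n]
  simp only [e1] at key
  suffices h : stieltjesInt δ z =
      ∫ t in Ioo (0 : ℝ) 1, ∑' n : ℕ, z ^ n * ((t ^ (-δ) * t ^ n : ℝ) : ℂ) by rwa [h]
  refine setIntegral_congr_fun measurableSet_Ioo fun t ht => ?_
  have htz : ‖(t : ℂ) * z‖ < 1 := by
    rw [norm_mul, Complex.norm_real, Real.norm_of_nonneg ht.1.le]
    nlinarith [norm_nonneg z, ht.1, ht.2]
  rw [← tsum_geometric_of_norm_lt_one htz, ← tsum_mul_left]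
  refine tsum_congr fun n => ?_
  push_cast
  ring

/-- Both sides are `(b)_{n+1}`, split off at the last or at the first factor. -/
theorem ascPochhammer_eval_mul (b : ℂ) (n : ℕ) :
    (ascPochhammer ℂ n).eval b * (b + n) = b * (ascPochhammer ℂ n).eval (b + 1) := by
  have h1 := congrArg (Polynomial.eval b) (ascPochhammer_succ_right ℂ n)
  have h2 := congrArg (Polynomial.eval b) (ascPochhammer_succ_left ℂ n)
  simp at h1 h2
  rw [← h1, h2]

/-- The numerator parameter `1` cancels `n!`, and `(-δ)_n / (1 - δ)_n` telescopes to `-δ / (n - δ)`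
because the lower parameter exceeds `-δ` by one. -/
theorem ordinaryHypergeometric_one_neg {δ : ℝ} (h0 : 0 < δ) (h1 : δ < 1) (z : ℂ) :
    ordinaryHypergeometric (1 : ℂ) (-δ : ℂ) (1 - δ : ℂ) z =
      ∑' n : ℕ, (-δ / (n - δ) : ℂ) * z ^ n := by
  rw [ordinaryHypergeometric_eq_tsum]
  refine tsum_congr fun n => ?_
  have hn : (n : ℂ) - δ ≠ 0 := by
    rcases Nat.eq_zero_or_pos n with rfl | hn
    · simpa using h0.ne'
    · have : (1 : ℝ) ≤ n := by exact_mod_cast hn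
      have h2 : (n : ℝ) - δ ≠ 0 := by linarith
      exact_mod_cast h2
  have hc : (ascPochhammer ℂ n).eval (1 - δ : ℂ) ≠ 0 := by
    have e : (ascPochhammer ℂ n).eval (1 - δ : ℂ) = (((ascPochhammer ℝ n).eval (1 - δ) : ℝ) : ℂ) := by
      rw [← ascPochhammer_map (algebraMap ℝ ℂ), Polynomial.eval_map_algebraMap]
      have := Polynomial.aeval_algebraMap_apply ℂ (1 - δ) (ascPochhammer ℝ n)
      simpa using this
    rw [e]
    exact_mod_cast (ascPochhammer_pos n (1 - δ) (by linarith)).ne'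
  have hb := ascPochhammer_eval_mul (-δ : ℂ) n
  rw [show (-δ : ℂ) + 1 = 1 - δ by ring, show (-δ : ℂ) + n = n - δ by ring] at hb
  have hf : (Nat.factorial n : ℂ) ≠ 0 := by exact_mod_cast n.factorial_ne_zero
  rw [ascPochhammer_eval_one, smul_eq_mul]
  congr 1
  field_simp
  linear_combination hb

theorem isPrincipalHyp2F1_eulerHyp {δ : ℝ} (h0 : 0 < δ) (h1 : δ < 1) :
    IsPrincipalHyp2F1 (1 : ℂ) (-δ : ℂ) (1 - δ : ℂ) (eulerHyp δ) := by
  refine ⟨?_, fun z hz => ?_⟩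
  · have := differentiableOn_stieltjesInt h1
    unfold eulerHyp
    change DifferentiableOn ℂ _ cutPlane
    fun_prop
  · rw [ordinaryHypergeometric_one_neg h0 h1]
    have h := (hasSum_stieltjesInt h1 hz).mul_left (-(δ * z : ℂ))
    -- The prefactor `-δ z` shifts the index by one; the missing term at `n = 0` is the `1` in
    -- `eulerHyp`.
    have h' : HasSum (fun n : ℕ => (-δ / (((n + 1 : ℕ) : ℂ) - δ) : ℂ) * z ^ (n + 1))
        (-(δ * z : ℂ) * stieltjesInt δ z) := by
      have e : (fun n : ℕ => (-δ / (((n + 1 : ℕ) : ℂ) - δ) : ℂ) * z ^ (n + 1)) =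
          fun n : ℕ => -(δ * z : ℂ) * (z ^ n * (1 / (n + 1 - δ) : ℝ)) := by
        ext n
        push_cast
        ring
      rw [e]
      exact h
    have hδ : (δ : ℂ) ≠ 0 := by exact_mod_cast h0.ne'
    have h2 := ((hasSum_nat_add_iff (f := fun n : ℕ => (-δ / (n - δ) : ℂ) * z ^ n) 1).1 h').tsum_eq
    rw [h2]
    simp only [Finset.range_one, Finset.sum_singleton, Nat.cast_zero, zero_sub, pow_zero, mul_one,
      neg_div_neg_eq, div_self hδ, eulerHyp]
    ring

theorem eqOn_epsilon_eulerHyp {δ : ℝ} (h0 : 0 < δ) (h1 : δ < 1) :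
    EqOn (Classical.epsilon (IsPrincipalHyp2F1 ((1 : ℝ) : ℂ) ((-δ : ℝ) : ℂ) ((1 - δ : ℝ) : ℂ)))
      (eulerHyp δ) cutPlane := by
  have h := isPrincipalHyp2F1_eulerHyp h0 h1
  have e1 : (-δ : ℂ) = ((-δ : ℝ) : ℂ) := by push_cast; rfl
  have e2 : (1 - δ : ℂ) = ((1 - δ : ℝ) : ℂ) := by push_cast; rfl
  rw [e1, e2, ← Complex.ofReal_one] at h
  exact (Classical.epsilon_spec ⟨_, h⟩ : IsPrincipalHyp2F1 _ _ _ _).eqOn h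

theorem hyp2F1_eq_integral {δ x : ℝ} (h0 : 0 < δ) (h1 : δ < 1) (hx : x < 1) :
    hyp2F1 1 (-δ) (1 - δ) x = 1 - δ * x * ∫ t in Ioo (0 : ℝ) 1, t ^ (-δ) * (1 - t * x)⁻¹ := by
  unfold hyp2F1
  rw [eqOn_epsilon_eulerHyp h0 h1 (ofReal_mem_cutPlane hx)]
  have e : stieltjesInt δ x = ((∫ t in Ioo (0 : ℝ) 1, t ^ (-δ) * (1 - t * x)⁻¹ : ℝ) : ℂ) := by
    rw [← integral_complex_ofReal]
    unfold stieltjesInt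
    congr 1
    ext t
    push_cast
    rfl
  unfold eulerHyp
  rw [e, ← Complex.ofReal_mul, ← Complex.ofReal_mul, ← Complex.ofReal_one, ← Complex.ofReal_sub,
    Complex.ofReal_re]

theorem contDiffAt_hyp2F1 {δ x : ℝ} (h0 : 0 < δ) (h1 : δ < 1) (hx : x < 1) :
    ContDiffAt ℝ ((⊤ : ℕ∞) : WithTop ℕ∞) (hyp2F1 1 (-δ) (1 - δ)) x := by
  have hd : DifferentiableOn ℂ (eulerHyp δ) cutPlane := (isPrincipalHyp2F1_eulerHyp h0 h1).1
  have ha : AnalyticAt ℂ (eulerHyp δ) x :=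
    hd.analyticOnNhd isOpen_cutPlane _ (ofReal_mem_cutPlane hx)
  have hc : ContDiffAt ℝ ((⊤ : ℕ∞) : WithTop ℕ∞) (fun y : ℝ => (eulerHyp δ y).re) x :=
    ContDiffAt.real_of_complex ha.contDiffAt
  refine hc.congr_of_eventuallyEq ?_
  filter_upwards [Iio_mem_nhds hx] with y hy
  unfold hyp2F1
  rw [eqOn_epsilon_eulerHyp h0 h1 (ofReal_mem_cutPlane hy)]

/-! ### Erlang tails and the gamma law of integer shape. -/

/-- The upper tail `e^{-t} ∑_{i<k} tⁱ / i!` of the Erlang law with shape `k` and unit rate. -/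
def erlangTail (k : ℕ) (t : ℝ) : ℝ :=
  ∑ i ∈ Finset.range k, t ^ i * Real.exp (-t) / (Nat.factorial i : ℝ)

/-- The derivative telescopes, leaving minus the Erlang density. So `-erlangTail` is a primitive of
that density, which gives the gamma tail without repeated integration by parts. -/
theorem hasDerivAt_erlangTail (n : ℕ) (t : ℝ) :
    HasDerivAt (erlangTail (n + 1)) (-(t ^ n * Real.exp (-t) / (Nat.factorial n : ℝ))) t := by
  have he : HasDerivAt (fun t : ℝ => Real.exp (-t)) (-Real.exp (-t)) t := by
    simpa using (hasDerivAt_neg t).exp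
  induction n with
  | zero =>
    have : erlangTail (0 + 1) = fun t => Real.exp (-t) := by
      ext t; simp [erlangTail]
    rw [this]
    simpa using he
  | succ n ih =>
    have e : erlangTail (n + 1 + 1) = fun t => erlangTail (n + 1) t +
        t ^ (n + 1) * Real.exp (-t) / (Nat.factorial (n + 1) : ℝ) := by
      ext t; unfold erlangTail; rw [Finset.sum_range_succ]
    rw [e]
    have h := ih.add ((((hasDerivAt_pow (n + 1) t).mul he)).div_const (Nat.factorial (n + 1) : ℝ))
    refine h.congr_deriv ?_
    have hf : (Nat.factorial n : ℝ) ≠ 0 := by exact_mod_cast n.factorial_ne_zero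
    rw [Nat.factorial_succ]
    push_cast
    field_simp
    ring

theorem tendsto_erlangTail (k : ℕ) : Filter.Tendsto (erlangTail k) Filter.atTop (nhds 0) := by
  have : Filter.Tendsto (erlangTail k) Filter.atTop
      (nhds (∑ i ∈ Finset.range k, 0 / (Nat.factorial i : ℝ))) :=
    tendsto_finsetSum _ fun i _ => (Real.tendsto_pow_mul_exp_neg_atTop_nhds_zero i).div_const _
  simpa using this

theorem continuous_erlangTail (k : ℕ) : Continuous (erlangTail k) := by
  unfold erlangTail
  fun_prop

theorem erlangTail_nonneg (k : ℕ) {t : ℝ} (ht : 0 ≤ t) : 0 ≤ erlangTail k t := by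
  unfold erlangTail
  positivity

theorem erlangTail_le_one (k : ℕ) {t : ℝ} (ht : 0 ≤ t) : erlangTail k t ≤ 1 := by
  have h := Real.sum_le_exp_of_nonneg ht k
  have e : erlangTail k t = Real.exp (-t) * ∑ i ∈ Finset.range k, t ^ i / (Nat.factorial i : ℝ) := by
    unfold erlangTail
    rw [Finset.mul_sum]
    exact Finset.sum_congr rfl fun i _ => by ring
  rw [e]
  calc _ ≤ Real.exp (-t) * Real.exp t := by gcongr
    _ = 1 := by rw [← Real.exp_add]; simp

theorem gammaMeasure_Ioi {k : ℕ} (hk : 0 < k) {ρ x : ℝ} (hρ : 0 < ρ) (hx : 0 ≤ x) :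
    gammaMeasure k ρ (Ioi x) = ENNReal.ofReal (erlangTail k (ρ * x)) := by
  obtain ⟨n, rfl⟩ : ∃ n, k = n + 1 := ⟨k - 1, by omega⟩
  set T' : ℝ → ℝ := fun t => (ρ * t) ^ n * Real.exp (-(ρ * t)) / (Nat.factorial n : ℝ) * ρ with hT'
  have hderiv : ∀ t ∈ Ici x, HasDerivAt (fun t => -erlangTail (n + 1) (ρ * t)) (T' t) t := by
    intro t _
    have h := ((hasDerivAt_erlangTail n (ρ * t)).comp t ((hasDerivAt_id t).const_mul ρ)).neg
    refine h.congr_deriv ?_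
    simp [hT']
  have hnn : ∀ t ∈ Ioi x, 0 ≤ T' t := by
    intro t ht
    have : 0 < t := hx.trans_lt ht
    simp only [hT']
    positivity
  have hlim : Filter.Tendsto (fun t => -erlangTail (n + 1) (ρ * t)) Filter.atTop (nhds 0) := by
    simpa using ((tendsto_erlangTail (n + 1)).comp
      (Filter.tendsto_id.const_mul_atTop hρ)).neg
  have hint := integrableOn_Ioi_deriv_of_nonneg' hderiv hnn hlim
  have hval := integral_Ioi_of_hasDerivAt_of_nonneg' hderiv hnn hlim
  rw [gammaMeasure, withDensity_apply _ measurableSet_Ioi]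
  calc ∫⁻ t in Ioi x, gammaPDF ((n + 1 : ℕ) : ℝ) ρ t = ∫⁻ t in Ioi x, ENNReal.ofReal (T' t) := by
        refine setLIntegral_congr_fun measurableSet_Ioi fun t ht => ?_
        have ht0 : 0 < t := hx.trans_lt ht
        rw [gammaPDF_of_nonneg ht0.le]
        congr 1
        simp only [hT']
        rw [Real.rpow_natCast, Nat.cast_succ, Real.Gamma_nat_eq_factorial, add_sub_cancel_right,
          Real.rpow_natCast]
        ring
    _ = ENNReal.ofReal (∫ t in Ioi x, T' t) := by
        rw [ofReal_integral_eq_lintegral_ofReal hint]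
        filter_upwards [ae_restrict_mem measurableSet_Ioi] with t ht using hnn t ht
    _ = _ := by rw [hval]; simp

/-! ### Laplace transforms and tails of complex Gaussian powers. -/

theorem lintegral_exp_neg_sq_gaussianReal {v : ℝ≥0} (hv : v ≠ 0) {s : ℝ} (hs : 0 ≤ s) :
    ∫⁻ x, ENNReal.ofReal (Real.exp (-(s * x ^ 2))) ∂(gaussianReal 0 v) =
      ENNReal.ofReal (√(1 / (1 + 2 * s * v))) := by
  have hv' : (0 : ℝ) < v := by positivity
  rw [gaussianReal_of_var_ne_zero 0 hv, lintegral_withDensity_eq_lintegral_mul₀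
    (measurable_gaussianPDF 0 v).aemeasurable (by fun_prop)]
  have e : ∀ x : ℝ, (gaussianPDF 0 v * fun x => ENNReal.ofReal (Real.exp (-(s * x ^ 2)))) x =
      ENNReal.ofReal ((√(2 * Real.pi * v))⁻¹ * Real.exp (-(s + 1 / (2 * v)) * x ^ 2)) := by
    intro x
    rw [Pi.mul_apply, gaussianPDF, ← ENNReal.ofReal_mul (gaussianPDFReal_nonneg _ _ _),
      gaussianPDFReal, mul_assoc, ← Real.exp_add]
    congr 3
    field_simp
    ring
  simp only [e]
  have hb : 0 < s + 1 / (2 * (v : ℝ)) := by positivity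
  rw [← ofReal_integral_eq_lintegral_ofReal ((integrable_exp_neg_mul_sq hb).const_mul _)
    (Filter.Eventually.of_forall fun x => by positivity), integral_const_mul, integral_gaussian,
    ← Real.sqrt_inv, ← Real.sqrt_mul (by positivity)]
  congr 2
  field_simp
  ring

/-- The combination is a centred Gaussian whose variances add. Positivity of the total variance
allows the density formula; either coefficient alone may vanish, which covers transmitters without
RIS. -/
theorem lintegral_exp_neg_add_sq_gaussianReal {v w : ℝ≥0} {a b : ℝ} {s : ℝ}
    (hs : 0 ≤ s) (hpos : 0 < a ^ 2 * v + b ^ 2 * w) :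
    ∫⁻ p, ENNReal.ofReal (Real.exp (-(s * (a * p.1 + b * p.2) ^ 2)))
      ∂((gaussianReal 0 v).prod (gaussianReal 0 w)) =
      ENNReal.ofReal (√(1 / (1 + 2 * s * (a ^ 2 * v + b ^ 2 * w)))) := by
  have hlaw : ((gaussianReal 0 v).prod (gaussianReal 0 w)).map (fun p => a * p.1 + b * p.2) =
      gaussianReal 0 (NNReal.mk (a ^ 2) (sq_nonneg a) * v + NNReal.mk (b ^ 2) (sq_nonneg b) * w) := by
    have h1 := gaussianReal_map_const_mul (μ := 0) (v := v) a
    have h2 := gaussianReal_map_const_mul (μ := 0) (v := w) b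
    have h3 := gaussianReal_conv_gaussianReal (m₁ := 0) (m₂ := 0)
      (v₁ := NNReal.mk (a ^ 2) (sq_nonneg a) * v) (v₂ := NNReal.mk (b ^ 2) (sq_nonneg b) * w)
    rw [mul_zero] at h1 h2
    rw [← h1, ← h2, Measure.conv, Measure.map_prod_map _ _ (by fun_prop) (by fun_prop),
      Measure.map_map (by fun_prop) (by fun_prop)] at h3
    rw [add_zero] at h3
    exact h3
  have hm : Measurable fun z : ℝ => ENNReal.ofReal (Real.exp (-(s * z ^ 2))) := by fun_prop
  rw [← lintegral_map (f := fun z : ℝ => ENNReal.ofReal (Real.exp (-(s * z ^ 2))))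
    (g := fun p : ℝ × ℝ => a * p.1 + b * p.2) hm (by fun_prop), hlaw,
    lintegral_exp_neg_sq_gaussianReal _ hs]
  · simp
  · intro h
    have := congrArg NNReal.toReal h
    simp at this
    linarith

instance (v : ℝ≥0) : IsProbabilityMeasure (complexGaussian v) :=
  Measure.isProbabilityMeasure_map (by fun_prop)

theorem lintegral_complexGaussian (v : ℝ≥0) {f : ℂ → ℝ≥0∞} (hf : Measurable f) :
    ∫⁻ z, f z ∂(complexGaussian v) = ∫⁻ x, ∫⁻ y, f ⟨x, y⟩ ∂(gaussianReal 0 (v / 2))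
      ∂(gaussianReal 0 (v / 2)) := by
  rw [complexGaussian, lintegral_map hf (by fun_prop), lintegral_prod]
  · rfl
  · exact (hf.comp (by fun_prop)).aemeasurable

/-- Laplace transform of the squared modulus of a combination of two independent circularly
symmetric complex Gaussian variables. -/
theorem lintegral_exp_neg_normSq_complexGaussian {v w : ℝ≥0} {a b s : ℝ} (hs : 0 ≤ s)
    (hpos : 0 < a ^ 2 * v + b ^ 2 * w) :
    ∫⁻ p, ENNReal.ofReal (Real.exp (-(s * ‖(a : ℂ) * p.1 + (b : ℂ) * p.2‖ ^ 2)))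
      ∂((complexGaussian v).prod (complexGaussian w)) =
      ENNReal.ofReal (1 / (1 + s * (a ^ 2 * v + b ^ 2 * w))) := by
  set f : ℝ → ℝ → ℝ≥0∞ := fun x x' => ENNReal.ofReal (Real.exp (-(s * (a * x + b * x') ^ 2)))
    with hf
  have hfm : Measurable (Function.uncurry f) := by
    simp only [hf, Function.uncurry_def]
    fun_prop
  set N := gaussianReal 0 (v / 2)
  set M := gaussianReal 0 (w / 2)
  -- Real and imaginary parts separate, so the transform is a product of two equal real Gaussian
  -- transforms, each contributing a square root.
  have hsplit : ∀ x y x' y' : ℝ, ENNReal.ofReal (Real.exp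
      (-(s * ‖(a : ℂ) * (⟨x, y⟩ : ℂ) + (b : ℂ) * (⟨x', y'⟩ : ℂ)‖ ^ 2))) = f x x' * f y y' := by
    intro x y x' y'
    simp only [hf]
    rw [← ENNReal.ofReal_mul (Real.exp_pos _).le, ← Real.exp_add, Complex.sq_norm,
      Complex.normSq_apply]
    congr 2
    simp
    ring
  have hone : ∫⁻ x, ∫⁻ x', f x x' ∂M ∂N =
      ENNReal.ofReal (√(1 / (1 + s * (a ^ 2 * v + b ^ 2 * w)))) := by
    rw [lintegral_lintegral hfm.aemeasurable]
    simp only [hf]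
    rw [lintegral_exp_neg_add_sq_gaussianReal hs]
    · congr 3
      push_cast
      ring
    · push_cast
      linarith
  rw [lintegral_prod _ (by
      exact (by fun_prop : Measurable fun p : ℂ × ℂ => ENNReal.ofReal
        (Real.exp (-(s * ‖(a : ℂ) * p.1 + (b : ℂ) * p.2‖ ^ 2)))).aemeasurable),
    lintegral_complexGaussian v
    (Measurable.lintegral_prod_right' (f := fun p : ℂ × ℂ => ENNReal.ofReal
      (Real.exp (-(s * ‖(a : ℂ) * p.1 + (b : ℂ) * p.2‖ ^ 2)))) (by fun_prop))]
  have hinner : ∀ x y : ℝ, ∫⁻ q, ENNReal.ofReal (Real.exp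
      (-(s * ‖(a : ℂ) * (⟨x, y⟩ : ℂ) + (b : ℂ) * q‖ ^ 2))) ∂(complexGaussian w) =
      (∫⁻ x', f x x' ∂M) * ∫⁻ y', f y y' ∂M := by
    intro x y
    rw [lintegral_complexGaussian w (by fun_prop)]
    simp only [hsplit]
    have hm : ∀ x, Measurable (f x) := fun x => hfm.of_uncurry_left
    simp only [lintegral_const_mul _ (hm y)]
    rw [lintegral_mul_const _ (hm x)]
  simp only [hinner]
  have hm2 : Measurable fun x => ∫⁻ x', f x x' ∂M := hfm.lintegral_prod_right'
  simp only [lintegral_const_mul _ hm2]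
  rw [lintegral_mul_const _ hm2, hone, ← ENNReal.ofReal_mul (Real.sqrt_nonneg _),
    Real.mul_self_sqrt]
  have : 0 ≤ s * (a ^ 2 * v + b ^ 2 * w) := by positivity
  positivity

/-- The squared modulus of a standard complex Gaussian variable is exponential. -/
theorem complexGaussian_one_normSq_tail {x : ℝ} (hx : 0 ≤ x) :
    complexGaussian 1 {z | x < ‖z‖ ^ 2} = ENNReal.ofReal (Real.exp (-x)) := by
  have hms : MeasurableSet {z : ℂ | x < ‖z‖ ^ 2} := measurableSet_lt (by fun_prop) (by fun_prop)
  have hne : ((1 : ℝ≥0) / 2) ≠ 0 := by positivity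
  rw [complexGaussian, Measure.map_apply (by fun_prop) hms, gaussianReal_of_var_ne_zero 0 hne,
    prod_withDensity (by fun_prop) (by fun_prop), withDensity_apply _ (by
      exact (by fun_prop : Measurable Complex.measurableEquivRealProd.symm) hms)]
  have hS : (Complex.measurableEquivRealProd.symm ⁻¹' {z : ℂ | x < ‖z‖ ^ 2}) =
      {p : ℝ × ℝ | x < p.1 ^ 2 + p.2 ^ 2} := by
    ext p
    simp only [mem_preimage, mem_ofPred_eq, Complex.sq_norm, Complex.normSq_apply]
    change x < p.1 * p.1 + p.2 * p.2 ↔ _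
    rw [sq, sq]
  have hmS : MeasurableSet {p : ℝ × ℝ | x < p.1 ^ 2 + p.2 ^ 2} :=
    measurableSet_lt (by fun_prop) (by fun_prop)
  -- Each component has variance `1/2`, so the joint density is `e^{-r²}/π`. In polar coordinates
  -- the angle gives `2π` and `r e^{-r²}` has an elementary primitive.
  rw [hS, ← lintegral_indicator hmS, ← Measure.volume_eq_prod, ← lintegral_comp_polarCoord_symm,
    polarCoord_target]
  have hden : ∀ p ∈ Ioi (0 : ℝ) ×ˢ Ioo (-Real.pi) Real.pi, ENNReal.ofReal p.1 •
      ({p : ℝ × ℝ | x < p.1 ^ 2 + p.2 ^ 2}.indicator (fun p => gaussianPDF 0 (1 / 2) p.1 *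
        gaussianPDF 0 (1 / 2) p.2) (polarCoord.symm p)) =
      (Ioi (√x)).indicator (fun r => ENNReal.ofReal (r * Real.exp (-r ^ 2) / Real.pi)) p.1 := by
    rintro ⟨r, φ⟩ ⟨hr, -⟩
    have hr0 : 0 < r := hr
    have hsum : (r * Real.cos φ) ^ 2 + (r * Real.sin φ) ^ 2 = r ^ 2 := by
      linear_combination r ^ 2 * Real.cos_sq_add_sin_sq φ
    simp only [polarCoord_symm_apply]
    by_cases h : x < r ^ 2
    · rw [indicator_of_mem (by simpa [hsum] using h),
        indicator_of_mem (by simpa using (Real.sqrt_lt' hr0).2 h), smul_eq_mul, gaussianPDF,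
        gaussianPDF, ← ENNReal.ofReal_mul (gaussianPDFReal_nonneg _ _ _),
        ← ENNReal.ofReal_mul hr0.le]
      congr 1
      have e1 : (2 * Real.pi * ((1 / 2 : ℝ≥0) : ℝ)) = Real.pi := by push_cast; ring
      have e2 : (2 * ((1 / 2 : ℝ≥0) : ℝ)) = 1 := by push_cast; ring
      rw [gaussianPDFReal, gaussianPDFReal, e1, e2]
      have e3 : Real.exp (-r ^ 2) = Real.exp (-(r * Real.cos φ - 0) ^ 2 / 1) *
          Real.exp (-(r * Real.sin φ - 0) ^ 2 / 1) := by
        rw [← Real.exp_add]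
        congr 1
        rw [← hsum]
        ring
      have e4 : (√Real.pi)⁻¹ * (√Real.pi)⁻¹ = 1 / Real.pi := by
        rw [← mul_inv, Real.mul_self_sqrt Real.pi_pos.le, one_div]
      rw [e3]
      linear_combination r * Real.exp (-(r * Real.cos φ - 0) ^ 2 / 1) *
          Real.exp (-(r * Real.sin φ - 0) ^ 2 / 1) * e4
    · rw [indicator_of_notMem (by simpa [hsum] using h), indicator_of_notMem, smul_zero]
      simpa [Real.sqrt_lt' hr0] using h
  rw [setLIntegral_congr_fun (measurableSet_Ioi.prod measurableSet_Ioo) hden,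
    Measure.volume_eq_prod, ← Measure.prod_restrict, lintegral_prod _ (by
      refine Measurable.aemeasurable ?_
      exact (Measurable.indicator (by fun_prop) measurableSet_Ioi).comp measurable_fst)]
  simp only [lintegral_const, Measure.restrict_apply_univ, Real.volume_Ioo]
  rw [lintegral_mul_const _ (Measurable.indicator (by fun_prop) measurableSet_Ioi),
    setLIntegral_indicator measurableSet_Ioi,
    inter_eq_left.2 (Ioi_subset_Ioi (Real.sqrt_nonneg x))]
  have hderiv : ∀ t ∈ Ici (√x), HasDerivAt (fun t => -Real.exp (-t ^ 2) / (2 * Real.pi))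
      (t * Real.exp (-t ^ 2) / Real.pi) t := by
    intro t _
    have h1 : HasDerivAt (fun t : ℝ => -t ^ 2) (-(2 * t)) t := by
      simpa using (hasDerivAt_pow 2 t).fun_neg
    refine (h1.exp.neg.div_const _).congr_deriv ?_
    field_simp
  have hnn : ∀ t ∈ Ioi (√x), 0 ≤ t * Real.exp (-t ^ 2) / Real.pi := by
    intro t ht
    have : 0 < t := (Real.sqrt_nonneg x).trans_lt ht
    positivity
  have hlim : Filter.Tendsto (fun t : ℝ => -Real.exp (-t ^ 2) / (2 * Real.pi)) Filter.atTop
      (nhds 0) := by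
    have h1 : Filter.Tendsto (fun t : ℝ => Real.exp (-t ^ 2)) Filter.atTop (nhds 0) :=
      Real.tendsto_exp_neg_atTop_nhds_zero.comp (Filter.tendsto_pow_atTop two_ne_zero)
    simpa using h1.neg.div_const (2 * Real.pi)
  rw [← ofReal_integral_eq_lintegral_ofReal (integrableOn_Ioi_deriv_of_nonneg' hderiv hnn hlim)
    (by filter_upwards [ae_restrict_mem measurableSet_Ioi] with t ht using hnn t ht),
    integral_Ioi_of_hasDerivAt_of_nonneg' hderiv hnn hlim, ← ENNReal.ofReal_mul]
  · congr 1
    rw [Real.sq_sqrt hx]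
    field_simp
    ring
  · rw [Real.sq_sqrt hx, zero_sub, neg_div, neg_neg]
    positivity

/-! ### The extended exponential and the Laplace functional of a Poisson process. -/

/-- The function `x ↦ e^{-x}` on `[0, ∞]`, with value `0` at `∞`. -/
def expNeg (x : ℝ≥0∞) : ℝ≥0∞ := (EReal.exp (x : EReal))⁻¹

@[simp] theorem expNeg_zero : expNeg 0 = 1 := by simp [expNeg]

@[simp] theorem expNeg_top : expNeg ∞ = 0 := by simp [expNeg]

theorem expNeg_ofReal {x : ℝ} (hx : 0 ≤ x) :
    expNeg (ENNReal.ofReal x) = ENNReal.ofReal (Real.exp (-x)) := by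
  rw [expNeg, EReal.coe_ennreal_ofReal, max_eq_left hx, EReal.exp_coe,
    ← ENNReal.ofReal_inv_of_pos (Real.exp_pos _), Real.exp_neg]

theorem one_le_exp_coe (x : ℝ≥0∞) : 1 ≤ EReal.exp (x : EReal) := by
  rw [EReal.one_le_exp_iff]
  exact EReal.coe_ennreal_nonneg x

theorem expNeg_le_one (x : ℝ≥0∞) : expNeg x ≤ 1 := ENNReal.inv_le_one.2 (one_le_exp_coe x)

theorem expNeg_ne_top (x : ℝ≥0∞) : expNeg x ≠ ∞ :=
  ne_top_of_le_ne_top ENNReal.one_ne_top (expNeg_le_one x)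

theorem expNeg_add (x y : ℝ≥0∞) : expNeg (x + y) = expNeg x * expNeg y := by
  have hx : EReal.exp (x : EReal) ≠ 0 := (one_pos.trans_le (one_le_exp_coe x)).ne'
  have hy : EReal.exp (y : EReal) ≠ 0 := (one_pos.trans_le (one_le_exp_coe y)).ne'
  rw [expNeg, expNeg, expNeg, EReal.coe_ennreal_add, EReal.exp_add,
    ENNReal.mul_inv (Or.inl hx) (Or.inr hy)]

theorem expNeg_sum {ι : Type*} (s : Finset ι) (f : ι → ℝ≥0∞) :
    expNeg (∑ i ∈ s, f i) = ∏ i ∈ s, expNeg (f i) := by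
  induction s using Finset.cons_induction with
  | empty => simp
  | cons j s hj ih => rw [Finset.sum_cons, Finset.prod_cons, expNeg_add, ih]

theorem expNeg_antitone : Antitone expNeg := fun _ _ h =>
  ENNReal.inv_le_inv.2 (EReal.exp_monotone (EReal.coe_ennreal_le_coe_ennreal_iff.2 h))

theorem continuous_expNeg : Continuous expNeg :=
  continuous_inv.comp (ENNReal.continuous_exp.comp continuous_coe_ennreal_ereal)

theorem measurable_expNeg : Measurable expNeg := continuous_expNeg.measurable

theorem _root_.Measurable.expNeg {α : Type*} {_ : MeasurableSpace α} {f : α → ℝ≥0∞}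
    (hf : Measurable f) : Measurable fun a => RISNet.expNeg (f a) := measurable_expNeg.comp hf

theorem expNeg_eq_zero_iff {x : ℝ≥0∞} : expNeg x = 0 ↔ x = ∞ := by
  simp [expNeg]

/-- Poisson generating function at `u = e^{-c}`. The case `c = ∞`, `u = 0` is included and yields
void probabilities. -/
theorem lintegral_expNeg_poisson (Λ : ℝ≥0) (c : ℝ≥0∞) :
    ∫⁻ n, expNeg (c * (n : ℝ≥0∞)) ∂(poissonMeasure Λ) = expNeg (Λ * (1 - expNeg c)) := by
  obtain ⟨u, hu0, hu1, hu⟩ : ∃ u : ℝ, 0 ≤ u ∧ u ≤ 1 ∧ expNeg c = ENNReal.ofReal u := by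
    refine ⟨(expNeg c).toReal, ENNReal.toReal_nonneg, ?_, (ENNReal.ofReal_toReal (expNeg_ne_top c)).symm⟩
    exact ENNReal.toReal_le_of_le_ofReal zero_le_one (by simpa using expNeg_le_one c)
  have hpow : ∀ n : ℕ, expNeg (c * (n : ℝ≥0∞)) = ENNReal.ofReal (u ^ n) := by
    intro n
    have : c * (n : ℝ≥0∞) = ∑ _i ∈ Finset.range n, c := by
      rw [Finset.sum_const, Finset.card_range, nsmul_eq_mul, mul_comm]
    rw [this, expNeg_sum, Finset.prod_const, Finset.card_range, hu, ENNReal.ofReal_pow hu0]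
  have hsum : HasSum (fun n : ℕ => Real.exp (-Λ) * (Λ : ℝ) ^ n / (Nat.factorial n : ℝ) * u ^ n)
      (Real.exp (-(Λ * (1 - u)))) := by
    have h := (NormedSpace.expSeries_div_hasSum_exp ((Λ : ℝ) * u)).mul_left (Real.exp (-Λ))
    rw [← Real.exp_eq_exp_ℝ, ← Real.exp_add] at h
    have e : -(Λ : ℝ) + Λ * u = -(Λ * (1 - u)) := by ring
    rw [e] at h
    have e2 : (fun n : ℕ => Real.exp (-Λ) * (Λ : ℝ) ^ n / (Nat.factorial n : ℝ) * u ^ n) =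
        fun n : ℕ => Real.exp (-Λ) * (((Λ : ℝ) * u) ^ n / (Nat.factorial n : ℝ)) := by
      ext n
      rw [mul_pow]
      ring
    rw [e2]
    exact h
  rw [poissonMeasure, lintegral_sum_measure]
  simp only [lintegral_smul_measure, lintegral_dirac, hpow, smul_eq_mul]
  have hterm : ∀ n : ℕ, ENNReal.ofReal (Real.exp (-Λ) * (Λ : ℝ) ^ n / (Nat.factorial n : ℝ)) *
      ENNReal.ofReal (u ^ n) =
      ENNReal.ofReal (Real.exp (-Λ) * (Λ : ℝ) ^ n / (Nat.factorial n : ℝ) * u ^ n) := by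
    intro n
    rw [← ENNReal.ofReal_mul (by positivity)]
  simp only [hterm]
  rw [← ENNReal.ofReal_tsum_of_nonneg (fun n => by positivity) hsum.summable, hsum.tsum_eq, hu,
    ← ENNReal.ofReal_one, ← ENNReal.ofReal_sub _ hu0, ← ENNReal.ofReal_coe_nnreal,
    ← ENNReal.ofReal_mul Λ.coe_nonneg, expNeg_ofReal]
  exact mul_nonneg Λ.coe_nonneg (by linarith)

theorem tsum_indicator_eq_pointCount {Ω : Type*} (X : ℕ → Ω → Plane) (B : Set Plane) (c : ℝ≥0∞) (ω : Ω) :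
    ∑' k, B.indicator (fun _ => c) (X k ω) = c * (pointCount X B ω : ℝ≥0∞) := by
  have h1 : ∀ k, B.indicator (fun _ => c) (X k ω) =
      {n : ℕ | X n ω ∈ B}.indicator (fun _ => c) k := fun k => rfl
  simp only [h1]
  rw [← tsum_subtype {n : ℕ | X n ω ∈ B} (fun _ => c), ENNReal.tsum_set_const, mul_comm]
  rfl

section

variable {Ω : Type*} [MeasurableSpace Ω] {μ : Measure Ω} {lam : ℝ} {X : ℕ → Ω → Plane}

theorem lintegral_expNeg_pointCount (h : IsHPPP lam X μ) {B : Set Plane}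
    (hB : MeasurableSet B) (hvol : volume B ≠ ∞) (c : ℝ≥0∞) :
    ∫⁻ ω, expNeg (c * (pointCount X B ω : ℝ≥0∞)) ∂μ =
      expNeg (ENNReal.ofReal lam * volume B * (1 - expNeg c)) := by
  have h1 := (h.count_law B hB hvol).lintegral_comp
    (f := fun n : ℕ∞ => expNeg (c * (n : ℝ≥0∞))) Measurable.of_discrete.aemeasurable
  rw [h1, lintegral_map Measurable.of_discrete Measurable.of_discrete]
  simp only [ENat.toENNReal_coe]
  rw [lintegral_expNeg_poisson, ENNReal.coe_toNNReal (ENNReal.mul_ne_top ENNReal.ofReal_ne_top hvol)]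

theorem measurable_pointCount (h : IsHPPP lam X μ) {B : Set Plane} (hB : MeasurableSet B) :
    Measurable (pointCount X B) := by
  have h1 : pointCount X B = fun ω => Set.encard {n : ℕ | X n ω ∈ B} := rfl
  rw [h1]
  refine measurable_encard.comp ?_
  rw [measurable_set_iff]
  intro k
  exact (measurable_mem.2 hB).comp (h.measurable_point k)

/-- The sum over points is a linear combination of the counts in the level sets of `φ`, which are
disjoint; independence of the counts turns the expectation into a product of Poisson transforms. -/
theorem lintegral_expNeg_tsum_simple (h : IsHPPP lam X μ) (φ : SimpleFunc Plane ℝ≥0∞)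
    (hφ : volume (Function.support φ) ≠ ∞) :
    ∫⁻ ω, expNeg (∑' k, φ (X k ω)) ∂μ =
      expNeg (ENNReal.ofReal lam * ∫⁻ y, (1 - expNeg (φ y))) := by
  classical
  -- The value `0` is dropped: its level set has infinite volume, and it contributes to neither
  -- side.
  set s : Finset ℝ≥0∞ := φ.range.filter (· ≠ 0) with hs
  set e := s.equivFin
  set c : Fin s.card → ℝ≥0∞ := fun i => (e.symm i : ℝ≥0∞) with hc
  set B : Fin s.card → Set Plane := fun i => φ ⁻¹' {c i} with hB
  have hc0 : ∀ i, c i ≠ 0 := fun i => (Finset.mem_filter.1 (e.symm i).2).2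
  have hcinj : Function.Injective c := Subtype.val_injective.comp e.symm.injective
  have hBm : ∀ i, MeasurableSet (B i) := fun i => φ.measurableSet_preimage _
  have hBv : ∀ i, volume (B i) ≠ ∞ := fun i => ne_top_of_le_ne_top hφ (measure_mono fun y hy => by
    have : φ y = c i := hy
    rw [Function.mem_support, this]
    exact hc0 i)
  have hBd : Pairwise fun i j => Disjoint (B i) (B j) := by
    intro i j hij
    rw [Set.disjoint_left]
    intro y hy hy'
    have h1 : φ y = c i := hy
    have h2 : φ y = c j := hy'
    exact hij (hcinj (h1.symm.trans h2))
  have hdecomp : ∀ (F : ℝ≥0∞ → ℝ≥0∞), F 0 = 0 → ∀ y,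
      F (φ y) = ∑ i, (B i).indicator (fun _ => F (c i)) y := by
    intro F hF y
    by_cases h0 : φ y = 0
    · rw [h0, hF]
      symm
      refine Finset.sum_eq_zero fun i _ => indicator_of_notMem ?_ _
      intro hy
      have : φ y = c i := hy
      exact hc0 i (this.symm.trans h0)
    · have hmem : φ y ∈ s := Finset.mem_filter.2 ⟨φ.mem_range_self y, h0⟩
      have hci : c (e ⟨φ y, hmem⟩) = φ y := by simp [hc]
      rw [Finset.sum_eq_single (e ⟨φ y, hmem⟩)]
      · rw [indicator_of_mem, hci]
        exact hci.symm
      · intro j _ hj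
        refine indicator_of_notMem ?_ _
        intro hy
        have h1 : φ y = c j := hy
        exact hj (hcinj (h1.symm.trans hci.symm))
      · simp
  have hL : ∀ ω, ∑' k, φ (X k ω) = ∑ i, c i * (pointCount X (B i) ω : ℝ≥0∞) := by
    intro ω
    simp only [← tsum_indicator_eq_pointCount]
    rw [← Summable.tsum_finsetSum (fun i _ => ENNReal.summable)]
    exact tsum_congr fun k => hdecomp id rfl (X k ω)
  have hR : ∫⁻ y, (1 - expNeg (φ y)) = ∑ i, volume (B i) * (1 - expNeg (c i)) := by
    have : ∀ y, 1 - expNeg (φ y) = ∑ i, (B i).indicator (fun _ => 1 - expNeg (c i)) y :=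
      hdecomp (fun x => 1 - expNeg x) (by simp)
    simp only [this]
    rw [lintegral_finsetSum _ fun i _ => measurable_const.indicator (hBm i)]
    refine Finset.sum_congr rfl fun i _ => ?_
    rw [lintegral_indicator (hBm i), setLIntegral_const, mul_comm]
  simp only [hL, expNeg_sum]
  have hind : iIndepFun (fun i ω => expNeg (c i * (pointCount X (B i) ω : ℝ≥0∞))) μ :=
    (h.count_indep _ B hBm hBv hBd).comp
      (fun i (n : ℕ∞) => expNeg (c i * (n : ℝ≥0∞))) fun i => Measurable.of_discrete
  rw [lintegral_prod_eq_prod_lintegral_of_indepFun _ _ hind fun i =>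
    (Measurable.of_discrete (f := fun n : ℕ∞ => expNeg (c i * (n : ℝ≥0∞)))).comp
      (measurable_pointCount h (hBm i))]
  rw [hR, Finset.mul_sum, expNeg_sum]
  refine Finset.prod_congr rfl fun i _ => ?_
  rw [lintegral_expNeg_pointCount h (hBm i) (hBv i), mul_assoc]

/-- The Laplace functional of a homogeneous Poisson point process. -/
theorem IsHPPP.laplaceFunctional [IsProbabilityMeasure μ] (h : IsHPPP lam X μ)
    {f : Plane → ℝ≥0∞} (hf : Measurable f) :
    ∫⁻ ω, expNeg (∑' k, f (X k ω)) ∂μ =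
      expNeg (ENNReal.ofReal lam * ∫⁻ y, (1 - expNeg (f y))) := by
  -- Cutting off by growing balls gives supports of finite volume and keeps the approximation
  -- monotone. The expectation then passes to the limit by domination by `1`, the spatial integral
  -- by monotone convergence.
  set φ : ℕ → SimpleFunc Plane ℝ≥0∞ := fun n =>
    (SimpleFunc.eapprox f n).restrict (Metric.ball 0 n) with hφ
  have hφa : ∀ n y, φ n y = (Metric.ball (0 : Plane) n).indicator (SimpleFunc.eapprox f n) y :=
    fun n y => SimpleFunc.restrict_apply _ measurableSet_ball _
  have hmono : ∀ y, Monotone fun n => φ n y := by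
    intro y m n hmn
    simp only [hφa]
    refine (indicator_le_indicator_of_subset (Metric.ball_subset_ball (Nat.cast_le.2 hmn))
      (fun _ => zero_le) y).trans ?_
    exact indicator_le_indicator (SimpleFunc.monotone_eapprox f hmn y)
  have hlim : ∀ y, Filter.Tendsto (fun n => φ n y) Filter.atTop (nhds (f y)) := by
    intro y
    refine (SimpleFunc.tendsto_eapprox hf y).congr' ?_
    obtain ⟨N, hN⟩ := exists_nat_gt ‖y‖
    filter_upwards [Filter.eventually_ge_atTop N] with n hn
    rw [hφa, indicator_of_mem]
    simp only [mem_ball_zero_iff]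
    exact hN.trans_le (by exact_mod_cast hn)
  have hfin : ∀ n, volume (Function.support (φ n)) ≠ ∞ := by
    intro n
    refine ne_top_of_le_ne_top (measure_ball_lt_top (x := (0 : Plane)) (r := n)).ne
      (measure_mono fun y hy => ?_)
    by_contra hy'
    exact hy (by rw [hφa, indicator_of_notMem hy'])
  have htsum : ∀ ω, Filter.Tendsto (fun n => ∑' k, φ n (X k ω)) Filter.atTop
      (nhds (∑' k, f (X k ω))) := by
    intro ω
    simp only [← lintegral_count]
    exact lintegral_tendsto_of_tendsto_of_monotone
      (fun n => Measurable.of_discrete.aemeasurable)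
      (Filter.Eventually.of_forall fun k => hmono (X k ω))
      (Filter.Eventually.of_forall fun k => hlim (X k ω))
  have hmeas : ∀ n, Measurable fun ω => ∑' k, φ n (X k ω) := fun n =>
    Measurable.tsum fun k => (φ n).measurable.comp (h.measurable_point k)
  have h1 : Filter.Tendsto (fun n => ∫⁻ ω, expNeg (∑' k, φ n (X k ω)) ∂μ) Filter.atTop
      (nhds (∫⁻ ω, expNeg (∑' k, f (X k ω)) ∂μ)) :=
    tendsto_lintegral_of_dominated_convergence (fun _ => 1) (fun n => (hmeas n).expNeg)
      (fun n => Filter.Eventually.of_forall fun ω => expNeg_le_one _) (by simp)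
      (Filter.Eventually.of_forall fun ω => (continuous_expNeg.tendsto _).comp (htsum ω))
  have h2 : Filter.Tendsto (fun n => ∫⁻ y, (1 - expNeg (φ n y))) Filter.atTop
      (nhds (∫⁻ y, (1 - expNeg (f y)))) := by
    refine lintegral_tendsto_of_tendsto_of_monotone
      (fun n => (measurable_const.sub (φ n).measurable.expNeg).aemeasurable)
      (Filter.Eventually.of_forall fun y m n hmn => ?_) (Filter.Eventually.of_forall fun y => ?_)
    · exact tsub_le_tsub_left (expNeg_antitone (hmono y hmn)) 1
    · exact ENNReal.Tendsto.sub tendsto_const_nhds ((continuous_expNeg.tendsto _).comp (hlim y))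
        (Or.inl ENNReal.one_ne_top)
  have h3 := (continuous_expNeg.tendsto _).comp
    (ENNReal.Tendsto.const_mul h2 (Or.inr (ENNReal.ofReal_ne_top (r := lam))))
  refine tendsto_nhds_unique h1 (h3.congr fun n => ?_)
  exact (lintegral_expNeg_tsum_simple h (φ n) (hfin n)).symm

/-- Almost surely every ball contains only finitely many points. -/
theorem IsHPPP.ae_finite (h : IsHPPP lam X μ) :
    ∀ᵐ ω ∂μ, ∀ n : ℕ, {k : ℕ | X k ω ∈ Metric.ball (0 : Plane) n}.Finite := by
  rw [ae_all_iff]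
  intro n
  have hlaw := h.count_law (Metric.ball (0 : Plane) n) measurableSet_ball
    measure_ball_lt_top.ne
  have h1 := (hlaw.ae_iff (p := fun m : ℕ∞ => m ≠ ⊤) Measurable.of_discrete).2 (by
    rw [ae_map_iff Measurable.of_discrete.aemeasurable (.of_discrete)]
    exact Filter.Eventually.of_forall fun m => ENat.natCast_ne_top m)
  filter_upwards [h1] with ω hω
  exact Set.encard_ne_top_iff.1 hω

end

/-! ### Averaging over the marks with the positions frozen. -/

/-- The random mark of a transmitter: RIS indicator, direct fading, reflected fading, and power
gain when serving with an aligned RIS. -/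
abbrev Mark : Type := Bool × ℂ × ℂ × ℝ

namespace Params

variable (θ : Params)

/-- Power received from an interfering transmitter at distance `d` with mark `m`. -/
def markInterf (d : ℝ) (m : Mark) : ℝ :=
  if m.1 = true then
    ‖((√(θ.ηg d) : ℝ) : ℂ) * m.2.1 + ((√(θ.ηh d) : ℝ) : ℂ) * m.2.2.1‖ ^ 2
  else ‖((√(θ.ηg d) : ℝ) : ℂ) * m.2.1‖ ^ 2

/-- Power received from the serving transmitter at distance `d` with mark `m`. -/
def markSignal (d : ℝ) (m : Mark) : ℝ :=
  if m.1 = true then θ.ηg d * m.2.2.2 else θ.ηg d * ‖m.2.1‖ ^ 2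

/-- Total interference for the configuration `x` with marks `m` served by the transmitter `i`. -/
def totalInterf (x : ℕ → Plane) (i : ℕ) (m : ℕ → Mark) : ℝ≥0∞ :=
  ∑' k : ℕ, if k = i then 0 else ENNReal.ofReal (θ.markInterf ‖x k‖ (m k))

/-- Laplace transform at `s` of the power of an interferer at distance `d`. -/
def interfLaplace (s d : ℝ) : ℝ :=
  θ.p * (1 / (1 + s * (θ.e₁ * d ^ (-θ.α)))) + (1 - θ.p) * (1 / (1 + s * (θ.Cd * d ^ (-θ.α))))

/-- Negative logarithm of `interfLaplace`. -/
def interfExponent (s d : ℝ) : ℝ≥0∞ := ENNReal.ofReal (-Real.log (θ.interfLaplace s d))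

/-- Coverage probability given that the serving transmitter is at distance `d` and that the
interference is `y`. -/
def condCoverage (γ d : ℝ) (y : ℝ) : ℝ :=
  θ.p * erlangTail θ.κhat (γ * (y + θ.γt⁻¹) / (θ.ηg d * θ.χbar)) +
    (1 - θ.p) * Real.exp (-(γ * (y + θ.γt⁻¹) / θ.ηg d))

variable {θ}

@[fun_prop]
theorem measurable_ηg (θ : Params) : Measurable θ.ηg := by unfold ηg; fun_prop

@[fun_prop]
theorem measurable_ηh (θ : Params) : Measurable θ.ηh := by unfold ηh; fun_prop

theorem measurable_markInterf (θ : Params) :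
    Measurable fun q : ℝ × Mark => θ.markInterf q.1 q.2 := by
  unfold markInterf
  refine Measurable.ite ?_ (by fun_prop) (by fun_prop)
  exact (by fun_prop : Measurable fun q : ℝ × Mark => q.2.1) (measurableSet_singleton true)

theorem measurable_markSignal (θ : Params) :
    Measurable fun q : ℝ × Mark => θ.markSignal q.1 q.2 := by
  unfold markSignal
  refine Measurable.ite ?_ (by fun_prop) (by fun_prop)
  exact (by fun_prop : Measurable fun q : ℝ × Mark => q.2.1) (measurableSet_singleton true)

theorem measurable_totalInterf (θ : Params) (i : ℕ) :
    Measurable fun q : (ℕ → Plane) × (ℕ → Mark) => θ.totalInterf q.1 i q.2 := by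
  unfold totalInterf
  refine Measurable.tsum fun k => ?_
  split_ifs
  · exact measurable_const
  · exact ((θ.measurable_markInterf.comp
      (f := fun q : (ℕ → Plane) × (ℕ → Mark) => (‖q.1 k‖, q.2 k)) (by fun_prop))).ennreal_ofReal

/-- Requires measurability only of the marks other than the `i`-th, so that it applies to the
σ-algebra they generate; this is what separates interference from signal. -/
theorem measurable_totalInterf_of_ne (θ : Params) (x : ℕ → Plane) {i : ℕ} {Ω' : Type*}
    {_ : MeasurableSpace Ω'} {f : Ω' → ℕ → Mark} (hf : ∀ k ≠ i, Measurable fun ω => f ω k) :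
    Measurable fun ω => θ.totalInterf x i (f ω) := by
  unfold totalInterf
  refine Measurable.tsum fun k => ?_
  split_ifs with hk
  · exact measurable_const
  · exact (θ.measurable_markInterf.comp (measurable_const.prodMk (hf k hk))).ennreal_ofReal

section Laplace

variable (h : θ.Admissible) {s d : ℝ}
include h

theorem Admissible.one_le_denoms (hs : 0 ≤ s) (hd : 0 ≤ d) :
    1 ≤ 1 + s * (θ.e₁ * d ^ (-θ.α)) ∧ 1 ≤ 1 + s * (θ.Cd * d ^ (-θ.α)) := by
  have h1 := h.e₁_pos
  have h2 := h.Cd_pos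
  have h3 := Real.rpow_nonneg hd (-θ.α)
  constructor <;> linarith [mul_nonneg hs (mul_nonneg h1.le h3), mul_nonneg hs (mul_nonneg h2.le h3)]

theorem Admissible.interfLaplace_pos (hs : 0 ≤ s) (hd : 0 ≤ d) : 0 < θ.interfLaplace s d := by
  obtain ⟨h1, h2⟩ := h.one_le_denoms hs hd
  have hp := h.p_nonneg
  have hp1 : 0 ≤ 1 - θ.p := by linarith [h.p_le_one]
  have a1 : 0 < 1 / (1 + s * (θ.e₁ * d ^ (-θ.α))) := by positivity
  have a2 : 0 < 1 / (1 + s * (θ.Cd * d ^ (-θ.α))) := by positivity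
  unfold interfLaplace
  rcases hp.eq_or_lt with h0 | h0
  · rw [← h0]
    simpa using a2
  · have := mul_pos h0 a1
    have := mul_nonneg hp1 a2.le
    linarith

theorem Admissible.interfLaplace_le_one (hs : 0 ≤ s) (hd : 0 ≤ d) : θ.interfLaplace s d ≤ 1 := by
  obtain ⟨h1, h2⟩ := h.one_le_denoms hs hd
  have hp := h.p_nonneg
  have hp1 : 0 ≤ 1 - θ.p := by linarith [h.p_le_one]
  have a1 : 1 / (1 + s * (θ.e₁ * d ^ (-θ.α))) ≤ 1 := (div_le_one (by linarith)).2 h1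
  have a2 : 1 / (1 + s * (θ.Cd * d ^ (-θ.α))) ≤ 1 := (div_le_one (by linarith)).2 h2
  unfold interfLaplace
  linarith [mul_le_mul_of_nonneg_left a1 hp, mul_le_mul_of_nonneg_left a2 hp1]

/-- Since `interfLaplace` lies in `(0, 1]`, its negative logarithm is a finite nonnegative number.
Products over interferers thus become exponentials of sums, the form needed for the Laplace
functional. -/
theorem Admissible.expNeg_interfExponent (hs : 0 ≤ s) (hd : 0 ≤ d) :
    expNeg (θ.interfExponent s d) = ENNReal.ofReal (θ.interfLaplace s d) := by
  have h1 := h.interfLaplace_pos hs hd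
  rw [interfExponent, expNeg_ofReal, neg_neg, Real.exp_log h1]
  linarith [Real.log_nonpos h1.le (h.interfLaplace_le_one hs hd)]

end Laplace

@[fun_prop]
theorem measurable_interfLaplace (θ : Params) (s : ℝ) : Measurable (θ.interfLaplace s) := by
  unfold interfLaplace
  fun_prop

@[fun_prop]
theorem measurable_interfExponent (θ : Params) (s : ℝ) : Measurable (θ.interfExponent s) := by
  unfold interfExponent
  fun_prop

end Params

/-- The marks of the transmitters. -/
def marks {Ω : Type*} (b : ℕ → Ω → Bool) (g Ir : ℕ → Ω → ℂ) (G : ℕ → Ω → ℝ) (ω : Ω) : ℕ → Mark :=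
  fun k => (b k ω, g k ω, Ir k ω, G k ω)

namespace IsNetwork

variable {Ω : Type*} [MeasurableSpace Ω] {θ : Params} {μ : Measure Ω} [IsProbabilityMeasure μ]
  {X : ℕ → Ω → Plane} {b : ℕ → Ω → Bool} {g Ir : ℕ → Ω → ℂ} {G : ℕ → Ω → ℝ}
  (hnet : IsNetwork θ μ X b g Ir G) (hθ : θ.Admissible)

include hnet

omit [IsProbabilityMeasure μ] in
theorem measurable_mark (k : ℕ) : Measurable fun ω => (b k ω, g k ω, Ir k ω, G k ω) :=
  (hnet.b_meas k).prodMk ((hnet.g_meas k).prodMk ((hnet.Ir_meas k).prodMk (hnet.G_meas k)))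

omit [IsProbabilityMeasure μ] in
theorem measurable_marks : Measurable (marks b g Ir G) :=
  measurable_pi_lambda _ fun k => hnet.measurable_mark k

include hθ

theorem lintegral_ite_ris (k : ℕ) {F₁ F₂ : ℂ × ℂ × ℝ → ℝ≥0∞} (h₁ : Measurable F₁)
    (h₂ : Measurable F₂) :
    ∫⁻ ω, (if b k ω = true then F₁ (g k ω, Ir k ω, G k ω) else F₂ (g k ω, Ir k ω, G k ω)) ∂μ =
      ENNReal.ofReal θ.p * ∫⁻ ω, F₁ (g k ω, Ir k ω, G k ω) ∂μ +
      ENNReal.ofReal (1 - θ.p) * ∫⁻ ω, F₂ (g k ω, Ir k ω, G k ω) ∂μ := by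
  have hm : Measurable fun ω => (g k ω, Ir k ω, G k ω) :=
    (hnet.g_meas k).prodMk ((hnet.Ir_meas k).prodMk (hnet.G_meas k))
  have hpt : MeasurableSet {ω | b k ω = true} := hnet.b_meas k (measurableSet_singleton true)
  have hpf : μ {ω | b k ω = false} = ENNReal.ofReal (1 - θ.p) := by
    have e : {ω | b k ω = false} = {ω | b k ω = true}ᶜ := by ext; simp
    rw [e, prob_compl_eq_one_sub hpt, hnet.b_law k, ENNReal.ofReal_sub _ hθ.p_nonneg,
      ENNReal.ofReal_one]
  have hfac : ∀ (c : Bool) (F : ℂ × ℂ × ℝ → ℝ≥0∞), Measurable F →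
      ∫⁻ ω, (if b k ω = c then (1 : ℝ≥0∞) else 0) * F (g k ω, Ir k ω, G k ω) ∂μ =
      μ {ω | b k ω = c} * ∫⁻ ω, F (g k ω, Ir k ω, G k ω) ∂μ := by
    intro c F hF
    have hind := (hnet.b_indep k).comp
      (Measurable.of_discrete (f := fun x : Bool => if x = c then (1 : ℝ≥0∞) else 0)) hF
    have hset : MeasurableSet {ω | b k ω = c} := hnet.b_meas k (measurableSet_singleton c)
    have := lintegral_mul_eq_lintegral_mul_lintegral_of_indepFun''
      ((Measurable.of_discrete.comp (hnet.b_meas k)).aemeasurable) ((hF.comp hm).aemeasurable) hind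
    simp only [Function.comp_apply] at this
    rw [this]
    congr 1
    have e : (fun ω => if b k ω = c then (1 : ℝ≥0∞) else 0) = {ω | b k ω = c}.indicator 1 := by
      ext ω
      simp [indicator_apply]
    rw [e, lintegral_indicator_one hset]
  rw [← hnet.b_law k, ← hpf, ← hfac true F₁ h₁, ← hfac false F₂ h₂, ← lintegral_add_left]
  · refine lintegral_congr fun ω => ?_
    cases b k ω <;> simp
  · exact (Measurable.of_discrete (f := fun x : Bool => if x = true then (1 : ℝ≥0∞) else 0)
      |>.comp (hnet.b_meas k)).mul (h₁.comp hm)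

theorem lintegral_expNeg_markInterf (k : ℕ) {s d : ℝ} (hs : 0 ≤ s) (hd : 0 ≤ d) :
    ∫⁻ ω, expNeg (ENNReal.ofReal s * ENNReal.ofReal (θ.markInterf d (b k ω, g k ω, Ir k ω, G k ω)))
      ∂μ = ENNReal.ofReal (θ.interfLaplace s d) := by
  have hα : -θ.α ≠ 0 := by linarith [hθ.two_lt_α]
  -- At distance `0` the convention `0 ^ (-α) = 0` makes both path losses vanish, so both sides
  -- equal `1`.
  rcases hd.eq_or_lt with rfl | hd
  · have h1 : θ.ηg 0 = 0 := by simp [Params.ηg, Real.zero_rpow hα]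
    have h2 : θ.ηh 0 = 0 := by simp [Params.ηh, Real.zero_rpow hα]
    simp [Params.markInterf, h1, h2, Params.interfLaplace, Real.zero_rpow hα]
  have hp1 : 0 ≤ 1 - θ.p := by linarith [hθ.p_le_one]
  have hηg := hθ.ηg_pos hd
  have hηh : 0 ≤ θ.ηh d := by
    have := hθ.Cr_pos
    have := hθ.d₀_pos
    unfold Params.ηh
    positivity
  have hN : (1 : ℝ) ≤ θ.N := by exact_mod_cast hθ.one_le_N
  have hjoint : ∀ c : ℝ, 0 < √(θ.ηg d) ^ 2 * ((1 : ℝ≥0) : ℝ) + c ^ 2 * ((θ.N : ℝ≥0) : ℝ) →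
      ∫⁻ ω, ENNReal.ofReal (Real.exp (-(s * ‖((√(θ.ηg d) : ℝ) : ℂ) * g k ω + (c : ℂ) * Ir k ω‖ ^ 2)))
        ∂μ = ENNReal.ofReal (1 / (1 + s * (√(θ.ηg d) ^ 2 * ((1 : ℝ≥0) : ℝ) +
          c ^ 2 * ((θ.N : ℝ≥0) : ℝ)))) := by
    intro c hc
    rw [← lintegral_exp_neg_normSq_complexGaussian hs hc]
    have hprod := (indepFun_iff_map_prod_eq_prod_map_map (hnet.g_meas k).aemeasurable
      (hnet.Ir_meas k).aemeasurable).1 (hnet.g_indep_Ir k)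
    rw [(hnet.g_law k).map_eq, (hnet.Ir_law k).map_eq] at hprod
    rw [← hprod, lintegral_map (by fun_prop) ((hnet.g_meas k).prodMk (hnet.Ir_meas k))]
  -- The case without RIS is written with reflected coefficient `0`, so that one Gaussian formula
  -- serves both cases.
  have hF : ∀ ω, expNeg (ENNReal.ofReal s *
      ENNReal.ofReal (θ.markInterf d (b k ω, g k ω, Ir k ω, G k ω))) =
      if b k ω = true then (fun q : ℂ × ℂ × ℝ => ENNReal.ofReal (Real.exp
        (-(s * ‖((√(θ.ηg d) : ℝ) : ℂ) * q.1 + ((√(θ.ηh d) : ℝ) : ℂ) * q.2.1‖ ^ 2))))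
          (g k ω, Ir k ω, G k ω)
      else (fun q : ℂ × ℂ × ℝ => ENNReal.ofReal (Real.exp
        (-(s * ‖((√(θ.ηg d) : ℝ) : ℂ) * q.1 + ((0 : ℝ) : ℂ) * q.2.1‖ ^ 2))))
          (g k ω, Ir k ω, G k ω) := by
    intro ω
    rw [← ENNReal.ofReal_mul hs]
    unfold Params.markInterf
    by_cases hb : b k ω = true
    · simp only [hb, if_true]
      rw [expNeg_ofReal (by positivity)]
    · simp only [hb]
      rw [expNeg_ofReal (by positivity)]
      simp
  have hm : ∀ c : ℝ, Measurable fun q : ℂ × ℂ × ℝ => ENNReal.ofReal (Real.exp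
      (-(s * ‖((√(θ.ηg d) : ℝ) : ℂ) * q.1 + (c : ℂ) * q.2.1‖ ^ 2))) := fun c => by fun_prop
  refine (lintegral_congr hF).trans
    ((hnet.lintegral_ite_ris hθ k (hm (√(θ.ηh d))) (hm 0)).trans ?_)
  rw [hjoint, hjoint]
  · obtain ⟨h1, h2⟩ := hθ.one_le_denoms hs hd.le
    have e1 : √(θ.ηg d) ^ 2 * ((1 : ℝ≥0) : ℝ) + √(θ.ηh d) ^ 2 * ((θ.N : ℝ≥0) : ℝ) =
        θ.e₁ * d ^ (-θ.α) := by
      rw [Real.sq_sqrt hηg.le, Real.sq_sqrt hηh]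
      unfold Params.ηg Params.ηh Params.e₁
      rw [Real.mul_rpow hθ.d₀_pos.le hd.le]
      push_cast
      ring
    have e2 : √(θ.ηg d) ^ 2 * ((1 : ℝ≥0) : ℝ) + 0 ^ 2 * ((θ.N : ℝ≥0) : ℝ) =
        θ.Cd * d ^ (-θ.α) := by
      rw [Real.sq_sqrt hηg.le]
      unfold Params.ηg
      push_cast
      ring
    rw [e1, e2, ← ENNReal.ofReal_mul hθ.p_nonneg, ← ENNReal.ofReal_mul hp1, ← ENNReal.ofReal_add]
    · rfl
    · exact mul_nonneg hθ.p_nonneg (by positivity)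
    · exact mul_nonneg hp1 (by positivity)
  · rw [Real.sq_sqrt hηg.le]
    simpa using hηg
  · rw [Real.sq_sqrt hηg.le, NNReal.coe_one, mul_one]
    positivity

theorem measure_lt_markSignal (i : ℕ) {d y : ℝ} (hd : 0 < d) (hy : 0 ≤ y) :
    μ {ω | y < θ.markSignal d (b i ω, g i ω, Ir i ω, G i ω)} =
      ENNReal.ofReal (θ.p * erlangTail θ.κhat (y / (θ.ηg d * θ.χbar)) +
        (1 - θ.p) * Real.exp (-(y / θ.ηg d))) := by
  have hηg := hθ.ηg_pos hd
  have hχ := hθ.χbar_pos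
  have hp1 : 0 ≤ 1 - θ.p := by linarith [hθ.p_le_one]
  have hset : MeasurableSet {ω | y < θ.markSignal d (b i ω, g i ω, Ir i ω, G i ω)} :=
    measurableSet_lt measurable_const (θ.measurable_markSignal.comp
      (measurable_const.prodMk (hnet.measurable_mark i)))
  have m1 : MeasurableSet {t : ℝ | y < θ.ηg d * t} := measurableSet_lt (by fun_prop) (by fun_prop)
  have m2 : MeasurableSet {z : ℂ | y < θ.ηg d * ‖z‖ ^ 2} :=
    measurableSet_lt (by fun_prop) (by fun_prop)
  have hF : ∀ ω, {ω | y < θ.markSignal d (b i ω, g i ω, Ir i ω, G i ω)}.indicator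
      (1 : Ω → ℝ≥0∞) ω =
      if b i ω = true then (fun q : ℂ × ℂ × ℝ => {t : ℝ | y < θ.ηg d * t}.indicator 1 q.2.2)
        (g i ω, Ir i ω, G i ω)
      else (fun q : ℂ × ℂ × ℝ => {z : ℂ | y < θ.ηg d * ‖z‖ ^ 2}.indicator 1 q.1)
        (g i ω, Ir i ω, G i ω) := by
    intro ω
    simp only [indicator_apply, mem_ofPred_eq, Params.markSignal]
    by_cases hb : b i ω = true <;> simp [hb]
  rw [← lintegral_indicator_one hset]
  refine (lintegral_congr hF).trans ((hnet.lintegral_ite_ris hθ i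
    ((measurable_one.indicator m1).comp (measurable_snd.comp measurable_snd))
    ((measurable_one.indicator m2).comp measurable_fst)).trans ?_)
  simp only [Function.comp_apply]
  rw [(hnet.G_law i).lintegral_comp (f := fun t => {t : ℝ | y < θ.ηg d * t}.indicator 1 t)
    (measurable_one.indicator m1).aemeasurable,
    (hnet.g_law i).lintegral_comp (f := fun z => {z : ℂ | y < θ.ηg d * ‖z‖ ^ 2}.indicator 1 z)
    (measurable_one.indicator m2).aemeasurable, lintegral_indicator_one m1,
    lintegral_indicator_one m2]
  have e1 : {t : ℝ | y < θ.ηg d * t} = Ioi (y / θ.ηg d) := by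
    ext t
    simp [div_lt_iff₀' hηg]
  have e2 : {z : ℂ | y < θ.ηg d * ‖z‖ ^ 2} = {z : ℂ | y / θ.ηg d < ‖z‖ ^ 2} := by
    ext z
    simp [div_lt_iff₀' hηg]
  have hy' : 0 ≤ y / θ.ηg d := by positivity
  rw [e1, e2, gammaMeasure_Ioi θ.κhat_pos (by positivity) hy', complexGaussian_one_normSq_tail hy',
    ← ENNReal.ofReal_mul hθ.p_nonneg, ← ENNReal.ofReal_mul hp1, ← ENNReal.ofReal_add]
  · congr 4
    field_simp
  · exact mul_nonneg hθ.p_nonneg (erlangTail_nonneg _ (by positivity))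
  · exact mul_nonneg hp1 (Real.exp_pos _).le

/-- Laplace transform of the interference for a fixed configuration of the transmitters. -/
theorem lintegral_expNeg_totalInterf (x : ℕ → Plane) (i : ℕ) {s : ℝ} (hs : 0 ≤ s) :
    ∫⁻ ω, expNeg (ENNReal.ofReal s * θ.totalInterf x i (marks b g Ir G ω)) ∂μ =
      expNeg (∑' k, if k = i then 0 else θ.interfExponent s ‖x k‖) := by
  set F : ℕ → Mark → ℝ≥0∞ := fun k m =>
    if k = i then 0 else ENNReal.ofReal s * ENNReal.ofReal (θ.markInterf ‖x k‖ m) with hF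
  have hFm : ∀ k, Measurable (F k) := by
    intro k
    simp only [hF]
    split_ifs
    · exact measurable_const
    · exact ((θ.measurable_markInterf.comp
        (measurable_const.prodMk measurable_id)).ennreal_ofReal).const_mul _
  have hsum : ∀ ω, ENNReal.ofReal s * θ.totalInterf x i (marks b g Ir G ω) =
      ∑' k, F k (marks b g Ir G ω k) := by
    intro ω
    rw [Params.totalInterf, ← ENNReal.tsum_mul_left]
    refine tsum_congr fun k => ?_
    simp only [hF]
    split_ifs <;> simp
  simp only [hsum]
  have hmk : ∀ k, Measurable fun ω => F k (marks b g Ir G ω k) :=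
    fun k => (hFm k).comp (hnet.measurable_mark k)
  -- Independence yields a product formula for finitely many interferers; the bound `1` carries it
  -- to the infinite sum.
  have hlim : Filter.Tendsto (fun n => ∫⁻ ω, expNeg (∑ k ∈ Finset.range n, F k (marks b g Ir G ω k))
      ∂μ) Filter.atTop (nhds (∫⁻ ω, expNeg (∑' k, F k (marks b g Ir G ω k)) ∂μ)) := by
    refine tendsto_lintegral_of_dominated_convergence (fun _ => 1)
      (fun n => (Finset.measurable_sum _ fun k _ => hmk k).expNeg)
      (fun n => Filter.Eventually.of_forall fun ω => expNeg_le_one _) (by simp)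
      (Filter.Eventually.of_forall fun ω => (continuous_expNeg.tendsto _).comp ?_)
    exact ENNReal.tendsto_nat_tsum _
  have hfin : ∀ n, ∫⁻ ω, expNeg (∑ k ∈ Finset.range n, F k (marks b g Ir G ω k)) ∂μ =
      expNeg (∑ k ∈ Finset.range n, if k = i then 0 else θ.interfExponent s ‖x k‖) := by
    intro n
    simp only [expNeg_sum]
    have hind : iIndepFun (fun k ω => expNeg (F k (marks b g Ir G ω k))) μ :=
      hnet.marks_indep.comp (fun k m => expNeg (F k m)) fun k => (hFm k).expNeg
    rw [lintegral_prod_eq_prod_lintegral_of_indepFun _ _ hind fun k => (hmk k).expNeg]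
    refine Finset.prod_congr rfl fun k _ => ?_
    simp only [hF]
    split_ifs
    · simp
    · rw [hθ.expNeg_interfExponent hs (norm_nonneg _)]
      exact hnet.lintegral_expNeg_markInterf hθ k hs (norm_nonneg _)
  simp only [hfin] at hlim
  exact tendsto_nhds_unique hlim ((continuous_expNeg.tendsto _).comp (ENNReal.tendsto_nat_tsum _))

omit hθ [IsProbabilityMeasure μ] in
-- The interference reads only the marks indexed by `{i}ᶜ`, and σ-algebras generated by disjoint
-- blocks of an independent family are independent.
theorem indepFun_totalInterf_mark (x : ℕ → Plane) (i : ℕ) :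
    IndepFun (fun ω => θ.totalInterf x i (marks b g Ir G ω)) (fun ω => marks b g Ir G ω i) μ := by
  have hle : ∀ k, MeasurableSpace.comap (fun ω => (b k ω, g k ω, Ir k ω, G k ω)) inferInstance ≤
      (inferInstance : MeasurableSpace Ω) := fun k => (hnet.measurable_mark k).comap_le
  have hind := indep_iSup_of_disjoint hle hnet.marks_indep.iIndep
    (S := {i}ᶜ) (T := {i}) disjoint_compl_left
  rw [IndepFun_iff_Indep]
  refine indep_of_indep_of_le_left (indep_of_indep_of_le_right hind ?_) ?_
  · exact le_iSup₂_of_le i rfl le_rfl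
  · rw [← measurable_iff_comap_le]
    refine θ.measurable_totalInterf_of_ne (Ω' := Ω) x fun k hk => ?_
    refine Measurable.mono (comap_measurable (fun ω => (b k ω, g k ω, Ir k ω, G k ω))) ?_ le_rfl
    exact le_iSup₂_of_le (f := fun k (_ : k ∈ ({i}ᶜ : Set ℕ)) => MeasurableSpace.comap
      (fun ω => (b k ω, g k ω, Ir k ω, G k ω)) inferInstance) k hk le_rfl

end IsNetwork

/-! ### Radial integrals and the tilted void probability. -/

/-- Radial integrand `ρ (1 - 1 / (1 + c ρ^{-α}))` of the Rayleigh fading interference exponent. -/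
def radialLoss (α c ρ : ℝ) : ℝ := ρ * (1 - 1 / (1 + c * ρ ^ (-α)))

theorem radialLoss_nonneg {α c ρ : ℝ} (hc : 0 ≤ c) (hρ : 0 ≤ ρ) : 0 ≤ radialLoss α c ρ := by
  have h1 : 0 ≤ c * ρ ^ (-α) := mul_nonneg hc (Real.rpow_nonneg hρ _)
  have h2 : 1 / (1 + c * ρ ^ (-α)) ≤ 1 := (div_le_one (by linarith)).2 (by linarith)
  exact mul_nonneg hρ (by linarith)

theorem radialLoss_eq {α c ρ : ℝ} (hc : 0 ≤ c) (hρ : 0 < ρ) :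
    radialLoss α c ρ = ρ * (c * ρ ^ (-α)) / (1 + c * ρ ^ (-α)) := by
  have h1 : 0 ≤ c * ρ ^ (-α) := mul_nonneg hc (Real.rpow_nonneg hρ.le _)
  unfold radialLoss
  field_simp
  ring

theorem measurable_radialLoss (α c : ℝ) : Measurable (radialLoss α c) := by
  unfold radialLoss
  fun_prop

theorem integrableOn_radialLoss {α c r : ℝ} (hα : 2 < α) (hc : 0 ≤ c) (hr : 0 < r) :
    IntegrableOn (radialLoss α c) (Ioi r) := by
  -- The integrand is at most `c ρ^{1-α}`, integrable at infinity exactly because `α > 2`.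
  refine Integrable.mono' ((integrableOn_Ioi_rpow_of_lt (a := 1 - α) (by linarith) hr).const_mul c)
    (measurable_radialLoss α c).aestronglyMeasurable ?_
  filter_upwards [ae_restrict_mem measurableSet_Ioi] with ρ hρ
  have hρ0 : 0 < ρ := hr.trans hρ
  rw [Real.norm_of_nonneg (radialLoss_nonneg hc hρ0.le), radialLoss_eq hc hρ0, sub_eq_add_neg,
    Real.rpow_add hρ0, Real.rpow_one]
  have h1 : 0 ≤ c * ρ ^ (-α) := mul_nonneg hc (Real.rpow_nonneg hρ0.le _)
  have h2 : 0 ≤ ρ * (c * ρ ^ (-α)) := mul_nonneg hρ0.le h1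
  calc _ ≤ ρ * (c * ρ ^ (-α)) := div_le_self h2 (by linarith)
    _ = c * (ρ * ρ ^ (-α)) := by ring

/-- The radial interference integral in terms of the hypergeometric function. -/
theorem integral_radialLoss {α c r : ℝ} (hα : 2 < α) (hc : 0 ≤ c) (hr : 0 < r) :
    2 * ∫ ρ in Ioi r, radialLoss α c ρ =
      r ^ 2 * (hyp2F1 1 (-(2 / α)) (1 - 2 / α) (-(c * r ^ (-α))) - 1) := by
  have hα0 : 0 < α := by linarith
  have hδ0 : 0 < 2 / α := by positivity
  have hδ1 : 2 / α < 1 := (div_lt_one hα0).2 hα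
  set u := c * r ^ (-α) with hu
  have hu0 : 0 ≤ u := mul_nonneg hc (Real.rpow_nonneg hr.le _)
  rw [hyp2F1_eq_integral hδ0 hδ1 (by linarith)]
  -- Scaling `ρ = r x` moves all dependence on `r` into the factor `r²` and the parameter `u = c
  -- r^{-α}`.
  have hscale : r * ∫ x in Ioi (1 : ℝ), radialLoss α c (r * x) = ∫ ρ in Ioi r, radialLoss α c ρ := by
    have := integral_comp_mul_left_Ioi' (radialLoss α c) 1 hr
    rwa [mul_one, smul_eq_mul] at this
  have hcomp : ∫ x in Ioi (1 : ℝ), radialLoss α c (r * x) =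
      r * ∫ x in Ioi (1 : ℝ), radialLoss α u x := by
    rw [← integral_const_mul]
    refine setIntegral_congr_fun measurableSet_Ioi fun x hx => ?_
    have hx0 : 0 < x := one_pos.trans hx
    simp only [radialLoss, hu]
    rw [Real.mul_rpow hr.le hx0.le]
    ring
  -- The substitution `t = x^{-α}` maps `(1, ∞)` to `(0, 1)`. The indicator lets the change of
  -- variables on all of `(0, ∞)` be used.
  set w : ℝ → ℝ := (Iio (1 : ℝ)).indicator fun t => t ^ (-(2 / α)) * (1 - t * -u)⁻¹ with hw
  have hsub := integral_comp_rpow_Ioi w (p := -α) (by linarith)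
  have hright : ∫ t in Ioi (0 : ℝ), w t = ∫ t in Ioo (0 : ℝ) 1, t ^ (-(2 / α)) * (1 - t * -u)⁻¹ := by
    rw [hw, setIntegral_indicator measurableSet_Iio]
    rfl
  have hleft : ∫ x in Ioi (0 : ℝ), (|-α| * x ^ (-α - 1)) • w (x ^ (-α)) =
      ∫ x in Ioi (1 : ℝ), α * (x * x ^ (-α) / (1 + u * x ^ (-α))) := by
    have h1 : Ioi (1 : ℝ) = Ioi 0 ∩ Ioi 1 := by
      rw [inter_eq_right.2 (Ioi_subset_Ioi zero_le_one)]
    rw [h1, ← setIntegral_indicator measurableSet_Ioi]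
    refine setIntegral_congr_fun measurableSet_Ioi fun x hx => ?_
    have hx0 : (0 : ℝ) < x := hx
    have hiff : x ^ (-α) < 1 ↔ 1 < x := by
      rw [Real.rpow_lt_one_iff_of_pos hx0]
      constructor
      · rintro (⟨h1, -⟩ | ⟨-, h2⟩)
        · exact h1
        · linarith
      · intro h1
        exact Or.inl ⟨h1, by linarith⟩
    simp only [hw, smul_eq_mul]
    by_cases hx1 : 1 < x
    · rw [indicator_of_mem (show x ^ (-α) ∈ Iio (1 : ℝ) from hiff.2 hx1),
        indicator_of_mem (show x ∈ Ioi (1 : ℝ) from hx1), abs_neg, abs_of_pos hα0,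
        ← Real.rpow_mul hx0.le]
      have e1 : -α * -(2 / α) = 1 + 1 := by field_simp; norm_num
      have e2 : x ^ (-α - 1) = x ^ (-α) * x⁻¹ := by
        rw [Real.rpow_sub hx0, Real.rpow_one, div_eq_mul_inv]
      rw [e1, e2, Real.rpow_add hx0, Real.rpow_one]
      have h3 : 0 ≤ u * x ^ (-α) := mul_nonneg hu0 (Real.rpow_nonneg hx0.le _)
      have h4 : 1 - x ^ (-α) * -u = 1 + u * x ^ (-α) := by ring
      rw [h4]
      field_simp
    · rw [indicator_of_notMem (show x ^ (-α) ∉ Iio (1 : ℝ) from fun h => hx1 (hiff.1 h)),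
        indicator_of_notMem (show x ∉ Ioi (1 : ℝ) from hx1), mul_zero]
  rw [hleft, hright, integral_const_mul] at hsub
  have hrl : ∫ x in Ioi (1 : ℝ), radialLoss α u x =
      u * ∫ x in Ioi (1 : ℝ), x * x ^ (-α) / (1 + u * x ^ (-α)) := by
    rw [← integral_const_mul]
    refine setIntegral_congr_fun measurableSet_Ioi fun x hx => ?_
    have hx0 : 0 < x := one_pos.trans hx
    rw [radialLoss_eq hu0 hx0]
    ring
  rw [← hscale, hcomp, hrl, ← hsub]
  field_simp
  ring

namespace Params

variable (θ : Params)

/-- The loss of radial mass `ρ (1 - φ_s(ρ))`, where `φ_s` is the Laplace transform of the power of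
one interferer. -/
def interfLoss (s ρ : ℝ) : ℝ := ρ * (1 - θ.interfLaplace s ρ)

/-- Integral over the disc complement of radius `r` of the interference loss, together with the
area of the disc, divided by `2π`. -/
def voidExponent (s r : ℝ) : ℝ := r ^ 2 / 2 + ∫ ρ in Ioi r, θ.interfLoss s ρ

/-- Laplace transform at `s` of the interference, given that the nearest transmitter is at
distance `r`. -/
def condLaplace (s r : ℝ) : ℝ :=
  Real.exp (-(Real.pi * θ.lam * r ^ 2 *
    (θ.p * (θ.hyp (-(s * θ.e₁ * r ^ (-θ.α))) - 1) +
      (1 - θ.p) * (θ.hyp (-(s * θ.Cd * r ^ (-θ.α))) - 1))))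

theorem interfLoss_eq (s ρ : ℝ) : θ.interfLoss s ρ =
    θ.p * radialLoss θ.α (s * θ.e₁) ρ + (1 - θ.p) * radialLoss θ.α (s * θ.Cd) ρ := by
  unfold interfLoss interfLaplace radialLoss
  simp only [mul_assoc]
  ring

variable {θ}

section

variable (h : θ.Admissible) {s r : ℝ} (hs : 0 ≤ s)
include h hs

theorem Admissible.interfLoss_nonneg (hr : 0 ≤ r) : 0 ≤ θ.interfLoss s r :=
  mul_nonneg hr (by linarith [h.interfLaplace_le_one hs hr])

theorem Admissible.integrableOn_interfLoss (hr : 0 < r) :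
    IntegrableOn (θ.interfLoss s) (Ioi r) := by
  have e : θ.interfLoss s = fun ρ => θ.p * radialLoss θ.α (s * θ.e₁) ρ +
      (1 - θ.p) * radialLoss θ.α (s * θ.Cd) ρ := funext fun ρ => θ.interfLoss_eq s ρ
  rw [e]
  have h1 := integrableOn_radialLoss h.two_lt_α (mul_nonneg hs h.e₁_pos.le) hr
  have h2 := integrableOn_radialLoss h.two_lt_α (mul_nonneg hs h.Cd_pos.le) hr
  exact (h1.const_mul _).add (h2.const_mul _)

/-- The disc contributes the void probability; the exterior contributes the RIS and non-RIS losses,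
each a hypergeometric value minus `1`. -/
theorem Admissible.exp_voidExponent (hr : 0 < r) :
    Real.exp (-(2 * Real.pi * θ.lam * θ.voidExponent s r)) =
      Real.exp (-(Real.pi * θ.lam * r ^ 2)) * θ.condLaplace s r := by
  have hc1 := mul_nonneg hs h.e₁_pos.le
  have hc2 := mul_nonneg hs h.Cd_pos.le
  have h1 := integral_radialLoss h.two_lt_α hc1 hr
  have h2 := integral_radialLoss h.two_lt_α hc2 hr
  have h3 : ∫ ρ in Ioi r, θ.interfLoss s ρ = θ.p * (∫ ρ in Ioi r, radialLoss θ.α (s * θ.e₁) ρ) +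
      (1 - θ.p) * ∫ ρ in Ioi r, radialLoss θ.α (s * θ.Cd) ρ := by
    simp only [interfLoss_eq]
    rw [integral_add ((integrableOn_radialLoss h.two_lt_α hc1 hr).const_mul _)
      ((integrableOn_radialLoss h.two_lt_α hc2 hr).const_mul _), integral_const_mul,
      integral_const_mul]
  rw [condLaplace, ← Real.exp_add, voidExponent, h3]
  congr 1
  unfold hyp
  linear_combination (-Real.pi * θ.lam * θ.p) * h1 + (-Real.pi * θ.lam * (1 - θ.p)) * h2

theorem Admissible.continuousAt_interfLaplace (hr : 0 < r) :
    ContinuousAt (θ.interfLaplace s) r := by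
  obtain ⟨h1, h2⟩ := h.one_le_denoms hs hr.le
  have h3 : ContinuousAt (fun d : ℝ => d ^ (-θ.α)) r :=
    Real.continuousAt_rpow_const _ _ (Or.inl hr.ne')
  unfold interfLaplace
  have h4 : 1 + s * (θ.e₁ * r ^ (-θ.α)) ≠ 0 := by linarith
  have h5 : 1 + s * (θ.Cd * r ^ (-θ.α)) ≠ 0 := by linarith
  fun_prop (disch := assumption)

theorem Admissible.hasDerivAt_voidExponent (hr : 0 < r) :
    HasDerivAt (θ.voidExponent s) (r * θ.interfLaplace s r) r := by
  -- Near `r` the tail integral is the constant integral over `(r/2, ∞)` minus the integral from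
  -- `r/2`; this base point stays off `0` and to the left of `r`. The derivative is `r - r (1 -
  -- φ_s(r)) = r φ_s(r)`.
  have hr2 : 0 < r / 2 := by positivity
  have hI := h.integrableOn_interfLoss hs hr2
  have hcont : ContinuousAt (θ.interfLoss s) r :=
    continuousAt_id.mul (continuousAt_const.sub (h.continuousAt_interfLaplace hs hr))
  have hmeas : Measurable (θ.interfLoss s) :=
    measurable_id.mul (measurable_const.sub (θ.measurable_interfLaplace s))
  have hd := intervalIntegral.integral_hasDerivAt_right (f := θ.interfLoss s) (a := r / 2) (b := r)
    ((intervalIntegrable_iff_integrableOn_Ioc_of_le (by linarith)).2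
      (hI.mono_set Ioc_subset_Ioi_self))
    hmeas.stronglyMeasurable.stronglyMeasurableAtFilter hcont
  have hd2 : HasDerivAt (fun r : ℝ => r ^ 2 / 2) r r := by
    simpa using (hasDerivAt_pow 2 r).div_const 2
  have hd3 := (hd2.add ((hasDerivAt_const r (∫ ρ in Ioi (r / 2), θ.interfLoss s ρ)).sub hd))
  refine (hd3.congr_of_eventuallyEq ?_).congr_deriv ?_
  · filter_upwards [Ioi_mem_nhds (show r / 2 < r by linarith)] with t ht
    have := intervalIntegral.integral_Ioi_sub_Ioi hI (le_of_lt ht)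
    simp only [voidExponent, Pi.add_apply, Pi.sub_apply]
    linarith
  · unfold interfLoss
    ring

theorem Admissible.half_sq_le_voidExponent (hr : 0 < r) : r ^ 2 / 2 ≤ θ.voidExponent s r := by
  have : 0 ≤ ∫ ρ in Ioi r, θ.interfLoss s ρ :=
    setIntegral_nonneg measurableSet_Ioi fun ρ hρ => h.interfLoss_nonneg hs (hr.trans hρ).le
  unfold voidExponent
  linarith

/-- Tail integral of the density of the nearest distance under the law tilted by the
interference of all the points. -/
theorem Admissible.lintegral_tilted_density (hr : 0 < r) :
    ∫⁻ t in Ioi r, ENNReal.ofReal (2 * Real.pi * θ.lam * (t * θ.interfLaplace s t) *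
      Real.exp (-(2 * Real.pi * θ.lam * θ.voidExponent s t))) =
      ENNReal.ofReal (Real.exp (-(2 * Real.pi * θ.lam * θ.voidExponent s r))) := by
  have hlam := h.lam_pos
  have hpi := Real.pi_pos
  set F : ℝ → ℝ := fun t => -Real.exp (-(2 * Real.pi * θ.lam * θ.voidExponent s t)) with hF
  set F' : ℝ → ℝ := fun t => 2 * Real.pi * θ.lam * (t * θ.interfLaplace s t) *
      Real.exp (-(2 * Real.pi * θ.lam * θ.voidExponent s t)) with hF'
  have hderiv : ∀ t ∈ Ici r, HasDerivAt F (F' t) t := by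
    intro t ht
    have h1 := ((h.hasDerivAt_voidExponent hs (hr.trans_le ht)).const_mul
      (2 * Real.pi * θ.lam)).fun_neg.exp.fun_neg
    refine h1.congr_deriv ?_
    simp only [hF']
    ring
  have hnn : ∀ t ∈ Ioi r, 0 ≤ F' t := by
    intro t ht
    have ht0 : 0 < t := hr.trans ht
    have := h.interfLaplace_pos hs ht0.le
    simp only [hF']
    positivity
  have hlim : Filter.Tendsto F Filter.atTop (nhds 0) := by
    have h1 : Filter.Tendsto (fun t => 2 * Real.pi * θ.lam * θ.voidExponent s t) Filter.atTop
        Filter.atTop := by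
      refine Filter.Tendsto.const_mul_atTop (by positivity) ?_
      refine Filter.tendsto_atTop_mono' _ ?_
        ((Filter.tendsto_pow_atTop two_ne_zero).atTop_div_const (two_pos (α := ℝ)))
      filter_upwards [Filter.eventually_gt_atTop 0] with t ht
      exact h.half_sq_le_voidExponent hs ht
    simpa using (Real.tendsto_exp_neg_atTop_nhds_zero.comp h1).neg
  rw [← ofReal_integral_eq_lintegral_ofReal (integrableOn_Ioi_deriv_of_nonneg' hderiv hnn hlim)
    (by filter_upwards [ae_restrict_mem measurableSet_Ioi] with t ht using hnn t ht),
    integral_Ioi_of_hasDerivAt_of_nonneg' hderiv hnn hlim]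
  simp [hF]

/-- The spatial integral in the Laplace functional of the interference with an empty disc. -/
theorem Admissible.lintegral_plane_loss (hr : 0 < r) :
    ∫⁻ y : Plane, (1 - expNeg (if ‖y‖ ≤ r then ∞ else θ.interfExponent s ‖y‖)) =
      ENNReal.ofReal (2 * Real.pi * θ.voidExponent s r) := by
  -- On the disc the exponent is `∞`, so the loss is the full `1`; with the weight `ρ` this produces
  -- the term `r²/2`.
  set w : ℝ → ℝ := fun ρ => if ρ ≤ r then 1 else 1 - θ.interfLaplace s ρ with hw
  have hw0 : ∀ ρ, 0 ≤ ρ → 0 ≤ w ρ := by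
    intro ρ hρ
    simp only [hw]
    split_ifs
    · exact zero_le_one
    · linarith [h.interfLaplace_le_one hs hρ]
  have hpt : ∀ y : Plane, 1 - expNeg (if ‖y‖ ≤ r then ∞ else θ.interfExponent s ‖y‖) =
      ENNReal.ofReal (w ‖y‖) := by
    intro y
    simp only [hw]
    split_ifs with hy
    · simp
    · rw [h.expNeg_interfExponent hs (norm_nonneg y), ENNReal.ofReal_sub _
        (h.interfLaplace_pos hs (norm_nonneg y)).le, ENNReal.ofReal_one]
  have hsplit : Ioi (0 : ℝ) = Ioc 0 r ∪ Ioi r := (Ioc_union_Ioi_eq_Ioi hr.le).symm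
  have e1 : EqOn (fun ρ : ℝ => ρ ^ (2 - 1) • w ρ) id (Ioc 0 r) := by
    intro ρ hρ
    simp [hw, hρ.2]
  have e2 : EqOn (fun ρ : ℝ => ρ ^ (2 - 1) • w ρ) (θ.interfLoss s) (Ioi r) := by
    intro ρ hρ
    simp [hw, not_le.2 (show r < ρ from hρ), interfLoss]
  have i1 : IntegrableOn (fun ρ : ℝ => ρ ^ (2 - 1) • w ρ) (Ioc 0 r) :=
    (integrableOn_congr_fun e1 measurableSet_Ioc).2
      ((continuous_id.integrableOn_Icc).mono_set Ioc_subset_Icc_self)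
  have i2 : IntegrableOn (fun ρ : ℝ => ρ ^ (2 - 1) • w ρ) (Ioi r) :=
    (integrableOn_congr_fun e2 measurableSet_Ioi).2 (h.integrableOn_interfLoss hs hr)
  have hfin : Module.finrank ℝ Plane = 2 := by simp
  have hint : Integrable (fun y : Plane => w ‖y‖) := by
    rw [integrable_fun_norm_addHaar, hfin, hsplit]
    exact i1.union i2
  simp only [hpt]
  rw [← ofReal_integral_eq_lintegral_ofReal hint
    (Filter.Eventually.of_forall fun y => hw0 _ (norm_nonneg y)), integral_fun_norm_addHaar, hfin,
    hsplit, setIntegral_union (Ioc_disjoint_Ioi le_rfl) measurableSet_Ioi i1 i2,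
    setIntegral_congr_fun measurableSet_Ioc e1, setIntegral_congr_fun measurableSet_Ioi e2,
    measureReal_def, EuclideanSpace.volume_ball_fin_two]
  have h4 : ∫ ρ in Ioc 0 r, id ρ = r ^ 2 / 2 := by
    rw [← intervalIntegral.integral_of_le hr.le]
    simp
  rw [h4]
  simp only [voidExponent, smul_eq_mul, nsmul_eq_mul]
  congr 1
  simp [ENNReal.toReal_ofReal Real.pi_pos.le]
  ring

end

end Params

/-! ### Measurable selection of the nearest transmitter. -/

/-- The indices of the points of `x` that are nearest to the origin. -/
def nearestSet (x : ℕ → Plane) : Set ℕ := {k | ∀ m, ‖x k‖ ≤ ‖x m‖}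

/-- A measurable version of `nearest`, as a function of the configuration. -/
def nearestIdx (x : ℕ → Plane) : ℕ :=
  open scoped Classical in
  if (nearestSet x).Finite then Classical.epsilon fun k => k ∈ nearestSet x else 0

/-- The distance from the origin to the nearest point of `x`. -/
def nearestDist (x : ℕ → Plane) : ℝ := ‖x (nearestIdx x)‖

/-- Every ball contains only finitely many points of `x`. -/
def IsLocallyFinite (x : ℕ → Plane) : Prop :=
  ∀ n : ℕ, {k : ℕ | x k ∈ Metric.ball (0 : Plane) n}.Finite

theorem IsLocallyFinite.finite_nearestSet {x : ℕ → Plane} (hx : IsLocallyFinite x) :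
    (nearestSet x).Finite := by
  obtain ⟨n, hn⟩ := exists_nat_gt ‖x 0‖
  refine (hx n).subset fun k hk => ?_
  simp only [mem_ofPred_eq, mem_ball_zero_iff]
  exact (hk 0).trans_lt hn

theorem IsLocallyFinite.nonempty_nearestSet {x : ℕ → Plane} (hx : IsLocallyFinite x) :
    (nearestSet x).Nonempty := by
  obtain ⟨n, hn⟩ := exists_nat_gt ‖x 0‖
  have h0 : 0 ∈ {k : ℕ | x k ∈ Metric.ball (0 : Plane) n} := by simpa using hn
  obtain ⟨k, hk, hmin⟩ := Set.exists_min_image _ (fun k => ‖x k‖) (hx n) ⟨0, h0⟩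
  refine ⟨k, fun m => ?_⟩
  by_cases hm : m ∈ {k : ℕ | x k ∈ Metric.ball (0 : Plane) n}
  · exact hmin m hm
  · have h1 : (n : ℝ) ≤ ‖x m‖ := by simpa using hm
    exact (hmin 0 h0).trans (hn.le.trans h1)

theorem IsLocallyFinite.nearestIdx_mem {x : ℕ → Plane} (hx : IsLocallyFinite x) :
    nearestIdx x ∈ nearestSet x := by
  rw [nearestIdx, if_pos hx.finite_nearestSet]
  exact Classical.epsilon_spec hx.nonempty_nearestSet

theorem IsLocallyFinite.nearest_eq {Ω : Type*} {X : ℕ → Ω → Plane} {ω : Ω}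
    (hx : IsLocallyFinite fun k => X k ω) : nearest X ω = nearestIdx fun k => X k ω := by
  rw [nearestIdx, if_pos hx.finite_nearestSet]
  rfl

/-- Arbitrary choice is harmless here: `ℕ` has only countably many finite subsets, so the selector
differs from the constant `0` on a countable set. This is why the default value is imposed on
infinite sets. -/
theorem measurable_nearestIdx : Measurable nearestIdx := by
  classical
  have h1 : Measurable nearestSet := by
    rw [measurable_set_iff]
    intro k
    refine Measurable.forall fun m => ?_
    exact measurableSet_setOfPred.1 (measurableSet_le (by fun_prop) (by fun_prop))
  have h2 : Measurable fun S : Set ℕ =>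
      if S.Finite then Classical.epsilon fun k => k ∈ S else 0 := by
    refine Measurable.measurable_of_countable_ne (f := fun _ => 0) measurable_const ?_
    refine (Set.Countable.ofPred_finite (α := ℕ)).mono fun S hS => ?_
    by_contra hS'
    exact hS (if_neg hS').symm
  exact h2.comp h1

theorem measurable_nearestDist : Measurable nearestDist := by
  have h : Measurable fun q : (ℕ → Plane) × ℕ => ‖q.1 q.2‖ :=
    measurable_from_prod_countable_left fun k => (measurable_pi_apply k).norm
  have h' := h.comp (measurable_id.prodMk measurable_nearestIdx)
  unfold nearestDist
  exact h'

theorem measurable_totalInterf_nearest (θ : Params) : Measurable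
    fun q : (ℕ → Plane) × (ℕ → Mark) => θ.totalInterf q.1 (nearestIdx q.1) q.2 := by
  have h : Measurable fun q : ((ℕ → Plane) × (ℕ → Mark)) × ℕ => θ.totalInterf q.1.1 q.2 q.1.2 :=
    measurable_from_prod_countable_left fun k => θ.measurable_totalInterf k
  exact h.comp (measurable_id.prodMk (measurable_nearestIdx.comp measurable_fst))

/-- Half-lines form a generating π-system. Tails are compared only for `a > 0`, where the radial
formulas hold; `a = 0` follows by continuity from below. -/
theorem restrict_Ioi_eq_of_Ioi {m₁ m₂ : Measure ℝ} [IsFiniteMeasure m₁]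
    (h : ∀ a, 0 < a → m₁ (Ioi a) = m₂ (Ioi a)) :
    m₁.restrict (Ioi 0) = m₂.restrict (Ioi 0) := by
  have hU : Ioi (0 : ℝ) = ⋃ n : ℕ, Ioi (1 / ((n : ℝ) + 1)) := by
    ext t
    simp only [mem_Ioi, mem_iUnion]
    constructor
    · exact fun ht => exists_nat_one_div_lt ht
    · rintro ⟨n, hn⟩
      exact lt_trans (by positivity) hn
  have hmono : Monotone fun n : ℕ => Ioi (1 / ((n : ℝ) + 1)) := fun m n hmn =>
    Ioi_subset_Ioi (one_div_le_one_div_of_le (by positivity)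
      (by have : (m : ℝ) ≤ n := Nat.cast_le.2 hmn
          linarith))
  have h0 : m₁ (Ioi 0) = m₂ (Ioi 0) := by
    rw [hU, hmono.measure_iUnion, hmono.measure_iUnion]
    exact iSup_congr fun n => h _ (by positivity)
  refine ext_of_generate_finite (range Ioi) ?_ isPiSystem_Ioi ?_ ?_
  · rw [← borel_eq_generateFrom_Ioi]
    exact BorelSpace.measurable_eq
  · rintro _ ⟨a, rfl⟩
    rw [Measure.restrict_apply measurableSet_Ioi, Measure.restrict_apply measurableSet_Ioi,
      Ioi_inter_Ioi]
    rcases le_or_gt a 0 with ha | ha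
    · rw [sup_of_le_right ha, h0]
    · rw [sup_of_le_left ha.le, h a ha]
  · rw [Measure.restrict_apply_univ, Measure.restrict_apply_univ, h0]

theorem IsHPPP.ae_ne_zero {Ω : Type*} [MeasurableSpace Ω] {μ : Measure Ω} [IsProbabilityMeasure μ]
    {lam : ℝ} {X : ℕ → Ω → Plane} (h : IsHPPP lam X μ) : ∀ᵐ ω ∂μ, ∀ k, X k ω ≠ 0 := by
  -- With weight `∞` the Laplace transform is a void probability, here that of a null set, hence
  -- `1`.
  have h1 := lintegral_expNeg_pointCount h (measurableSet_singleton (0 : Plane)) (by simp) ∞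
  simp only [measure_singleton, mul_zero, zero_mul, expNeg_zero] at h1
  have h2 := ae_eq_of_ae_le_of_lintegral_le (μ := μ)
    (f := fun ω => expNeg (∞ * (pointCount X {0} ω : ℝ≥0∞))) (g := fun _ => 1)
    (Filter.Eventually.of_forall fun ω => expNeg_le_one _) (by rw [h1]; simp) (by fun_prop)
    (by rw [h1]; simp)
  filter_upwards [h2] with ω hω k hk
  have h3 : pointCount X {0} ω ≠ 0 := Set.encard_ne_zero.2 ⟨k, hk⟩
  have h4 : (pointCount X {0} ω : ℝ≥0∞) ≠ 0 := by simpa using h3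
  rw [ENNReal.top_mul h4, expNeg_top] at hω
  exact zero_ne_one hω

/-! ### Joint law of the nearest distance and the interference. -/

namespace IsNetwork

variable {Ω : Type*} [MeasurableSpace Ω] {θ : Params} {μ : Measure Ω} [IsProbabilityMeasure μ]
  {X : ℕ → Ω → Plane} {b : ℕ → Ω → Bool} {g Ir : ℕ → Ω → ℂ} {G : ℕ → Ω → ℝ}
  (hnet : IsNetwork θ μ X b g Ir G) (hθ : θ.Admissible)

include hnet

omit [IsProbabilityMeasure μ] in
theorem measurable_config : Measurable fun ω k => X k ω :=
  measurable_pi_lambda _ fun k => hnet.hppp.measurable_point k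

omit [IsProbabilityMeasure μ] in
theorem measurable_dist : Measurable fun ω => nearestDist fun k => X k ω :=
  measurable_nearestDist.comp hnet.measurable_config

omit [IsProbabilityMeasure μ] in
theorem ae_isLocallyFinite : ∀ᵐ ω ∂μ, IsLocallyFinite fun k => X k ω := hnet.hppp.ae_finite

theorem ae_dist_pos : ∀ᵐ ω ∂μ, 0 < nearestDist fun k => X k ω := by
  filter_upwards [hnet.hppp.ae_ne_zero] with ω hω
  exact norm_pos_iff.2 (hω _)

/-- Averaging over the marks first, with the positions frozen. -/
theorem lintegral_config_marks {F : (ℕ → Plane) × (ℕ → Mark) → ℝ≥0∞} (hF : Measurable F) :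
    ∫⁻ ω, F (fun k => X k ω, marks b g Ir G ω) ∂μ =
      ∫⁻ ω, ∫⁻ ω', F (fun k => X k ω, marks b g Ir G ω') ∂μ ∂μ := by
  have hX := hnet.measurable_config
  have hM := hnet.measurable_marks
  have hprod := (indepFun_iff_map_prod_eq_prod_map_map hX.aemeasurable hM.aemeasurable).1
    hnet.position_indep
  have : SFinite (μ.map (marks b g Ir G)) := inferInstance
  rw [← lintegral_map (f := F) (g := fun ω => (fun k => X k ω, marks b g Ir G ω)) hF
    (hX.prodMk hM), hprod, lintegral_prod _ hF.aemeasurable,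
    lintegral_map hF.lintegral_prod_right' hX]
  refine lintegral_congr fun ω => ?_
  exact lintegral_map (f := fun m => F (fun k => X k ω, m)) (hF.comp measurable_prodMk_left) hM

include hθ

/-- An infinite weight on the closed disc kills the exponential exactly when some point lies there,
so a single Laplace functional encodes both the event `R > r` and the tilt. -/
theorem lintegral_indicator_dist_tilted {s r : ℝ} (hs : 0 ≤ s) (hr : 0 < r) :
    ∫⁻ ω, (Ioi r).indicator 1 (nearestDist fun k => X k ω) *
      expNeg (∑' k, θ.interfExponent s ‖X k ω‖) ∂μ =
      ENNReal.ofReal (Real.exp (-(2 * Real.pi * θ.lam * θ.voidExponent s r))) := by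
  have hV : 0 ≤ θ.voidExponent s r := (by positivity : 0 ≤ r ^ 2 / 2).trans
    (hθ.half_sq_le_voidExponent hs hr)
  have hlam := hθ.lam_pos
  have hpi := Real.pi_pos
  have hm : Measurable fun y : Plane => if ‖y‖ ≤ r then ∞ else θ.interfExponent s ‖y‖ :=
    Measurable.ite (measurableSet_le (by fun_prop) (by fun_prop)) (by fun_prop) (by fun_prop)
  have h1 := hnet.hppp.laplaceFunctional hm
  rw [hθ.lintegral_plane_loss hs hr, ← ENNReal.ofReal_mul hlam.le,
    expNeg_ofReal (by positivity)] at h1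
  have e : 2 * Real.pi * θ.lam * θ.voidExponent s r =
      θ.lam * (2 * Real.pi * θ.voidExponent s r) := by ring
  rw [e, ← h1]
  refine lintegral_congr_ae ?_
  filter_upwards [hnet.ae_isLocallyFinite] with ω hω
  by_cases hR : r < nearestDist fun k => X k ω
  · rw [indicator_of_mem (show _ ∈ Ioi r from hR), Pi.one_apply, one_mul]
    congr 1
    refine tsum_congr fun k => ?_
    rw [if_neg (not_le.2 (hR.trans_le (hω.nearestIdx_mem k)))]
  · rw [indicator_of_notMem (show _ ∉ Ioi r from hR), zero_mul]
    symm
    rw [expNeg_eq_zero_iff]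
    refine ENNReal.tsum_eq_top_of_eq_top ⟨nearestIdx fun k => X k ω, if_pos (not_lt.1 hR)⟩

/-- The tails of `R` under the measure with density `T` are known and are differentiable in `r`;
matching tails identifies the law, hence the integral of every test function. -/
theorem lintegral_dist_tilted {s : ℝ} (hs : 0 ≤ s) {F : ℝ → ℝ≥0∞} (hF : Measurable F) :
    ∫⁻ ω, F (nearestDist fun k => X k ω) * expNeg (∑' k, θ.interfExponent s ‖X k ω‖) ∂μ =
      ∫⁻ t in Ioi 0, F t * ENNReal.ofReal (2 * Real.pi * θ.lam * (t * θ.interfLaplace s t) *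
        Real.exp (-(2 * Real.pi * θ.lam * θ.voidExponent s t))) := by
  set R : Ω → ℝ := fun ω => nearestDist fun k => X k ω with hR
  have hRm : Measurable R := hnet.measurable_dist
  set T : Ω → ℝ≥0∞ := fun ω => expNeg (∑' k, θ.interfExponent s ‖X k ω‖) with hT
  have hTm : Measurable T := by
    refine Measurable.expNeg (Measurable.tsum fun k => ?_)
    exact (θ.measurable_interfExponent s).comp (hnet.hppp.measurable_point k).norm
  set D : ℝ → ℝ≥0∞ := fun t => ENNReal.ofReal (2 * Real.pi * θ.lam * (t * θ.interfLaplace s t) *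
        Real.exp (-(2 * Real.pi * θ.lam * θ.voidExponent s t))) with hD
  have hVm : AEMeasurable (θ.voidExponent s) (volume.restrict (Ioi 0)) := by
    refine ContinuousOn.aemeasurable (fun t ht => ?_) measurableSet_Ioi
    exact (hθ.hasDerivAt_voidExponent hs ht).continuousAt.continuousWithinAt
  have hDm : AEMeasurable D (volume.restrict (Ioi 0)) := by
    have := θ.measurable_interfLaplace s
    simp only [hD]
    fun_prop
  have hfin : IsFiniteMeasure (μ.withDensity T) := by
    refine isFiniteMeasure_withDensity (ne_top_of_le_ne_top ENNReal.one_ne_top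
      ((lintegral_mono fun ω => expNeg_le_one _).trans ?_))
    simp
  have hlaw : ((μ.withDensity T).map R).restrict (Ioi 0) =
      (((volume.restrict (Ioi 0)).withDensity D)).restrict (Ioi 0) := by
    refine restrict_Ioi_eq_of_Ioi fun a ha => ?_
    rw [Measure.map_apply hRm measurableSet_Ioi, withDensity_apply _ (hRm measurableSet_Ioi),
      withDensity_apply _ measurableSet_Ioi, Measure.restrict_restrict measurableSet_Ioi,
      inter_eq_left.2 (Ioi_subset_Ioi ha.le), hθ.lintegral_tilted_density hs ha,
      ← hnet.lintegral_indicator_dist_tilted hθ hs ha,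
      ← lintegral_indicator (hRm measurableSet_Ioi)]
    refine lintegral_congr fun ω => ?_
    by_cases h : R ω ∈ Ioi a
    · rw [indicator_of_mem (show ω ∈ R ⁻¹' Ioi a from h), indicator_of_mem h, Pi.one_apply, one_mul]
    · rw [indicator_of_notMem (show ω ∉ R ⁻¹' Ioi a from h), indicator_of_notMem h, zero_mul]
  -- Restriction to `(0, ∞)` loses nothing, since almost surely no point sits at the origin.
  have hpos : ∀ᵐ x ∂((μ.withDensity T).map R), x ∈ Ioi (0 : ℝ) := by
    rw [ae_map_iff (p := fun x => x ∈ Ioi (0 : ℝ)) hRm.aemeasurable measurableSet_Ioi]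
    exact (withDensity_absolutelyContinuous μ T).ae_le hnet.ae_dist_pos
  rw [Measure.restrict_eq_self_of_ae_mem hpos, restrict_withDensity measurableSet_Ioi,
    Measure.restrict_restrict measurableSet_Ioi, inter_self] at hlaw
  calc ∫⁻ ω, F (R ω) * T ω ∂μ = ∫⁻ ω, F (R ω) ∂(μ.withDensity T) := by
        rw [lintegral_withDensity_eq_lintegral_mul (g := fun ω => F (R ω)) _ hTm (hF.comp hRm)]
        exact lintegral_congr fun ω => mul_comm _ _
    _ = ∫⁻ t, F t ∂((μ.withDensity T).map R) := (lintegral_map hF hRm).symm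
    _ = ∫⁻ t in Ioi 0, F t * D t := by
        rw [hlaw, lintegral_withDensity_eq_lintegral_mul₀ hDm hF.aemeasurable]
        exact lintegral_congr fun ω => mul_comm _ _

/-- Joint Laplace transform of the distance to the nearest transmitter and of the interference. -/
theorem lintegral_dist_expNeg_interf {s : ℝ} (hs : 0 ≤ s) {F : ℝ → ℝ≥0∞} (hF : Measurable F) :
    ∫⁻ ω, F (nearestDist fun k => X k ω) * expNeg (ENNReal.ofReal s *
      θ.totalInterf (fun k => X k ω) (nearestIdx fun k => X k ω) (marks b g Ir G ω)) ∂μ =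
      ∫⁻ t in Ioi 0, F t * ENNReal.ofReal (θ.distPDF t * θ.condLaplace s t) := by
  have hJ : Measurable fun q : (ℕ → Plane) × (ℕ → Mark) => F (nearestDist q.1) *
      expNeg (ENNReal.ofReal s * θ.totalInterf q.1 (nearestIdx q.1) q.2) :=
    (hF.comp (measurable_nearestDist.comp measurable_fst)).mul
      ((measurable_totalInterf_nearest θ).const_mul _).expNeg
  have hφm := (θ.measurable_interfLaplace s).ennreal_ofReal
  refine (hnet.lintegral_config_marks hJ).trans ?_
  -- The product omits the serving transmitter, while the tilted law carries all factors. Dividing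
  -- the test function by `φ_s(R)` compensates, and the factor `φ_s(t)` of the tilted density
  -- cancels this division.
  calc _ = ∫⁻ ω, (F (nearestDist fun k => X k ω) /
        ENNReal.ofReal (θ.interfLaplace s (nearestDist fun k => X k ω))) *
          expNeg (∑' k, θ.interfExponent s ‖X k ω‖) ∂μ := by
        refine lintegral_congr fun ω => ?_
        have hm : Measurable fun ω' => expNeg (ENNReal.ofReal s * θ.totalInterf (fun k => X k ω)
            (nearestIdx fun k => X k ω) (marks b g Ir G ω')) :=
          (((θ.measurable_totalInterf _).comp (measurable_const.prodMk
            hnet.measurable_marks)).const_mul _).expNeg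
        have hφ : 0 < θ.interfLaplace s (nearestDist fun k => X k ω) :=
          hθ.interfLaplace_pos hs (norm_nonneg _)
        simp only
        rw [lintegral_const_mul _ hm, hnet.lintegral_expNeg_totalInterf hθ _ _ hs,
          ENNReal.tsum_eq_add_tsum_ite (f := fun k => θ.interfExponent s ‖X k ω‖) (nearestIdx fun k => X k ω), expNeg_add,
          hθ.expNeg_interfExponent hs (norm_nonneg _), ← mul_assoc]
        congr 1
        · exact (ENNReal.div_mul_cancel (by simpa using hφ) ENNReal.ofReal_ne_top).symm
        · refine congrArg expNeg (tsum_congr fun k => ?_)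
          split_ifs <;> rfl
    _ = _ := by
        refine (hnet.lintegral_dist_tilted hθ hs (hF.div hφm)).trans ?_
        refine setLIntegral_congr_fun measurableSet_Ioi fun t ht => ?_
        have hφ : 0 < θ.interfLaplace s t := hθ.interfLaplace_pos hs (le_of_lt ht)
        have e : 2 * Real.pi * θ.lam * (t * θ.interfLaplace s t) *
            Real.exp (-(2 * Real.pi * θ.lam * θ.voidExponent s t)) =
            θ.interfLaplace s t * (θ.distPDF t * θ.condLaplace s t) := by
          rw [hθ.exp_voidExponent hs ht, Params.distPDF]
          ring
        simp only [Pi.div_apply]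
        rw [e, ENNReal.ofReal_mul hφ.le, ← mul_assoc,
          ENNReal.div_mul_cancel (by simpa using hφ) ENNReal.ofReal_ne_top]

/-- Conditional coverage probability for a fixed configuration of the transmitters. -/
theorem measure_coverage_config {γ : ℝ} (hγ : 0 ≤ γ) (x : ℕ → Plane) {i : ℕ} (hx : 0 < ‖x i‖) :
    μ {ω | ENNReal.ofReal γ < ENNReal.ofReal (θ.markSignal ‖x i‖ (marks b g Ir G ω i)) /
      (θ.totalInterf x i (marks b g Ir G ω) + ENNReal.ofReal θ.γt⁻¹)} =
      ∫⁻ ω, (if θ.totalInterf x i (marks b g Ir G ω) = ∞ then 0 else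
        ENNReal.ofReal (θ.condCoverage γ ‖x i‖ (θ.totalInterf x i (marks b g Ir G ω)).toReal)) ∂μ := by
  have hγt : 0 < θ.γt⁻¹ := inv_pos.2 hθ.γt_pos
  have hIm : Measurable fun ω => θ.totalInterf x i (marks b g Ir G ω) :=
    θ.measurable_totalInterf_of_ne x fun k _ => hnet.measurable_mark k
  have hMm : Measurable fun ω => marks b g Ir G ω i :=
    (measurable_pi_apply i).comp hnet.measurable_marks
  set S : Set (ℝ≥0∞ × Mark) := {q | ENNReal.ofReal γ <
    ENNReal.ofReal (θ.markSignal ‖x i‖ q.2) / (q.1 + ENNReal.ofReal θ.γt⁻¹)} with hS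
  have hSm : MeasurableSet S := measurableSet_lt measurable_const
    ((θ.measurable_markSignal.comp (measurable_const.prodMk measurable_snd)).ennreal_ofReal.div
      (measurable_fst.add measurable_const))
  have hprod := (indepFun_iff_map_prod_eq_prod_map_map hIm.aemeasurable hMm.aemeasurable).1
    (hnet.indepFun_totalInterf_mark x i)
  have h1 : μ {ω | ENNReal.ofReal γ < ENNReal.ofReal (θ.markSignal ‖x i‖ (marks b g Ir G ω i)) /
      (θ.totalInterf x i (marks b g Ir G ω) + ENNReal.ofReal θ.γt⁻¹)} =
      μ.map (fun ω => (θ.totalInterf x i (marks b g Ir G ω), marks b g Ir G ω i)) S := by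
    rw [Measure.map_apply (hIm.prodMk hMm) hSm]
    rfl
  rw [h1, hprod, Measure.prod_apply hSm, lintegral_map (measurable_measure_prodMk_left hSm) hIm]
  refine lintegral_congr fun ω => ?_
  set z := θ.totalInterf x i (marks b g Ir G ω)
  rw [Measure.map_apply hMm (measurable_prodMk_left hSm)]
  -- Infinite interference makes the ratio `0`, which exceeds no threshold.
  split_ifs with hz
  · have : (fun ω => marks b g Ir G ω i) ⁻¹' (Prod.mk z ⁻¹' S) = ∅ := by
      ext ω'
      simp [hS, hz]
    rw [this, measure_empty]
  · have hy : 0 ≤ γ * (z.toReal + θ.γt⁻¹) := by positivity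
    rw [Params.condCoverage, ← hnet.measure_lt_markSignal hθ i hx hy]
    congr 1
    ext ω'
    simp only [hS, mem_preimage, mem_ofPred_eq]
    have hden : z + ENNReal.ofReal θ.γt⁻¹ = ENNReal.ofReal (z.toReal + θ.γt⁻¹) := by
      rw [ENNReal.ofReal_add ENNReal.toReal_nonneg hγt.le, ENNReal.ofReal_toReal hz]
    rw [hden, ENNReal.lt_div_iff_mul_lt (Or.inl (by
      rw [ne_eq, ENNReal.ofReal_eq_zero, not_le]; positivity)) (Or.inl ENNReal.ofReal_ne_top),
      ← ENNReal.ofReal_mul hγ, ENNReal.ofReal_lt_ofReal_iff']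
    constructor
    · exact fun h => h.1
    · exact fun h => ⟨h, hy.trans_lt h⟩

/-- Coverage probability in terms of the distance to the nearest transmitter and of the
interference. -/
theorem measure_coverage {γ : ℝ} (hγ : 0 ≤ γ)
    (hfinite : ∀ᵐ ω ∂μ, θ.totalInterf (fun k => X k ω) (nearestIdx fun k => X k ω)
      (marks b g Ir G ω) ≠ ∞) :
    μ {ω | ENNReal.ofReal γ < sinr θ X b g Ir G ω} =
      ∫⁻ ω, ENNReal.ofReal (θ.condCoverage γ (nearestDist fun k => X k ω)
        (θ.totalInterf (fun k => X k ω) (nearestIdx fun k => X k ω)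
          (marks b g Ir G ω)).toReal) ∂μ := by
  have hcm : Measurable fun q : ℝ × ℝ => θ.condCoverage γ q.1 q.2 := by
    have h1 := (continuous_erlangTail θ.κhat).measurable
    have h2 := θ.measurable_ηg
    unfold Params.condCoverage
    fun_prop
  have hIm := measurable_totalInterf_nearest θ
  set E : Set ((ℕ → Plane) × (ℕ → Mark)) := {q | ENNReal.ofReal γ <
    ENNReal.ofReal (θ.markSignal (nearestDist q.1) (q.2 (nearestIdx q.1))) /
      (θ.totalInterf q.1 (nearestIdx q.1) q.2 + ENNReal.ofReal θ.γt⁻¹)} with hE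
  have hmark : Measurable fun q : (ℕ → Plane) × (ℕ → Mark) => q.2 (nearestIdx q.1) := by
    have h : Measurable fun q : (ℕ → Mark) × ℕ => q.1 q.2 :=
      measurable_from_prod_countable_left fun k => measurable_pi_apply k
    exact h.comp (measurable_snd.prodMk (measurable_nearestIdx.comp measurable_fst))
  have hdm : Measurable fun q : (ℕ → Plane) × (ℕ → Mark) => nearestDist q.1 :=
    measurable_nearestDist.comp measurable_fst
  have hEm : MeasurableSet E := measurableSet_lt measurable_const
    ((θ.measurable_markSignal.comp (hdm.prodMk hmark)).ennreal_ofReal.div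
      (hIm.add measurable_const))
  have hXM : Measurable fun ω => ((fun k => X k ω), marks b g Ir G ω) :=
    hnet.measurable_config.prodMk hnet.measurable_marks
  set Q : (ℕ → Plane) × (ℕ → Mark) → ℝ≥0∞ := fun q =>
    if θ.totalInterf q.1 (nearestIdx q.1) q.2 = ∞ then 0 else
      ENNReal.ofReal (θ.condCoverage γ (nearestDist q.1)
        (θ.totalInterf q.1 (nearestIdx q.1) q.2).toReal) with hQ
  have hQm : Measurable Q := Measurable.ite (hIm (measurableSet_singleton ∞)) measurable_const
    (hcm.comp (hdm.prodMk hIm.ennreal_toReal)).ennreal_ofReal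
  calc μ {ω | ENNReal.ofReal γ < sinr θ X b g Ir G ω}
      = μ {ω | ((fun k => X k ω), marks b g Ir G ω) ∈ E} := by
        refine measure_congr ?_
        filter_upwards [hnet.ae_isLocallyFinite] with ω hω
        refine propext ?_
        change ENNReal.ofReal γ < sinr θ X b g Ir G ω ↔ _
        rw [sinr, hω.nearest_eq]
        rfl
    _ = ∫⁻ ω, E.indicator 1 ((fun k => X k ω), marks b g Ir G ω) ∂μ := by
        exact (lintegral_indicator_one (hXM hEm)).symm
    _ = ∫⁻ ω, ∫⁻ ω', E.indicator 1 ((fun k => X k ω), marks b g Ir G ω') ∂μ ∂μ :=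
        hnet.lintegral_config_marks (measurable_one.indicator hEm)
    -- With the positions frozen, the serving mark is integrated out; the freezing is then undone to
    -- return to a single expectation.
    _ = ∫⁻ ω, ∫⁻ ω', Q ((fun k => X k ω), marks b g Ir G ω') ∂μ ∂μ := by
        refine lintegral_congr_ae ?_
        filter_upwards [hnet.ae_dist_pos] with ω hω
        refine Eq.trans ?_ (hnet.measure_coverage_config hθ hγ (fun k => X k ω) hω)
        have hm : MeasurableSet {ω' | ((fun k => X k ω), marks b g Ir G ω') ∈ E} :=
          (measurable_const.prodMk hnet.measurable_marks) hEm
        exact lintegral_indicator_one hm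
    _ = ∫⁻ ω, Q ((fun k => X k ω), marks b g Ir G ω) ∂μ := (hnet.lintegral_config_marks hQm).symm
    _ = _ := by
        refine lintegral_congr_ae ?_
        filter_upwards [hfinite] with ω hω
        simp only [hQ]
        rw [if_neg hω]

end IsNetwork

/-! ### Regularity of the closed forms and their link with `condLaplace`. -/

namespace Params

variable {θ : Params}

theorem Admissible.contDiffAt_hyp (h : θ.Admissible) {x : ℝ} (hx : x < 1) :
    ContDiffAt ℝ ((⊤ : ℕ∞) : WithTop ℕ∞) θ.hyp x := by
  have h2 := h.two_lt_α
  exact contDiffAt_hyp2F1 (div_pos two_pos (by linarith)) ((div_lt_one (by linarith)).2 h2) hx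

theorem Admissible.hyp_zero (h : θ.Admissible) : θ.hyp 0 = 1 := by
  have h2 := h.two_lt_α
  rw [hyp, hyp2F1_eq_integral (div_pos two_pos (by linarith)) ((div_lt_one (by linarith)).2 h2)
    one_pos]
  simp

theorem Admissible.condLaplace_zero (h : θ.Admissible) (t : ℝ) : θ.condLaplace 0 t = 1 := by
  simp [condLaplace, h.hyp_zero]

theorem condLaplace_pos (s t : ℝ) : 0 < θ.condLaplace s t := Real.exp_pos _

/-- Read off from `voidExponent ≥ t²/2` rather than from bounds on the hypergeometric function. -/
theorem Admissible.condLaplace_le_one (h : θ.Admissible) {s t : ℝ} (hs : 0 ≤ s) (ht : 0 < t) :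
    θ.condLaplace s t ≤ 1 := by
  have h1 := h.exp_voidExponent hs ht
  have h2 := h.half_sq_le_voidExponent hs ht
  have h3 : 0 < 2 * Real.pi * θ.lam := by
    have := h.lam_pos
    positivity
  have h4 : Real.exp (-(2 * Real.pi * θ.lam * θ.voidExponent s t)) ≤
      Real.exp (-(Real.pi * θ.lam * t ^ 2)) := by
    apply Real.exp_le_exp.2
    nlinarith [mul_le_mul_of_nonneg_left h2 h3.le]
  rw [h1] at h4
  exact le_of_mul_le_mul_left (by linarith) (Real.exp_pos (-(Real.pi * θ.lam * t ^ 2)))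

theorem Admissible.continuousAt_condLaplace (h : θ.Admissible) {s t : ℝ} (hs : 0 ≤ s)
    (ht : 0 < t) : ContinuousAt (fun q : ℝ × ℝ => θ.condLaplace q.1 q.2) (s, t) := by
  have hpow : ContinuousAt (fun q : ℝ × ℝ => q.2 ^ (-θ.α)) (s, t) :=
    continuousAt_snd.rpow_const (Or.inl ht.ne')
  have hc : ∀ c : ℝ, 0 < c →
      ContinuousAt (fun q : ℝ × ℝ => θ.hyp (-(q.1 * c * q.2 ^ (-θ.α)))) (s, t) := by
    intro c hc
    have h1 : 0 ≤ s * c * t ^ (-θ.α) := by positivity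
    have h2 : ContinuousAt (fun q : ℝ × ℝ => -(q.1 * c * q.2 ^ (-θ.α))) (s, t) := by fun_prop
    exact ContinuousAt.comp (g := θ.hyp) (f := fun q : ℝ × ℝ => -(q.1 * c * q.2 ^ (-θ.α)))
      (h.contDiffAt_hyp (show -(s * c * t ^ (-θ.α)) < 1 by linarith)).continuousAt h2
  have h3 := hc _ h.e₁_pos
  have h4 := hc _ h.Cd_pos
  unfold condLaplace
  fun_prop

theorem Admissible.aemeasurable_condLaplace (h : θ.Admissible) {s : ℝ} (hs : 0 ≤ s) :
    AEMeasurable (θ.condLaplace s) (volume.restrict (Ioi 0)) := by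
  refine ContinuousOn.aemeasurable (fun t ht => ?_) measurableSet_Ioi
  exact ((h.continuousAt_condLaplace hs ht).comp (f := fun t : ℝ => (s, t))
    (by fun_prop)).continuousWithinAt

theorem Admissible.distPDF_pos (h : θ.Admissible) {t : ℝ} (ht : 0 < t) : 0 < θ.distPDF t := by
  have := h.lam_pos
  unfold distPDF
  positivity

@[fun_prop]
theorem measurable_distPDF (θ : Params) : Measurable θ.distPDF := by
  unfold distPDF
  fun_prop

/-- The noise factor times the interference transform, at `s` times the threshold over the gamma
scale `η_g χbar`. The powers of `t` in `η_g` cancel those inside the hypergeometric arguments. -/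
theorem Admissible.exp_W (h : θ.Admissible) {γ s t : ℝ} (ht : 0 < t) :
    Real.exp (θ.W γ s t) = Real.exp (-(s * (γ / (θ.ηg t * θ.χbar)) * θ.γt⁻¹)) *
      θ.condLaplace (s * (γ / (θ.ηg t * θ.χbar))) t := by
  have hχ := h.χbar_pos
  have hCd := h.Cd_pos
  have ht' := Real.rpow_pos_of_pos ht θ.α
  have e1 : s * (γ / (θ.ηg t * θ.χbar)) * θ.e₁ * t ^ (-θ.α) = θ.e₁ * γ / (θ.Cd * θ.χbar) * s := by
    rw [ηg, Real.rpow_neg ht.le]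
    field_simp
  have e2 : s * (γ / (θ.ηg t * θ.χbar)) * θ.Cd * t ^ (-θ.α) = γ / θ.χbar * s := by
    rw [ηg, Real.rpow_neg ht.le]
    field_simp
  have e3 : s * (γ / (θ.ηg t * θ.χbar)) * θ.γt⁻¹ = γ * θ.γt⁻¹ / (θ.Cd * θ.χbar) * t ^ θ.α * s := by
    rw [ηg, Real.rpow_neg ht.le]
    field_simp
  rw [condLaplace, ← Real.exp_add, e1, e2, e3, W]
  congr 1
  ring

theorem Admissible.qStar_eq (h : θ.Admissible) {γ t : ℝ} (ht : 0 < t) :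
    θ.qStar γ t = Real.exp (-(γ / θ.ηg t * θ.γt⁻¹)) * θ.condLaplace (γ / θ.ηg t) t := by
  have hCd := h.Cd_pos
  have ht' := Real.rpow_pos_of_pos ht θ.α
  have e1 : γ / θ.ηg t * θ.e₁ * t ^ (-θ.α) = θ.e₁ * γ / θ.Cd := by
    rw [ηg, Real.rpow_neg ht.le]
    field_simp
  have e2 : γ / θ.ηg t * θ.Cd * t ^ (-θ.α) = γ := by
    rw [ηg, Real.rpow_neg ht.le]
    field_simp
  have e3 : γ / θ.ηg t * θ.γt⁻¹ = γ * θ.γt⁻¹ / θ.Cd * t ^ θ.α := by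
    rw [ηg, Real.rpow_neg ht.le]
    field_simp
  rw [condLaplace, ← Real.exp_add, e1, e2, e3, qStar]
  congr 1
  ring

theorem Admissible.contDiffAt_exp_W (h : θ.Admissible) {γ : ℝ} (hγ : 0 ≤ γ) (r : ℝ) :
    ContDiffAt ℝ ((⊤ : ℕ∞) : WithTop ℕ∞) (fun s => Real.exp (θ.W γ s r)) 1 := by
  have hc : ∀ c : ℝ, 0 ≤ c →
      ContDiffAt ℝ ((⊤ : ℕ∞) : WithTop ℕ∞) (fun s => θ.hyp (-(c * s))) 1 := by
    intro c hc
    exact ContDiffAt.comp (g := θ.hyp) (f := fun s : ℝ => -(c * s)) 1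
      (h.contDiffAt_hyp (by linarith)) (by fun_prop)
  have h1 := h.e₁_pos
  have h2 := h.Cd_pos
  have h3 := h.χbar_pos
  have h4 := hc (θ.e₁ * γ / (θ.Cd * θ.χbar)) (by positivity)
  have h5 := hc (γ / θ.χbar) (by positivity)
  unfold W
  fun_prop

end Params

/-! ### Conditional Laplace transforms and derivatives of moment generating functions. -/

section CondDistrib

variable {Ω : Type*} [MeasurableSpace Ω] {μ : Measure Ω} [IsProbabilityMeasure μ]
  {R : Ω → ℝ} {Y : Ω → ℝ≥0}

theorem lintegral_eq_lintegral_condDistrib (hR : Measurable R) (hY : Measurable Y)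
    {F : ℝ × ℝ≥0 → ℝ≥0∞} (hF : Measurable F) :
    ∫⁻ ω, F (R ω, Y ω) ∂μ = ∫⁻ t, ∫⁻ y, F (t, y) ∂(condDistrib Y R μ t) ∂(μ.map R) := by
  rw [← Measure.lintegral_compProd hF, compProd_map_condDistrib hY.aemeasurable,
    lintegral_map hF (hR.prodMk hY)]

/-- For fixed `s`, testing against indicators identifies the conditional transform off a null set
depending on `s`. Rational `s` give one common null set, and continuity in `s` of both sides does
the rest. -/
theorem ae_integral_exp_condDistrib (hR : Measurable R) (hY : Measurable Y) {f : ℝ → ℝ}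
    {L : ℝ → ℝ → ℝ} (hf : Measurable f) (hf0 : ∀ t, 0 < t → 0 ≤ f t)
    (hlaw : μ.map R = (volume.restrict (Ioi 0)).withDensity fun t => ENNReal.ofReal (f t))
    (hLm : ∀ s, 0 ≤ s → AEMeasurable (L s) (volume.restrict (Ioi 0)))
    (hL0 : ∀ s t, 0 ≤ L s t)
    (hLc : ∀ s t, 0 ≤ s → 0 < t → ContinuousAt (fun s => L s t) s)
    (hjoint : ∀ s, 0 ≤ s → ∀ F : ℝ → ℝ≥0∞, Measurable F →
      ∫⁻ ω, F (R ω) * ENNReal.ofReal (Real.exp (-(s * Y ω))) ∂μ =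
        ∫⁻ t in Ioi 0, F t * ENNReal.ofReal (f t * L s t)) :
    ∀ᵐ t ∂(μ.map R), ∀ s, 0 ≤ s →
      ∫ y : ℝ≥0, Real.exp (-(s * y)) ∂(condDistrib Y R μ t) = L s t := by
  have hprob : IsProbabilityMeasure (μ.map R) := Measure.isProbabilityMeasure_map hR.aemeasurable
  have hac : μ.map R ≪ volume.restrict (Ioi 0) := by
    rw [hlaw]
    exact withDensity_absolutelyContinuous _ _
  have hint : ∀ (s : ℝ) (t : ℝ), 0 ≤ s →
      Integrable (fun y : ℝ≥0 => Real.exp (-(s * y))) (condDistrib Y R μ t) := by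
    intro s t hs
    refine Integrable.mono' (integrable_const 1)
      (Measurable.aestronglyMeasurable (by fun_prop)) (Filter.Eventually.of_forall fun y => ?_)
    rw [Real.norm_of_nonneg (Real.exp_pos _).le, Real.exp_le_one_iff]
    have : 0 ≤ s * (y : ℝ) := by positivity
    linarith
  have hfix : ∀ s, 0 ≤ s → ∀ᵐ t ∂(μ.map R),
      ∫ y : ℝ≥0, Real.exp (-(s * y)) ∂(condDistrib Y R μ t) = L s t := by
    intro s hs
    have hmE : Measurable fun q : ℝ × ℝ≥0 => ENNReal.ofReal (Real.exp (-(s * q.2))) := by fun_prop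
    have hm1 : Measurable fun t => ∫⁻ y : ℝ≥0, ENNReal.ofReal (Real.exp (-(s * y)))
        ∂(condDistrib Y R μ t) := hmE.lintegral_kernel_prod_right'
    have hm2 : AEMeasurable (fun t => ENNReal.ofReal (L s t)) (μ.map R) :=
      ((hLm s hs).mono_ac hac).ennreal_ofReal
    have key : (fun t => ∫⁻ y : ℝ≥0, ENNReal.ofReal (Real.exp (-(s * y)))
        ∂(condDistrib Y R μ t)) =ᵐ[μ.map R] fun t => ENNReal.ofReal (L s t) := by
      refine ae_eq_of_forall_setLIntegral_eq_of_sigmaFinite₀ hm1.aemeasurable hm2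
        fun A hA _ => ?_
      have hFm : Measurable (A.indicator (1 : ℝ → ℝ≥0∞)) := measurable_one.indicator hA
      have h1 := lintegral_eq_lintegral_condDistrib (μ := μ) hR hY
        (F := fun q => A.indicator 1 q.1 * ENNReal.ofReal (Real.exp (-(s * q.2))))
        ((hFm.comp measurable_fst).mul hmE)
      rw [hjoint s hs _ hFm] at h1
      have h2 : ∀ t, ∫⁻ y : ℝ≥0, A.indicator 1 t * ENNReal.ofReal (Real.exp (-(s * y)))
          ∂(condDistrib Y R μ t) = A.indicator (fun t => ∫⁻ y : ℝ≥0,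
            ENNReal.ofReal (Real.exp (-(s * y))) ∂(condDistrib Y R μ t)) t := by
        intro t
        by_cases ht : t ∈ A <;> simp [ht]
      simp only [h2] at h1
      rw [← lintegral_indicator hA, ← h1, hlaw, restrict_withDensity hA,
        lintegral_withDensity_eq_lintegral_mul₀ hf.ennreal_ofReal.aemeasurable
          (((hLm s hs).ennreal_ofReal).mono_measure Measure.restrict_le_self),
        ← lintegral_indicator hA]
      refine setLIntegral_congr_fun measurableSet_Ioi fun t ht => ?_
      by_cases htA : t ∈ A
      · simp [htA, ENNReal.ofReal_mul (hf0 t ht)]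
      · simp [htA]
    filter_upwards [key] with t ht
    rw [← ofReal_integral_eq_lintegral_ofReal (hint s t hs)
      (Filter.Eventually.of_forall fun y => (Real.exp_pos _).le)] at ht
    exact (ENNReal.ofReal_eq_ofReal_iff (integral_nonneg fun y => (Real.exp_pos _).le)
      (hL0 s t)).1 ht
  have hpos : ∀ᵐ t ∂(μ.map R), 0 < t := hac.ae_le (ae_restrict_mem measurableSet_Ioi)
  have hrat : ∀ᵐ t ∂(μ.map R), ∀ n : ℚ, 0 ≤ n →
      ∫ y : ℝ≥0, Real.exp (-((n : ℝ) * y)) ∂(condDistrib Y R μ t) = L n t := by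
    rw [ae_all_iff]
    intro n
    by_cases hn : 0 ≤ n
    · filter_upwards [hfix n (by exact_mod_cast hn)] with t ht _ using ht
    · exact Filter.Eventually.of_forall fun t h => absurd h hn
  filter_upwards [hpos, hrat] with t ht hq s hs
  -- Approximation from above keeps the rationals nonnegative, even at `s = 0`.
  obtain ⟨u, -, hu, hulim⟩ := Real.exists_seq_rat_strictAnti_tendsto s
  have hu0 : ∀ n, (0 : ℝ) ≤ u n := fun n => hs.trans (hu n).le
  have h1 : Filter.Tendsto (fun n => L (u n) t) Filter.atTop (nhds (L s t)) :=
    (hLc s t hs ht).tendsto.comp hulim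
  have h2 : Filter.Tendsto (fun n => ∫ y : ℝ≥0, Real.exp (-((u n : ℝ) * y))
      ∂(condDistrib Y R μ t)) Filter.atTop
      (nhds (∫ y : ℝ≥0, Real.exp (-(s * y)) ∂(condDistrib Y R μ t))) := by
    refine tendsto_integral_of_dominated_convergence (fun _ => 1)
      (fun n => Measurable.aestronglyMeasurable (by fun_prop)) (integrable_const 1)
      (fun n => Filter.Eventually.of_forall fun y => ?_) (Filter.Eventually.of_forall fun y => ?_)
    · rw [Real.norm_of_nonneg (Real.exp_pos _).le, Real.exp_le_one_iff]
      have : 0 ≤ (u n : ℝ) * (y : ℝ) := mul_nonneg (hu0 n) y.coe_nonneg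
      linarith
    · exact ((Real.continuous_exp.tendsto _).comp (hulim.mul_const (y : ℝ)).neg)
  have h3 : ∀ n, ∫ y : ℝ≥0, Real.exp (-((u n : ℝ) * y)) ∂(condDistrib Y R μ t) = L (u n) t :=
    fun n => hq (u n) (by exact_mod_cast hu0 n)
  simp only [h3] at h2
  exact tendsto_nhds_unique h2 h1

end CondDistrib

/-- The Erlang tail expressed through the derivatives of a Laplace transform. -/
theorem sum_iteratedDeriv_mgf_eq_integral_erlangTail {α : Type*} [MeasurableSpace α]
    {ν : Measure α} [IsFiniteMeasure ν] {Z : α → ℝ} (hZm : Measurable Z) (hZ : ∀ y, 0 ≤ Z y)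
    (k : ℕ) :
    ∑ i ∈ Finset.range k, (-1) ^ i / (Nat.factorial i : ℝ) *
      iteratedDeriv i (mgf (fun y => -Z y) ν) 1 = ∫ y, erlangTail k (Z y) ∂ν := by
  have hset : Ioi (0 : ℝ) ⊆ integrableExpSet (fun y => -Z y) ν := by
    intro s hs
    have hs0 : (0 : ℝ) < s := hs
    refine Integrable.mono' (integrable_const 1)
      (Measurable.aestronglyMeasurable (by fun_prop)) (Filter.Eventually.of_forall fun y => ?_)
    rw [Real.norm_of_nonneg (Real.exp_pos _).le, Real.exp_le_one_iff]
    have := mul_nonneg hs0.le (hZ y)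
    linarith
  -- `e^{-sZ}` is integrable for all `s > 0`, so differentiation under the integral is legitimate at
  -- `1` without any moment assumption on `Z`.
  have hmem : (1 : ℝ) ∈ interior (integrableExpSet (fun y => -Z y) ν) :=
    interior_maximal hset isOpen_Ioi (mem_Ioi.2 one_pos)
  have hint : ∀ i ∈ Finset.range k,
      Integrable (fun y => Z y ^ i * Real.exp (-Z y) / (Nat.factorial i : ℝ)) ν := by
    intro i _
    refine Integrable.mono' (integrable_const 1)
      (Measurable.aestronglyMeasurable (by fun_prop)) (Filter.Eventually.of_forall fun y => ?_)
    have h0 := hZ y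
    rw [Real.norm_of_nonneg (by positivity)]
    -- Each term is the last summand of an Erlang tail, hence at most `1`.
    refine le_trans ?_ (erlangTail_le_one (i + 1) h0)
    rw [erlangTail, Finset.sum_range_succ]
    have := erlangTail_nonneg i h0
    unfold erlangTail at this
    linarith
  unfold erlangTail
  rw [integral_finsetSum _ hint]
  refine Finset.sum_congr rfl fun i _ => ?_
  rw [iteratedDeriv_mgf hmem, ← integral_const_mul]
  refine integral_congr_ae (Filter.Eventually.of_forall fun y => ?_)
  simp only [one_mul]
  rw [neg_pow (Z y) i]
  have : ((-1 : ℝ) ^ i) * (-1) ^ i = 1 := by rw [← mul_pow]; simp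
  linear_combination (Z y ^ i * Real.exp (-Z y) / (Nat.factorial i : ℝ)) * this

/-- A random variable whose Laplace transform tends to `1` at `0` is almost surely finite. -/
theorem ae_ne_top_of_tendsto_lintegral_expNeg {Ω : Type*} [MeasurableSpace Ω] {μ : Measure Ω}
    [IsProbabilityMeasure μ] {I : Ω → ℝ≥0∞} (hI : Measurable I) {u : ℕ → ℝ} (hu0 : ∀ n, 0 < u n)
    (hulim : Filter.Tendsto u Filter.atTop (nhds 0))
    (h : Filter.Tendsto (fun n => ∫⁻ ω, expNeg (ENNReal.ofReal (u n) * I ω) ∂μ) Filter.atTop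
      (nhds 1)) : ∀ᵐ ω ∂μ, I ω ≠ ∞ := by
  have hL : Filter.Tendsto (fun n => ∫⁻ ω, expNeg (ENNReal.ofReal (u n) * I ω) ∂μ) Filter.atTop
      (nhds (∫⁻ ω, {ω | I ω ≠ ∞}.indicator 1 ω ∂μ)) := by
    refine tendsto_lintegral_of_dominated_convergence (fun _ => 1)
      (fun n => (hI.const_mul _).expNeg) (fun n => Filter.Eventually.of_forall fun ω =>
        expNeg_le_one _) (by simp) (Filter.Eventually.of_forall fun ω => ?_)
    by_cases hω : I ω = ∞
    · have h1 : ∀ n, expNeg (ENNReal.ofReal (u n) * I ω) = 0 := by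
        intro n
        rw [hω, ENNReal.mul_top (by simpa using hu0 n), expNeg_top]
      simp only [h1]
      simp [hω]
    · have h1 : Filter.Tendsto (fun n => ENNReal.ofReal (u n) * I ω) Filter.atTop (nhds 0) := by
        have := ENNReal.Tendsto.mul_const (b := I ω) (ENNReal.tendsto_ofReal hulim) (Or.inr hω)
        simpa using this
      have h2 := (continuous_expNeg.tendsto 0).comp h1
      rw [expNeg_zero] at h2
      rw [indicator_of_mem (show ω ∈ {ω | I ω ≠ ∞} from hω)]
      exact h2
  have hset : MeasurableSet {ω | I ω ≠ ∞} := (hI (measurableSet_singleton ∞)).compl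
  have hprob := tendsto_nhds_unique hL h
  rw [lintegral_indicator_one hset] at hprob
  exact (mem_ae_iff_prob_eq_one hset).2 hprob

/-! ### Law of the nearest distance and finiteness of the interference. -/

namespace IsNetwork

variable {Ω : Type*} [MeasurableSpace Ω] {θ : Params} {μ : Measure Ω} [IsProbabilityMeasure μ]
  {X : ℕ → Ω → Plane} {b : ℕ → Ω → Bool} {g Ir : ℕ → Ω → ℂ} {G : ℕ → Ω → ℝ}
  (hnet : IsNetwork θ μ X b g Ir G) (hθ : θ.Admissible)

include hnet hθ

/-- The distance to the nearest transmitter has density `distPDF`. -/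
theorem map_nearestDist : μ.map (fun ω => nearestDist fun k => X k ω) =
    (volume.restrict (Ioi 0)).withDensity fun t => ENNReal.ofReal (θ.distPDF t) := by
  ext A hA
  have hFm : Measurable (A.indicator (1 : ℝ → ℝ≥0∞)) := measurable_one.indicator hA
  have h := hnet.lintegral_dist_expNeg_interf hθ le_rfl hFm
  simp only [ENNReal.ofReal_zero, zero_mul, expNeg_zero, mul_one, hθ.condLaplace_zero] at h
  rw [withDensity_apply _ hA, ← lintegral_indicator_one hA, lintegral_map hFm hnet.measurable_dist,
    h, ← lintegral_indicator hA]
  refine lintegral_congr fun t => ?_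
  by_cases ht : t ∈ A <;> simp [ht]

omit [IsProbabilityMeasure μ] hθ in
theorem measurable_totalInterf : Measurable fun ω => θ.totalInterf (fun k => X k ω)
    (nearestIdx fun k => X k ω) (marks b g Ir G ω) := by
  have h := (measurable_totalInterf_nearest θ).comp
    (hnet.measurable_config.prodMk hnet.measurable_marks)
  exact h

/-- As `s → 0` the transform tends to the total mass of `distPDF`, dominated by that density because
`condLaplace ≤ 1`; an atom at `∞` would keep the limit below `1`. -/
theorem ae_totalInterf_ne_top : ∀ᵐ ω ∂μ, θ.totalInterf (fun k => X k ω)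
    (nearestIdx fun k => X k ω) (marks b g Ir G ω) ≠ ∞ := by
  have hone : ∫⁻ t in Ioi 0, ENNReal.ofReal (θ.distPDF t) = 1 := by
    have := hnet.map_nearestDist hθ
    have h2 := congrArg (fun ν : Measure ℝ => ν univ) this
    simp only [withDensity_apply _ MeasurableSet.univ, Measure.restrict_univ,
      Measure.map_apply hnet.measurable_dist MeasurableSet.univ, preimage_univ, measure_univ] at h2
    exact h2.symm
  have hu0 : ∀ n : ℕ, 0 < 1 / ((n : ℝ) + 1) := fun n => by positivity
  have hulim : Filter.Tendsto (fun n : ℕ => 1 / ((n : ℝ) + 1)) Filter.atTop (nhds 0) :=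
    tendsto_one_div_add_atTop_nhds_zero_nat
  refine ae_ne_top_of_tendsto_lintegral_expNeg hnet.measurable_totalInterf hu0 hulim ?_
  have hid : ∀ n : ℕ, ∫⁻ ω, expNeg (ENNReal.ofReal (1 / ((n : ℝ) + 1)) *
      θ.totalInterf (fun k => X k ω) (nearestIdx fun k => X k ω) (marks b g Ir G ω)) ∂μ =
      ∫⁻ t in Ioi 0, ENNReal.ofReal (θ.distPDF t * θ.condLaplace (1 / ((n : ℝ) + 1)) t) := by
    intro n
    have h := hnet.lintegral_dist_expNeg_interf hθ (hu0 n).le (F := fun _ => 1) measurable_const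
    simp only [one_mul] at h
    exact h
  rw [funext hid, ← hone]
  refine tendsto_lintegral_of_dominated_convergence' (fun t => ENNReal.ofReal (θ.distPDF t))
    (fun n => ?_) (fun n => ?_) (by rw [hone]; simp) ?_
  · exact ((θ.measurable_distPDF.aemeasurable).mul
      (hθ.aemeasurable_condLaplace (hu0 n).le)).ennreal_ofReal
  · filter_upwards [ae_restrict_mem measurableSet_Ioi] with t ht
    refine ENNReal.ofReal_le_ofReal ?_
    exact mul_le_of_le_one_right (hθ.distPDF_pos ht).le (hθ.condLaplace_le_one (hu0 n).le ht)
  · filter_upwards [ae_restrict_mem measurableSet_Ioi] with t ht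
    refine ENNReal.tendsto_ofReal ?_
    have h1 : ContinuousAt (fun s => θ.condLaplace s t) 0 :=
      (hθ.continuousAt_condLaplace le_rfl ht).comp (f := fun s : ℝ => (s, t)) (by fun_prop)
    have h2 := (h1.tendsto.comp hulim).const_mul (θ.distPDF t)
    rw [hθ.condLaplace_zero, mul_one] at h2
    exact h2

end IsNetwork

/-! ### The closed forms as averages of conditional coverage. -/

namespace Params

variable {θ : Params}

/-- Conditional coverage through an RIS-assisted server, given interference `y` and serving
distance `t`. -/
def plusCoverage (θ : Params) (γ t y : ℝ) : ℝ :=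
  erlangTail θ.κhat (γ * (y + θ.γt⁻¹) / (θ.ηg t * θ.χbar))

/-- Conditional coverage through a server without RIS. -/
def starCoverage (θ : Params) (γ t y : ℝ) : ℝ := Real.exp (-(γ * (y + θ.γt⁻¹) / θ.ηg t))

theorem measurable_plusCoverage (θ : Params) (γ : ℝ) :
    Measurable fun q : ℝ × ℝ≥0 => θ.plusCoverage γ q.1 q.2 := by
  refine (continuous_erlangTail θ.κhat).measurable.comp ?_
  have h : Measurable fun q : ℝ × ℝ≥0 => θ.ηg q.1 := θ.measurable_ηg.comp measurable_fst
  fun_prop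

theorem measurable_starCoverage (θ : Params) (γ : ℝ) :
    Measurable fun q : ℝ × ℝ≥0 => θ.starCoverage γ q.1 q.2 := by
  unfold starCoverage
  have h : Measurable fun q : ℝ × ℝ≥0 => θ.ηg q.1 := θ.measurable_ηg.comp measurable_fst
  fun_prop

theorem Admissible.plusCoverage_mem_Icc (h : θ.Admissible) {γ t : ℝ} (hγ : 0 ≤ γ) (ht : 0 < t)
    (y : ℝ≥0) : θ.plusCoverage γ t y ∈ Icc 0 1 := by
  have h1 := h.ηg_pos ht
  have h2 := h.χbar_pos
  have h3 := h.γt_pos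
  have h4 : 0 ≤ γ * (y + θ.γt⁻¹) / (θ.ηg t * θ.χbar) := by positivity
  exact ⟨erlangTail_nonneg _ h4, erlangTail_le_one _ h4⟩

theorem Admissible.starCoverage_mem_Icc (h : θ.Admissible) {γ t : ℝ} (hγ : 0 ≤ γ) (ht : 0 < t)
    (y : ℝ≥0) : θ.starCoverage γ t y ∈ Icc 0 1 := by
  have h1 := h.ηg_pos ht
  have h3 := h.γt_pos
  have h4 : 0 ≤ γ * (y + θ.γt⁻¹) / θ.ηg t := by positivity
  exact ⟨(Real.exp_pos _).le, Real.exp_le_one_iff.2 (by linarith)⟩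

/-- `qPlus` is the conditional coverage averaged over an interference whose Laplace transform is
`condLaplace`. -/
theorem Admissible.qPlus_eq_integral (h : θ.Admissible) {γ t : ℝ} (hγ : 0 ≤ γ) (ht : 0 < t)
    {ν : Measure ℝ≥0} [IsFiniteMeasure ν]
    (hν : ∀ s, 0 ≤ s → ∫ y : ℝ≥0, Real.exp (-(s * y)) ∂ν = θ.condLaplace s t) :
    θ.qPlus γ t = ∫ y : ℝ≥0, θ.plusCoverage γ t y ∂ν := by
  have h1 := h.ηg_pos ht
  have h2 := h.χbar_pos
  have h3 := h.γt_pos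
  have hZ : ∀ y : ℝ≥0, 0 ≤ γ * (y + θ.γt⁻¹) / (θ.ηg t * θ.χbar) := fun y => by positivity
  have hZm : Measurable fun y : ℝ≥0 => γ * (y + θ.γt⁻¹) / (θ.ηg t * θ.χbar) := by fun_prop
  -- The transform is known only for nonnegative arguments; agreement near `s = 1` suffices for all
  -- derivatives there.
  have hmgf : (fun s => Real.exp (θ.W γ s t)) =ᶠ[nhds 1]
      mgf (fun y : ℝ≥0 => -(γ * (y + θ.γt⁻¹) / (θ.ηg t * θ.χbar))) ν := by
    filter_upwards [Ioi_mem_nhds one_pos] with s hs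
    have hs0 : 0 < s := hs
    rw [h.exp_W ht, ← hν _ (by positivity), ← integral_const_mul, mgf]
    refine integral_congr_ae (Filter.Eventually.of_forall fun y => ?_)
    simp only
    rw [← Real.exp_add]
    congr 1
    ring
  unfold plusCoverage
  rw [← sum_iteratedDeriv_mgf_eq_integral_erlangTail hZm hZ, qPlus]
  refine Finset.sum_congr rfl fun i _ => ?_
  rw [hmgf.iteratedDeriv_eq]

theorem Admissible.qStar_eq_integral (h : θ.Admissible) {γ t : ℝ} (hγ : 0 ≤ γ) (ht : 0 < t)
    {ν : Measure ℝ≥0}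
    (hν : ∀ s, 0 ≤ s → ∫ y : ℝ≥0, Real.exp (-(s * y)) ∂ν = θ.condLaplace s t) :
    θ.qStar γ t = ∫ y : ℝ≥0, θ.starCoverage γ t y ∂ν := by
  have h1 := h.ηg_pos ht
  rw [h.qStar_eq ht, ← hν _ (by positivity), ← integral_const_mul]
  refine integral_congr_ae (Filter.Eventually.of_forall fun y => ?_)
  simp only [starCoverage]
  rw [← Real.exp_add]
  congr 1
  ring

end Params

/-- Averaging a conditional probability over a kernel and a density. -/
theorem lintegral_kernel_eq_integral {κ : Kernel ℝ ℝ≥0} [IsMarkovKernel κ] {f q : ℝ → ℝ}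
    {C : ℝ → ℝ → ℝ} (hf : Measurable f) (hf0 : ∀ t, 0 < t → 0 ≤ f t)
    (hfi : IntegrableOn f (Ioi 0)) (hC : Measurable fun r : ℝ × ℝ≥0 => C r.1 r.2)
    (hC01 : ∀ t, 0 < t → ∀ y : ℝ≥0, C t y ∈ Icc 0 1)
    (hq : ∀ᵐ t ∂(volume.restrict (Ioi 0)), q t = ∫ y : ℝ≥0, C t y ∂(κ t)) :
    IntegrableOn (fun t => q t * f t) (Ioi 0) ∧ (∀ᵐ t ∂(volume.restrict (Ioi 0)), 0 ≤ q t) ∧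
      ∀ᵐ t ∂(volume.restrict (Ioi 0)),
        ∫⁻ y : ℝ≥0, ENNReal.ofReal (C t y) ∂(κ t) = ENNReal.ofReal (q t) := by
  have hint : ∀ t, 0 < t → Integrable (fun y : ℝ≥0 => C t y) (κ t) := by
    intro t ht
    refine Integrable.mono' (integrable_const 1)
      (hC.comp measurable_prodMk_left).aestronglyMeasurable (Filter.Eventually.of_forall fun y => ?_)
    rw [Real.norm_of_nonneg (hC01 t ht y).1]
    exact (hC01 t ht y).2
  have hm : StronglyMeasurable fun t => ∫ y : ℝ≥0, C t y ∂(κ t) :=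
    hC.stronglyMeasurable.integral_kernel_prod_right'
  have hbound : ∀ᵐ t ∂(volume.restrict (Ioi 0)), q t ∈ Icc 0 1 := by
    filter_upwards [hq, ae_restrict_mem measurableSet_Ioi] with t ht ht0
    rw [ht]
    refine ⟨integral_nonneg fun y => (hC01 t ht0 y).1, ?_⟩
    calc ∫ y : ℝ≥0, C t y ∂(κ t) ≤ ∫ _ : ℝ≥0, 1 ∂(κ t) :=
          integral_mono (hint t ht0) (integrable_const 1) fun y => (hC01 t ht0 y).2
      _ = 1 := by simp
  refine ⟨?_, hbound.mono fun t ht => ht.1, ?_⟩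
  · refine Integrable.mono' hfi ?_ ?_
    · have hqm : AEStronglyMeasurable q (volume.restrict (Ioi 0)) :=
        hm.aestronglyMeasurable.congr (hq.mono fun t ht => ht.symm)
      exact hqm.mul hf.aestronglyMeasurable
    · filter_upwards [hbound, ae_restrict_mem measurableSet_Ioi] with t ht ht0
      rw [Real.norm_of_nonneg (mul_nonneg ht.1 (hf0 t ht0))]
      exact mul_le_of_le_one_left (hf0 t ht0) ht.2
  · filter_upwards [hq, ae_restrict_mem measurableSet_Ioi] with t ht ht0
    rw [ht, ofReal_integral_eq_lintegral_ofReal (hint t ht0)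
      (Filter.Eventually.of_forall fun y => (hC01 t ht0 y).1)]

namespace IsNetwork

variable {Ω : Type*} [MeasurableSpace Ω] {θ : Params} {μ : Measure Ω} [IsProbabilityMeasure μ]
  {X : ℕ → Ω → Plane} {b : ℕ → Ω → Bool} {g Ir : ℕ → Ω → ℂ} {G : ℕ → Ω → ℝ}
  (hnet : IsNetwork θ μ X b g Ir G) (hθ : θ.Admissible)

include hnet hθ

/-- Total mass one is read off from `distPDF` being the density of a probability law. -/
theorem integrableOn_distPDF : IntegrableOn θ.distPDF (Ioi 0) := by
  have hone := congrArg (fun ν : Measure ℝ => ν univ) (hnet.map_nearestDist hθ)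
  simp only [withDensity_apply _ MeasurableSet.univ, Measure.restrict_univ,
    Measure.map_apply hnet.measurable_dist MeasurableSet.univ, preimage_univ, measure_univ] at hone
  refine ⟨θ.measurable_distPDF.aestronglyMeasurable, ?_⟩
  rw [hasFiniteIntegral_iff_ofReal, ← hone]
  · exact ENNReal.one_lt_top
  · filter_upwards [ae_restrict_mem measurableSet_Ioi] with t ht using (hθ.distPDF_pos ht).le

end IsNetwork

section Mixture

variable {Ω : Type*} [MeasurableSpace Ω] {θ : Params} {μ : Measure Ω} [IsProbabilityMeasure μ]
  {R : Ω → ℝ} {I : Ω → ℝ≥0∞}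

/-- The conditional Laplace transform of the interference given the serving distance. -/
theorem ae_condDistrib_interf (hθ : θ.Admissible) (hR : Measurable R) (hI : Measurable I)
    (hfin : ∀ᵐ ω ∂μ, I ω ≠ ∞)
    (hlaw : μ.map R = (volume.restrict (Ioi 0)).withDensity fun t => ENNReal.ofReal (θ.distPDF t))
    (hjoint : ∀ s, 0 ≤ s → ∀ F : ℝ → ℝ≥0∞, Measurable F →
      ∫⁻ ω, F (R ω) * expNeg (ENNReal.ofReal s * I ω) ∂μ =
        ∫⁻ t in Ioi 0, F t * ENNReal.ofReal (θ.distPDF t * θ.condLaplace s t)) :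
    ∀ᵐ t ∂(volume.restrict (Ioi 0)), ∀ s, 0 ≤ s →
      ∫ y : ℝ≥0, Real.exp (-(s * y)) ∂(condDistrib (fun ω => (I ω).toNNReal) R μ t) =
        θ.condLaplace s t := by
  have h := ae_integral_exp_condDistrib (μ := μ) (R := R) (Y := fun ω => (I ω).toNNReal)
    (f := θ.distPDF) (L := θ.condLaplace) hR hI.ennreal_toNNReal θ.measurable_distPDF
    (fun t ht => (hθ.distPDF_pos ht).le) hlaw (fun s hs => hθ.aemeasurable_condLaplace hs)
    (fun s t => (Params.condLaplace_pos s t).le)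
    (fun s t hs ht => (hθ.continuousAt_condLaplace hs ht).comp (f := fun s : ℝ => (s, t))
      (by fun_prop))
    (fun s hs F hF => by
      rw [← hjoint s hs F hF]
      refine lintegral_congr_ae ?_
      filter_upwards [hfin] with ω hω
      have e : ENNReal.ofReal s * I ω = ENNReal.ofReal (s * ((I ω).toNNReal : ℝ)) := by
        rw [ENNReal.ofReal_mul hs, ENNReal.ofReal_coe_nnreal, ENNReal.coe_toNNReal hω]
      rw [e, expNeg_ofReal (by positivity)])
  -- Strict positivity of the density on `(0, ∞)` turns "almost surely for the law of `R`" into "for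
  -- Lebesgue-almost every `t > 0`".
  rw [hlaw, ae_withDensity_iff (by fun_prop)] at h
  filter_upwards [h, ae_restrict_mem measurableSet_Ioi] with t ht ht0
  exact ht (by simpa using hθ.distPDF_pos ht0)

/-- The conditional coverage averaged over the serving distance and the interference. -/
theorem toReal_lintegral_condCoverage (hθ : θ.Admissible) (hR : Measurable R) (hI : Measurable I)
    (hlaw : μ.map R = (volume.restrict (Ioi 0)).withDensity fun t => ENNReal.ofReal (θ.distPDF t))
    (hlap : ∀ᵐ t ∂(volume.restrict (Ioi 0)), ∀ s, 0 ≤ s →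
      ∫ y : ℝ≥0, Real.exp (-(s * y)) ∂(condDistrib (fun ω => (I ω).toNNReal) R μ t) =
        θ.condLaplace s t)
    (hpdf : IntegrableOn θ.distPDF (Ioi 0)) {γ : ℝ} (hγ : 0 ≤ γ) :
    IntegrableOn (fun r => θ.qPlus γ r * θ.distPDF r) (Ioi 0) ∧
    IntegrableOn (fun r => θ.qStar γ r * θ.distPDF r) (Ioi 0) ∧
    (∫⁻ ω, ENNReal.ofReal (θ.condCoverage γ (R ω) (I ω).toReal) ∂μ).toReal =
      θ.p * (∫ r in Ioi (0 : ℝ), θ.qPlus γ r * θ.distPDF r) +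
        (1 - θ.p) * ∫ r in Ioi (0 : ℝ), θ.qStar γ r * θ.distPDF r := by
  have hp0 := hθ.p_nonneg
  have hp1 : 0 ≤ 1 - θ.p := sub_nonneg.2 hθ.p_le_one
  have hf0 : ∀ t, 0 < t → 0 ≤ θ.distPDF t := fun t ht => (hθ.distPDF_pos ht).le
  obtain ⟨hPi, hP0, hPl⟩ := lintegral_kernel_eq_integral
    (κ := condDistrib (fun ω => (I ω).toNNReal) R μ) (q := θ.qPlus γ) (C := θ.plusCoverage γ)
    θ.measurable_distPDF hf0 hpdf (θ.measurable_plusCoverage γ)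
    (fun t ht y => hθ.plusCoverage_mem_Icc hγ ht y) (by
      filter_upwards [hlap, ae_restrict_mem measurableSet_Ioi] with t ht ht0
      exact hθ.qPlus_eq_integral hγ ht0 ht)
  obtain ⟨hSi, hS0, hSl⟩ := lintegral_kernel_eq_integral
    (κ := condDistrib (fun ω => (I ω).toNNReal) R μ) (q := θ.qStar γ) (C := θ.starCoverage γ)
    θ.measurable_distPDF hf0 hpdf (θ.measurable_starCoverage γ)
    (fun t ht y => hθ.starCoverage_mem_Icc hγ ht y) (by
      filter_upwards [hlap, ae_restrict_mem measurableSet_Ioi] with t ht ht0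
      exact hθ.qStar_eq_integral hγ ht0 ht)
  refine ⟨hPi, hSi, ?_⟩
  have hmP := θ.measurable_plusCoverage γ
  have hmS := θ.measurable_starCoverage γ
  have hmC : Measurable fun q : ℝ × ℝ≥0 => ENNReal.ofReal (θ.condCoverage γ q.1 q.2) :=
    ((hmP.const_mul θ.p).add (hmS.const_mul (1 - θ.p))).ennreal_ofReal
  have h1 := lintegral_eq_lintegral_condDistrib (μ := μ) hR hI.ennreal_toNNReal hmC
  have h2 : ∫⁻ ω, ENNReal.ofReal (θ.condCoverage γ (R ω) (I ω).toReal) ∂μ =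
      ∫⁻ t in Ioi 0, ENNReal.ofReal (θ.p * (θ.qPlus γ t * θ.distPDF t) +
        (1 - θ.p) * (θ.qStar γ t * θ.distPDF t)) := by
    refine h1.trans ?_
    rw [hlaw, lintegral_withDensity_eq_lintegral_mul _ θ.measurable_distPDF.ennreal_ofReal
      hmC.lintegral_kernel_prod_right']
    refine lintegral_congr_ae ?_
    filter_upwards [hP0, hPl, hS0, hSl, ae_restrict_mem measurableSet_Ioi] with t hP hPt hS hSt ht
    have hsplit : ∀ y : ℝ≥0, ENNReal.ofReal (θ.condCoverage γ t y) =
        ENNReal.ofReal θ.p * ENNReal.ofReal (θ.plusCoverage γ t y) +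
          ENNReal.ofReal (1 - θ.p) * ENNReal.ofReal (θ.starCoverage γ t y) := by
      intro y
      rw [← ENNReal.ofReal_mul hp0, ← ENNReal.ofReal_mul hp1, ← ENNReal.ofReal_add
        (mul_nonneg hp0 (hθ.plusCoverage_mem_Icc hγ ht y).1)
        (mul_nonneg hp1 (hθ.starCoverage_mem_Icc hγ ht y).1)]
      rfl
    have hmPt : Measurable fun y : ℝ≥0 => ENNReal.ofReal (θ.plusCoverage γ t y) :=
      (hmP.comp measurable_prodMk_left).ennreal_ofReal
    have hmSt : Measurable fun y : ℝ≥0 => ENNReal.ofReal (θ.starCoverage γ t y) :=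
      (hmS.comp measurable_prodMk_left).ennreal_ofReal
    simp only [Pi.mul_apply, hsplit]
    rw [lintegral_add_left (hmPt.const_mul _), lintegral_const_mul _ hmPt,
      lintegral_const_mul _ hmSt, hPt, hSt, ← ENNReal.ofReal_mul hp0, ← ENNReal.ofReal_mul hp1,
      ← ENNReal.ofReal_add (mul_nonneg hp0 hP) (mul_nonneg hp1 hS),
      ← ENNReal.ofReal_mul (hf0 t ht)]
    congr 1
    ring
  have hPc := hPi.const_mul θ.p
  have hSc := hSi.const_mul (1 - θ.p)
  have hsum : IntegrableOn (fun t => θ.p * (θ.qPlus γ t * θ.distPDF t) +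
      (1 - θ.p) * (θ.qStar γ t * θ.distPDF t)) (Ioi 0) := hPc.add hSc
  rw [h2, ← ofReal_integral_eq_lintegral_ofReal hsum, ENNReal.toReal_ofReal]
  · rw [← integral_const_mul, ← integral_const_mul]
    exact integral_add hPc hSc
  · refine integral_nonneg_of_ae ?_
    filter_upwards [hP0, hS0, ae_restrict_mem measurableSet_Ioi] with t hP hS ht
    have := hf0 t ht
    simp only [Pi.zero_apply]
    positivity
  · filter_upwards [hP0, hS0, ae_restrict_mem measurableSet_Ioi] with t hP hS ht
    have := hf0 t ht
    simp only [Pi.zero_apply]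
    positivity

end Mixture

end RISNet

end

theorem proposition5 {Ω : Type*} [MeasurableSpace Ω] (μ : MeasureTheory.Measure Ω)
    [MeasureTheory.IsProbabilityMeasure μ] (θ : RISNet.Params) (hθ : θ.Admissible)
    (X : ℕ → Ω → RISNet.Plane) (b : ℕ → Ω → Bool) (g Ir : ℕ → Ω → ℂ) (G : ℕ → Ω → ℝ)
    (hnet : RISNet.IsNetwork θ μ X b g Ir G) (γ : ℝ) (hγ : 0 ≤ γ) :
    (∀ r : ℝ, 0 < r → ContDiffAt ℝ ((⊤ : ℕ∞) : WithTop ℕ∞) (fun s => Real.exp (θ.W γ s r)) 1) ∧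
    MeasureTheory.IntegrableOn (fun r => θ.qPlus γ r * θ.distPDF r) (Set.Ioi 0) ∧
    MeasureTheory.IntegrableOn (fun r => θ.qStar γ r * θ.distPDF r) (Set.Ioi 0) ∧
    RISNet.coverage θ μ X b g Ir G γ =
      θ.p * (∫ r in Set.Ioi (0 : ℝ), θ.qPlus γ r * θ.distPDF r) +
        (1 - θ.p) * ∫ r in Set.Ioi (0 : ℝ), θ.qStar γ r * θ.distPDF r := by
  have hfin := hnet.ae_totalInterf_ne_top hθ
  have hI := hnet.measurable_totalInterf
  have hlaw := hnet.map_nearestDist hθ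
  have hlap := RISNet.ae_condDistrib_interf hθ hnet.measurable_dist hI hfin hlaw
    fun s hs F hF => hnet.lintegral_dist_expNeg_interf hθ hs hF
  obtain ⟨hP, hS, hcov⟩ := RISNet.toReal_lintegral_condCoverage hθ hnet.measurable_dist hI hlaw
    hlap (hnet.integrableOn_distPDF hθ) hγ
  refine ⟨fun r _ => hθ.contDiffAt_exp_W hγ r, hP, hS, ?_⟩
  rw [← hcov, ← hnet.measure_coverage hθ hγ hfin]
  rfl
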